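/- Let $\alpha,\beta\in\mathbb{R}$ and let $\Gamma\subset\mathbb{R}^2$ be the lattice generated by a basis $b_1,b_2$ of $\mathbb{R}^2$ whose dual basis ($\langle b_i,b_j'\rangle=\delta_{ij}$) is $b_1'=\alpha e_1$, $b_2'=\beta e_1+e_2$ (so $\alpha\neq 0$). Let $\Omega\cong\mathbb{R}^2/\Gamma$ be the elementary cell, and let $H^s_{\rm per}(\Omega)$ denote the Sobolev spaces of complex-valued $\Gamma$-periodic functions. Let $A\colon\mathbb{R}^2\to\mathbb{R}^2$, $V\colon\mathbb{R}^2\to\mathbb{R}$ and $\omega\colon\mathbb{R}^2\to\mathbb{R}$ be $\Gamma$-periodic, with $$A\in C^1,\quad \operatorname{div}A=0,\quad \int_\Omega A\,dx=0,\qquad V\in L^\infty(\Omega),\qquad \omega\in C^2,\quad \omega^2\ge m_g>0 .$$ For $k=(k_1,k_2)\in\mathbb{C}^2$ let $H(k)=(-i\nabla+\bar k-A)^*\omega^2(-i\nabla+k-A)+V$ with domain $H^2_{\rm per}(\Omega)$ in $L^2(\Omega)$; since $A$ is real, this is $\sum_{j=1}^2(-i\partial_j+k_j-A_j)\,\omega^2\,(-i\partial_j+k_j-A_j)+V$.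 In the Hilbert space $H^1_{\rm per}(\Omega)\oplus L^2(\Omega)$ let $T_1(k_2)$ be the unbounded operator with domain $H^2_{\rm per}(\Omega)\oplus H^1_{\rm per}(\Omega)$, $$T_1(k_2)=\begin{pmatrix}0&\omega^{-2}\\ -H(0,k_2)& 2(i\partial_1+A_1)-2i\,\omega^{-1}\partial_1\omega\end{pmatrix}.$$ Then there exists $l\in 2\pi\mathbb{Z}$ (depending only on the lattice and on $A,V,\omega$) such that for every $n\in2\pi\mathbb{Z}$ the spectrum of $T_1(k_2)$ at $$k_2=\frac{\pi}{2}+n+i\Bigl(\frac{\pi}{2}+l\Bigr)\alpha$$ is simple: every point $z$ of the spectrum is an isolated point of the spectrum and an eigenvalue of algebraic multiplicity one, that is, the Riesz projection $-\frac1{2\pi i}\oint_{|\zeta-z|=r}(T_1(k_2)-\zeta)^{-1}d\zeta$ has one-dimensional range for every $r>0$ such that the closed disc of radius $r$ about $z$ contains no other point of the spectrum. -/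

import Mathlib

open MeasureTheory
open scoped ENNReal

noncomputable section

namespace PeriodicSchrodinger

/-! ### Periodic functions, the elementary cell and weak derivatives -/

/-- The Euclidean plane. -/
abbrev Plane : Type := EuclideanSpace ℝ (Fin 2)

/-- `f` is periodic with respect to the lattice generated by the basis `b`. -/
def IsPer (b : Module.Basis (Fin 2) ℝ Plane) {X : Type*} (f : Plane → X) : Prop :=
  ∀ (x : Plane) (j : Fin 2), f (x + b j) = f x

/-- The elementary cell `{t₁ b₁ + t₂ b₂ : 0 ≤ t₁, t₂ < 1}` of the lattice generated by `b`. -/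
abbrev cell (b : Module.Basis (Fin 2) ℝ Plane) : Set Plane := ZSpan.fundamentalDomain b

/-- Lebesgue measure on the elementary cell. -/
abbrev cellMeasure (b : Module.Basis (Fin 2) ℝ Plane) : Measure Plane :=
  volume.restrict (cell b)

/-- The Hilbert space `L²(Ω)` of complex-valued functions on the elementary cell. -/
abbrev L2 (b : Module.Basis (Fin 2) ℝ Plane) : Type := Lp ℂ 2 (cellMeasure b)

/-- The classical partial derivative `∂ⱼ f`. -/
def pd {F : Type*} [NormedAddCommGroup F] [NormedSpace ℝ F] (j : Fin 2) (f : Plane → F)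
    (x : Plane) : F :=
  fderiv ℝ f x (EuclideanSpace.single j 1)

/-- Periodic complex-valued functions of class `C¹`: they serve as test functions and as
multipliers. -/
structure IsC1Per (b : Module.Basis (Fin 2) ℝ Plane) (f : Plane → ℂ) : Prop where
  contDiff : ContDiff ℝ 1 f
  per : IsPer b f

/-- `p = ∂ⱼ u` weakly, in the sense of periodic functions:
`∫_Ω u ∂ⱼφ = - ∫_Ω p φ` for all periodic test functions `φ`. -/
def IsWeakDeriv (b : Module.Basis (Fin 2) ℝ Plane) (j : Fin 2) (u p : L2 b) : Prop :=
  ∀ φ : Plane → ℂ, IsC1Per b φ →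
    ∫ x in cell b, u x * pd j φ x = -∫ x in cell b, p x * φ x

section Basic

variable {b : Module.Basis (Fin 2) ℝ Plane}

theorem IsPer.pd {F : Type*} [NormedAddCommGroup F] [NormedSpace ℝ F] {f : Plane → F}
    (hf : IsPer b f) (j : Fin 2) : IsPer b (pd j f) := by
  intro x i
  have h : (fun y => f (y + b i)) = f := funext fun y => hf y i
  unfold PeriodicSchrodinger.pd
  rw [← fderiv_comp_add_right, h]

theorem continuous_pd {F : Type*} [NormedAddCommGroup F] [NormedSpace ℝ F] {f : Plane → F}
    (hf : ContDiff ℝ 1 f) (j : Fin 2) : Continuous (pd j f) :=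
  (hf.continuous_fderiv one_ne_zero).clm_apply continuous_const

theorem isFiniteMeasure_cell (b : Module.Basis (Fin 2) ℝ Plane) :
    IsFiniteMeasure (cellMeasure b) :=
  ⟨by
    rw [Measure.restrict_apply_univ]
    exact (ZSpan.fundamentalDomain_isBounded b).measure_lt_top⟩

theorem memLp_top_of_continuous {m : Plane → ℂ} (hm : Continuous m) :
    MemLp m ∞ (cellMeasure b) := by
  have hb := ZSpan.fundamentalDomain_isBounded b
  obtain ⟨C, hC⟩ := (hb.isCompact_closure.image hm).isBounded.exists_norm_le
  refine memLp_top_of_bound hm.aestronglyMeasurable C ?_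
  filter_upwards [ae_restrict_mem (ZSpan.fundamentalDomain_measurableSet b)] with x hx
  exact hC _ ⟨x, subset_closure hx, rfl⟩

theorem integrable_mul (u : L2 b) {m : Plane → ℂ} (hm : Continuous m) :
    Integrable (fun x => u x * m x) (cellMeasure b) := by
  have := isFiniteMeasure_cell b
  have h2 : MemLp m 2 (cellMeasure b) := (memLp_top_of_continuous hm).mono_exponent le_top
  exact (Lp.memLp u).integrable_mul h2

theorem integrable_mul_pd (u : L2 b) {φ : Plane → ℂ} (hφ : IsC1Per b φ) (j : Fin 2) :
    Integrable (fun x => u x * pd j φ x) (cellMeasure b) :=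
  integrable_mul u (continuous_pd hφ.contDiff j)

/-- Multiplication by an essentially bounded function, as an operator in `L²(Ω)`. -/
def mulL2 (b : Module.Basis (Fin 2) ℝ Plane) (m : Plane → ℂ) (hm : MemLp m ∞ (cellMeasure b)) :
    L2 b →L[ℂ] L2 b :=
  (ContinuousLinearMap.mul ℂ ℂ).holderL (cellMeasure b) ∞ 2 2 (hm.toLp m)

theorem coeFn_mulL2 {m : Plane → ℂ} (hm : MemLp m ∞ (cellMeasure b)) (u : L2 b) :
    mulL2 b m hm u =ᵐ[cellMeasure b] fun x => m x * u x := by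
  have h1 := ContinuousLinearMap.coeFn_holder (r := 2) (ContinuousLinearMap.mul ℂ ℂ)
    (hm.toLp m) u
  filter_upwards [h1, hm.coeFn_toLp] with x hx hx'
  simp only [mulL2, ContinuousLinearMap.holderL_apply_apply]
  rw [hx, hx']
  simp

theorem integral_mulL2 {m : Plane → ℂ} (hm : MemLp m ∞ (cellMeasure b)) (u : L2 b)
    (φ : Plane → ℂ) :
    ∫ x in cell b, mulL2 b m hm u x * φ x = ∫ x in cell b, u x * (m x * φ x) := by
  refine integral_congr_ae ?_
  filter_upwards [coeFn_mulL2 hm u] with x hx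
  rw [hx]
  ring

theorem integral_add_mul (u v : L2 b) {φ : Plane → ℂ} (hφ : Continuous φ) :
    ∫ x in cell b, (u + v) x * φ x
      = (∫ x in cell b, u x * φ x) + ∫ x in cell b, v x * φ x := by
  rw [← integral_add (integrable_mul u hφ) (integrable_mul v hφ)]
  refine integral_congr_ae ?_
  filter_upwards [Lp.coeFn_add u v] with x hx
  rw [hx, Pi.add_apply, add_mul]

theorem integral_smul_mul (c : ℂ) (u : L2 b) (φ : Plane → ℂ) :
    ∫ x in cell b, (c • u) x * φ x = c * ∫ x in cell b, u x * φ x := by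
  rw [← integral_const_mul]
  refine integral_congr_ae ?_
  filter_upwards [Lp.coeFn_smul c u] with x hx
  rw [hx, Pi.smul_apply, smul_eq_mul, mul_assoc]

theorem integral_zero_mul (φ : Plane → ℂ) :
    ∫ x in cell b, (0 : L2 b) x * φ x = 0 := by
  have := integral_smul_mul 0 (0 : L2 b) φ
  simpa using this

/-- A smooth function supported inside the cell extends to a smooth periodic function. -/
theorem exists_periodization {g : Plane → ℝ} (hg : ContDiff ℝ ((⊤ : ℕ∞) : WithTop ℕ∞) g) (hc : HasCompactSupport g)
    (hs : tsupport g ⊆ interior (cell b)) :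
    ∃ φ : Plane → ℂ, IsC1Per b φ ∧ ∀ x ∈ cell b, φ x = (g x : ℂ) := by
  let L := Submodule.span ℤ (Set.range b)
  let F : L → Plane → ℂ := fun γ x => ((g (x + γ) : ℝ) : ℂ)
  refine ⟨fun x => ∑ᶠ γ : L, F γ x, ⟨?_, ?_⟩, ?_⟩
  · rw [← contMDiff_iff_contDiff]
    refine contMDiff_finsum (fun γ => ?_) ?_
    · rw [contMDiff_iff_contDiff]
      exact Complex.ofRealCLM.contDiff.comp
        ((hg.of_le (by exact_mod_cast le_top)).comp (contDiff_id.add contDiff_const))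
    · intro x
      refine ⟨Metric.ball x 1, Metric.ball_mem_nhds x one_pos, ?_⟩
      obtain ⟨C, hC⟩ := hc.isCompact.isBounded.exists_norm_le
      have hbd : Bornology.IsBounded {γ : Plane | ∃ y, y + γ ∈ tsupport g ∧ y ∈ Metric.ball x 1} := by
        refine (Metric.isBounded_closedBall (x := (0 : Plane)) (r := C + (1 + ‖x‖))).subset ?_
        rintro γ ⟨y, hy, hyb⟩
        rw [mem_closedBall_zero_iff]
        have h1 := hC _ hy
        have h2 : ‖y‖ < 1 + ‖x‖ := by
          have := norm_le_norm_add_norm_sub' y x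
          rw [mem_ball_iff_norm] at hyb
          linarith
        have h3 : ‖γ‖ ≤ ‖y + γ‖ + ‖y‖ := by
          simpa using norm_sub_le (y + γ) y
        linarith
      have hfin := ZSpan.setFinite_inter b hbd
      refine Set.Finite.of_finite_image (f := fun γ : L => (γ : Plane)) (hfin.subset ?_)
        Subtype.coe_injective.injOn
      rintro _ ⟨γ, ⟨y, hy, hyb⟩, rfl⟩
      refine ⟨⟨y, subset_tsupport g ?_, hyb⟩, γ.2⟩
      simp only [F, Function.mem_support] at hy ⊢
      exact_mod_cast hy
  · intro x j
    have hj : b j ∈ L := Submodule.subset_span ⟨j, rfl⟩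
    refine finsum_eq_of_bijective (fun γ : L => γ + ⟨b j, hj⟩)
      (Equiv.addRight (⟨b j, hj⟩ : L)).bijective (fun γ => ?_)
    simp only [F, Submodule.coe_add]
    congr 2
    abel
  · intro x hx
    change ∑ᶠ γ : L, F γ x = _
    rw [finsum_eq_single _ (0 : L)]
    · simp [F]
    · intro γ hγ
      by_contra h
      apply hγ
      have hmem : x + (γ : Plane) ∈ cell b := by
        refine interior_subset (hs (subset_tsupport g ?_))
        simp only [F] at h
        rw [Function.mem_support]
        exact_mod_cast h
      have h1 := (ZSpan.fract_eq_self (b := b)).2 hmem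
      rw [ZSpan.fract_add_ZSpan b x γ.2, (ZSpan.fract_eq_self (b := b)).2 hx] at h1
      have : (γ : Plane) = 0 := by simpa using h1.symm
      exact Subtype.ext this

/-- An `L²` function orthogonal to all periodic test functions is zero. -/
theorem eq_zero_of_forall_integral (u : L2 b)
    (h : ∀ φ : Plane → ℂ, IsC1Per b φ → ∫ x in cell b, u x * φ x = 0) : u = 0 := by
  have := isFiniteMeasure_cell b
  have hint : IntegrableOn u (cell b) volume := (Lp.memLp u).integrable (by norm_num)
  have hcvx : Convex ℝ (cell b) := by
    intro x hx y hy s t hs ht hst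
    rw [ZSpan.mem_fundamentalDomain] at hx hy ⊢
    intro i
    have := (convex_Ico (0 : ℝ) 1) (hx i) (hy i) hs ht hst
    simpa using this
  have hae : interior (cell b) =ᵐ[volume] cell b := by
    refine Filter.EventuallyLE.antisymm (interior_subset.eventuallyLE) ?_
    rw [ae_le_set]
    refine measure_mono_null ?_ (hcvx.addHaar_frontier volume)
    exact fun x hx => ⟨subset_closure hx.1, hx.2⟩
  have key := isOpen_interior.ae_eq_zero_of_integral_contDiff_smul_eq_zero
    (U := interior (cell b)) (μ := (volume : Measure Plane)) (f := u)
    ((hint.mono_set interior_subset).locallyIntegrableOn) (by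
      intro g hg hc hs
      obtain ⟨φ, hφ, hφg⟩ := exists_periodization (b := b) hg hc hs
      have h0 := h φ hφ
      rw [← h0, ← setIntegral_eq_integral_of_forall_compl_eq_zero (s := cell b)]
      · refine setIntegral_congr_fun (ZSpan.fundamentalDomain_measurableSet b) ?_
        intro x hx
        simp only [hφg x hx, Complex.real_smul]
        ring
      · intro x hx
        have : g x = 0 := by
          by_contra hne
          exact hx (interior_subset (hs (subset_tsupport g hne)))
        simp [this])
  rw [Lp.eq_zero_iff_ae_eq_zero]
  rw [Filter.EventuallyEq, ae_restrict_iff' (ZSpan.fundamentalDomain_measurableSet b)]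
  filter_upwards [key, hae.mem_iff] with x hx hx' hxc
  exact hx (hx'.2 hxc)

theorem IsWeakDeriv.unique {j : Fin 2} {u p q : L2 b} (hp : IsWeakDeriv b j u p)
    (hq : IsWeakDeriv b j u q) : p = q := by
  rw [← sub_eq_zero]
  refine eq_zero_of_forall_integral _ fun φ hφ => ?_
  have e : p - q = p + (-1 : ℂ) • q := by
    rw [neg_one_smul, sub_eq_add_neg]
  rw [e, integral_add_mul _ _ hφ.contDiff.continuous, integral_smul_mul]
  have h1 := hp φ hφ
  have h2 := hq φ hφ
  rw [h1] at h2
  linear_combination -h2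

theorem IsWeakDeriv.add {j : Fin 2} {u p v q : L2 b} (hp : IsWeakDeriv b j u p)
    (hq : IsWeakDeriv b j v q) : IsWeakDeriv b j (u + v) (p + q) := by
  intro φ hφ
  rw [integral_add_mul _ _ (continuous_pd hφ.contDiff j),
    integral_add_mul _ _ hφ.contDiff.continuous, hp φ hφ, hq φ hφ]
  ring

theorem IsWeakDeriv.smul {j : Fin 2} {u p : L2 b} (c : ℂ) (hp : IsWeakDeriv b j u p) :
    IsWeakDeriv b j (c • u) (c • p) := by
  intro φ hφ
  rw [integral_smul_mul, integral_smul_mul, hp φ hφ]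
  ring

theorem IsWeakDeriv.zero {j : Fin 2} : IsWeakDeriv b j (0 : L2 b) 0 := by
  intro φ _
  rw [integral_zero_mul, integral_zero_mul, neg_zero]

theorem pd_mul {f g : Plane → ℂ} (hf : ContDiff ℝ 1 f) (hg : ContDiff ℝ 1 g) (j : Fin 2)
    (x : Plane) : pd j (fun y => f y * g y) x = f x * pd j g x + pd j f x * g x := by
  have h := fderiv_fun_mul (hf.differentiable one_ne_zero x) (hg.differentiable one_ne_zero x)
  simp only [pd, h, add_apply, smul_apply, smul_eq_mul]
  ring

/-- The product rule `∂ⱼ(m u) = m ∂ⱼu + (∂ⱼm) u` for periodic `m` of class `C¹`. -/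
theorem IsWeakDeriv.mul {j : Fin 2} {u p : L2 b} (h : IsWeakDeriv b j u p) {m : Plane → ℂ}
    (hm : IsC1Per b m) :
    IsWeakDeriv b j (mulL2 b m (memLp_top_of_continuous hm.contDiff.continuous) u)
      (mulL2 b m (memLp_top_of_continuous hm.contDiff.continuous) p
        + mulL2 b (pd j m) (memLp_top_of_continuous (continuous_pd hm.contDiff j)) u) := by
  intro φ hφ
  have hmφ : IsC1Per b (fun y => m y * φ y) :=
    ⟨hm.contDiff.mul hφ.contDiff, fun x i => by
      rw [hm.per x i, hφ.per x i]⟩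
  have h1 := h _ hmφ
  have hcm := hm.contDiff.continuous
  have hcφ := hφ.contDiff.continuous
  have hcm' := continuous_pd hm.contDiff j
  have hcφ' := continuous_pd hφ.contDiff j
  rw [integral_add_mul _ _ hcφ, integral_mulL2, integral_mulL2, integral_mulL2]
  have h2 : ∫ x in cell b, u x * pd j (fun y => m y * φ y) x
      = (∫ x in cell b, u x * (m x * pd j φ x)) + ∫ x in cell b, u x * (pd j m x * φ x) := by
    have i1 : Integrable (fun x => u x * (m x * pd j φ x)) (cellMeasure b) :=
      integrable_mul u (hcm.mul hcφ')
    have i2 : Integrable (fun x => u x * (pd j m x * φ x)) (cellMeasure b) :=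
      integrable_mul u (hcm'.mul hcφ)
    rw [← integral_add i1 i2]
    refine integral_congr_ae (Filter.Eventually.of_forall fun x => ?_)
    simp only [pd_mul hm.contDiff hφ.contDiff]
    ring
  rw [h2] at h1
  linear_combination h1

end Basic

/-! ### The periodic Sobolev spaces -/

section Sobolev

variable (b : Module.Basis (Fin 2) ℝ Plane)

/-- The Sobolev space `H¹_per(Ω)`. A function `u` is stored together with its weak partial
derivatives as the triple `(u, ∂₁u, ∂₂u)`, so that the inherited norm is
`(‖u‖² + ‖∂₁u‖² + ‖∂₂u‖²)^{1/2}`. -/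
def H1 : Submodule ℂ (PiLp 2 (fun _ : Fin 3 => L2 b)) where
  carrier := {F | ∀ j : Fin 2, IsWeakDeriv b j (F 0) (F j.succ)}
  add_mem' hF hG j := (hF j).add (hG j)
  zero_mem' _ := IsWeakDeriv.zero
  smul_mem' c _ hF j := (hF j).smul c

/-- The inclusion `H¹_per(Ω) → L²(Ω)`. -/
def H1.val : H1 b →ₗ[ℂ] L2 b where
  toFun u := u.1 0
  map_add' _ _ := rfl
  map_smul' _ _ := rfl

/-- The weak derivative `∂ⱼ : H¹_per(Ω) → L²(Ω)`. -/
def H1.deriv (j : Fin 2) : H1 b →ₗ[ℂ] L2 b where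
  toFun u := u.1 j.succ
  map_add' _ _ := rfl
  map_smul' _ _ := rfl

theorem H1.val_injective : Function.Injective (H1.val b) := by
  intro u w h
  have h0 : u.1 0 = w.1 0 := h
  refine Subtype.ext (PiLp.ext fun i => ?_)
  refine Fin.cases h0 (fun j => ?_) i
  have hu := u.2 j
  rw [h0] at hu
  exact hu.unique (w.2 j)

/-- Multiplication by a periodic function of class `C¹`, as an operator in `H¹_per(Ω)`. -/
def mulH1 (m : Plane → ℂ) (hm : IsC1Per b m) : H1 b →ₗ[ℂ] H1 b where
  toFun u :=
    ⟨WithLp.toLp 2 (Fin.cases (motive := fun _ => L2 b)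
        (mulL2 b m (memLp_top_of_continuous hm.contDiff.continuous) (H1.val b u))
        (fun j => mulL2 b m (memLp_top_of_continuous hm.contDiff.continuous) (H1.deriv b j u)
          + mulL2 b (pd j m) (memLp_top_of_continuous (continuous_pd hm.contDiff j))
              (H1.val b u))),
      fun j => (u.2 j).mul hm⟩
  map_add' u w := H1.val_injective b (map_add (mulL2 b m _) (H1.val b u) (H1.val b w))
  map_smul' c u := H1.val_injective b (map_smul (mulL2 b m _) c (H1.val b u))

/-- The Sobolev space `H²_per(Ω)`: those `u ∈ H¹_per(Ω)` with `∂₁u, ∂₂u ∈ H¹_per(Ω)`. -/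
def H2 : Submodule ℂ (H1 b) :=
  ⨅ j : Fin 2, (LinearMap.range (H1.val b)).comap (H1.deriv b j)

/-- The element of `H¹_per(Ω)` represented by a function in `L²(Ω)` that lies in this space. -/
def toH1 : LinearMap.range (H1.val b) →ₗ[ℂ] H1 b :=
  (LinearEquiv.ofInjective (H1.val b) (H1.val_injective b)).symm.toLinearMap

/-- The weak derivative `∂ⱼ : H²_per(Ω) → H¹_per(Ω)`. -/
def H2.deriv (j : Fin 2) : H2 b →ₗ[ℂ] H1 b :=
  toH1 b ∘ₗ ((H1.deriv b j ∘ₗ (H2 b).subtype).codRestrict (LinearMap.range (H1.val b))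
    fun u => (Submodule.mem_iInf _).1 u.2 j)

theorem H2.val_deriv (j : Fin 2) (u : H2 b) :
    H1.val b (H2.deriv b j u) = H1.deriv b j (u : H1 b) :=
  congrArg Subtype.val ((LinearEquiv.ofInjective (H1.val b) (H1.val_injective b)).apply_symm_apply _)

/-- `H¹_per(Ω)` is complete, hence a Hilbert space. -/
instance H1.completeSpace : CompleteSpace (H1 b) := by
  have := isFiniteMeasure_cell b
  have hcont : ∀ m : Plane → ℂ, Continuous m →
      Continuous fun u : L2 b => ∫ x in cell b, u x * m x := by
    intro m hm
    have hconj : MemLp (fun x => (starRingEnd ℂ) (m x)) 2 (cellMeasure b) :=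
      (memLp_top_of_continuous (Complex.continuous_conj.comp hm)).mono_exponent le_top
    have e : (fun u : L2 b => ∫ x in cell b, u x * m x)
        = fun u => inner ℂ (hconj.toLp _) u := by
      funext u
      rw [L2.inner_def]
      refine integral_congr_ae ?_
      filter_upwards [hconj.coeFn_toLp] with x hx
      rw [hx]
      simp
    rw [e]
    exact continuous_const.inner continuous_id
  suffices key : IsClosed
      ((H1 b : Submodule ℂ (PiLp 2 (fun _ : Fin 3 => L2 b))) : Set (PiLp 2 (fun _ : Fin 3 => L2 b)))
    from key.completeSpace_coe
  have e : ((H1 b : Submodule ℂ (PiLp 2 (fun _ : Fin 3 => L2 b))) :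
        Set (PiLp 2 (fun _ : Fin 3 => L2 b)))
      = ⋂ (j : Fin 2) (φ : Plane → ℂ) (_ : IsC1Per b φ),
        {F | ∫ x in cell b, F 0 x * pd j φ x = -∫ x in cell b, F j.succ x * φ x} := by
    ext F
    simp only [Set.mem_iInter]
    rfl
  rw [e]
  refine isClosed_iInter fun j => isClosed_iInter fun φ => isClosed_iInter fun hφ => ?_
  exact isClosed_eq
    ((hcont _ (continuous_pd hφ.contDiff j)).comp (PiLp.continuous_apply 2 _ 0))
    ((hcont _ hφ.contDiff.continuous).comp (PiLp.continuous_apply 2 _ j.succ)).neg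

end Sobolev

/-! ### The coefficients and the operators -/

/-- The coefficients of the operator: a periodic magnetic potential `A` of class `C¹` with
`div A = 0` and mean value zero, a periodic electric potential `V ∈ L^∞(Ω)`, and a periodic
function `ω` of class `C²` with `ω² ≥ m_g > 0`. -/
structure Coefficients (b : Module.Basis (Fin 2) ℝ Plane) where
  A : Plane → Plane
  V : Plane → ℝ
  ω : Plane → ℝ
  A_contDiff : ContDiff ℝ 1 A
  A_per : IsPer b A
  A_div : ∀ x, ∑ j : Fin 2, pd j A x j = 0
  A_mean : ∫ x in cell b, A x = 0
  V_per : IsPer b V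
  V_memLp : MemLp V ∞ (cellMeasure b)
  ω_contDiff : ContDiff ℝ 2 ω
  ω_per : IsPer b ω
  ω_lower : ∃ mg : ℝ, 0 < mg ∧ ∀ x, mg ≤ ω x ^ 2

namespace Coefficients

variable {b : Module.Basis (Fin 2) ℝ Plane} (c : Coefficients b)

theorem ω_ne_zero (x : Plane) : c.ω x ≠ 0 := by
  obtain ⟨mg, h0, h⟩ := c.ω_lower
  intro hx
  have := h x
  rw [hx] at this
  norm_num at this
  linarith

theorem isC1Per_ωsq : IsC1Per b (fun x => (((c.ω x) ^ 2 : ℝ) : ℂ)) where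
  contDiff := Complex.ofRealCLM.contDiff.comp ((c.ω_contDiff.of_le (by norm_num)).pow 2)
  per x j := by
    change ((c.ω (x + b j) ^ 2 : ℝ) : ℂ) = _
    rw [c.ω_per x j]

theorem isC1Per_ωsq_inv : IsC1Per b (fun x => ((((c.ω x) ^ 2)⁻¹ : ℝ) : ℂ)) where
  contDiff := Complex.ofRealCLM.contDiff.comp
    (((c.ω_contDiff.of_le (by norm_num)).pow 2).inv fun x => pow_ne_zero 2 (c.ω_ne_zero x))
  per x j := by
    change (((c.ω (x + b j) ^ 2)⁻¹ : ℝ) : ℂ) = _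
    rw [c.ω_per x j]

theorem isC1Per_sub_A (z : ℂ) (j : Fin 2) : IsC1Per b (fun x => z - (c.A x j : ℂ)) where
  contDiff := contDiff_const.sub (Complex.ofRealCLM.contDiff.comp
    ((EuclideanSpace.proj (𝕜 := ℝ) j).contDiff.comp c.A_contDiff))
  per x i := by
    change z - (c.A (x + b i) j : ℂ) = _
    rw [c.A_per x i]

theorem memLp_V : MemLp (fun x => (c.V x : ℂ)) ∞ (cellMeasure b) :=
  c.V_memLp.ofReal

theorem memLp_lowerOrder : MemLp
    (fun x => 2 * (c.A x 0 : ℂ) - 2 * Complex.I * (((c.ω x)⁻¹ * pd 0 c.ω x : ℝ) : ℂ)) ∞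
    (cellMeasure b) := by
  refine memLp_top_of_continuous ?_
  have h1 : Continuous fun x => c.A x 0 :=
    (EuclideanSpace.proj (𝕜 := ℝ) (0 : Fin 2)).continuous.comp c.A_contDiff.continuous
  have h2 : Continuous fun x => (c.ω x)⁻¹ * pd 0 c.ω x :=
    (c.ω_contDiff.continuous.inv₀ c.ω_ne_zero).mul
      (continuous_pd (c.ω_contDiff.of_le (by norm_num)) 0)
  exact (continuous_const.mul (Complex.continuous_ofReal.comp h1)).sub
    (continuous_const.mul (Complex.continuous_ofReal.comp h2))

/-- The first order operator `-i ∂ⱼ + kⱼ - Aⱼ : H¹_per(Ω) → L²(Ω)`. -/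
def momentum (k : Fin 2 → ℂ) (j : Fin 2) : H1 b →ₗ[ℂ] L2 b :=
  (-Complex.I) • H1.deriv b j
    + H1.val b ∘ₗ mulH1 b (fun x => k j - (c.A x j : ℂ)) (c.isC1Per_sub_A (k j) j)

/-- The first order operator `-i ∂ⱼ + kⱼ - Aⱼ : H²_per(Ω) → H¹_per(Ω)`. -/
def momentum' (k : Fin 2 → ℂ) (j : Fin 2) : H2 b →ₗ[ℂ] H1 b :=
  (-Complex.I) • H2.deriv b j
    + mulH1 b (fun x => k j - (c.A x j : ℂ)) (c.isC1Per_sub_A (k j) j) ∘ₗ (H2 b).subtype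

/-- The operator `H(k) = (-i∇ + k̄ - A)^* ω² (-i∇ + k - A) + V` on `H²_per(Ω)`, for complex `k`.
As `A` is real, the adjoint of `-i∂ⱼ + k̄ⱼ - Aⱼ` is `-i∂ⱼ + kⱼ - Aⱼ`, so that
`H(k) = ∑ⱼ (-i∂ⱼ + kⱼ - Aⱼ) ω² (-i∂ⱼ + kⱼ - Aⱼ) + V`. -/
def hamiltonian (k : Fin 2 → ℂ) : H2 b →ₗ[ℂ] L2 b :=
  (∑ j : Fin 2, c.momentum k j ∘ₗ
      mulH1 b (fun x => (((c.ω x) ^ 2 : ℝ) : ℂ)) c.isC1Per_ωsq ∘ₗ c.momentum' k j)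
    + (mulL2 b (fun x => (c.V x : ℂ)) c.memLp_V).toLinearMap ∘ₗ H1.val b ∘ₗ (H2 b).subtype

/-- The operator `2(i∂₁ + A₁) - 2i ω⁻¹ ∂₁ω : H¹_per(Ω) → L²(Ω)`. -/
def corner : H1 b →ₗ[ℂ] L2 b :=
  (2 * Complex.I) • H1.deriv b 0
    + (mulL2 b
        (fun x => 2 * (c.A x 0 : ℂ) - 2 * Complex.I * (((c.ω x)⁻¹ * pd 0 c.ω x : ℝ) : ℂ))
        c.memLp_lowerOrder).toLinearMap ∘ₗ H1.val b

end Coefficients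

/-- The Hilbert space `H¹_per(Ω) ⊕ L²(Ω)`. -/
abbrev StateSpace (b : Module.Basis (Fin 2) ℝ Plane) : Type := WithLp 2 (H1 b × L2 b)

/-- The subspace `H²_per(Ω) ⊕ H¹_per(Ω)` of `H¹_per(Ω) ⊕ L²(Ω)`. -/
def T1Domain (b : Module.Basis (Fin 2) ℝ Plane) : Submodule ℂ (StateSpace b) :=
  ((H2 b).prod (LinearMap.range (H1.val b))).comap (WithLp.linearEquiv 2 ℂ (H1 b × L2 b)).toLinearMap

/-- The first component of an element of the domain, in `H²_per(Ω)`. -/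
def T1Domain.fst (b : Module.Basis (Fin 2) ℝ Plane) : T1Domain b →ₗ[ℂ] H2 b where
  toFun X := ⟨X.1.fst, X.2.1⟩
  map_add' _ _ := rfl
  map_smul' _ _ := rfl

/-- The second component of an element of the domain, in `H¹_per(Ω)`. -/
def T1Domain.snd (b : Module.Basis (Fin 2) ℝ Plane) : T1Domain b →ₗ[ℂ] H1 b :=
  toH1 b ∘ₗ
    { toFun := fun X => (⟨X.1.snd, X.2.2⟩ : LinearMap.range (H1.val b))
      map_add' := fun _ _ => rfl
      map_smul' := fun _ _ => rfl }

/-- The unbounded operator in `H¹_per(Ω) ⊕ L²(Ω)` with domain `H²_per(Ω) ⊕ H¹_per(Ω)` given by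
`T₁(k₂, λ)(u, v) = (ω⁻² v, -(H(0, k₂) - λ) u + (2(i∂₁ + A₁) - 2i ω⁻¹ ∂₁ω) v)`. -/
def Coefficients.T1 {b : Module.Basis (Fin 2) ℝ Plane} (c : Coefficients b) (k₂ lam : ℂ) :
    StateSpace b →ₗ.[ℂ] StateSpace b where
  domain := T1Domain b
  toFun := (WithLp.linearEquiv 2 ℂ (H1 b × L2 b)).symm.toLinearMap ∘ₗ LinearMap.prod
    (mulH1 b (fun x => ((((c.ω x) ^ 2)⁻¹ : ℝ) : ℂ)) c.isC1Per_ωsq_inv ∘ₗ T1Domain.snd b)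
    (-(c.hamiltonian ![0, k₂] - lam • (H1.val b ∘ₗ (H2 b).subtype)) ∘ₗ T1Domain.fst b
      + c.corner ∘ₗ T1Domain.snd b)

/-! ### Spectra of unbounded operators -/

section Spectral

variable {E : Type*} [NormedAddCommGroup E] [NormedSpace ℂ E]

/-- The bounded operator `R` is the inverse `(T - z)⁻¹`. -/
structure IsResolventAt (T : E →ₗ.[ℂ] E) (z : ℂ) (R : E →L[ℂ] E) : Prop where
  right_inv : ∀ f : E, ∃ x : T.domain, (x : E) = R f ∧ T x - z • (x : E) = f
  left_inv : ∀ x : T.domain, R (T x - z • (x : E)) = x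

/-- The spectrum of an unbounded operator: the complement of the set of those `z` for which
`T - z` has a bounded everywhere defined inverse. -/
def spec (T : E →ₗ.[ℂ] E) : Set ℂ := {z | ¬ ∃ R : E →L[ℂ] E, IsResolventAt T z R}

open Classical in
/-- The resolvent `(T - z)⁻¹` (zero, by convention, if `z` is in the spectrum). -/
def resolv (T : E →ₗ.[ℂ] E) (z : ℂ) : E →L[ℂ] E :=
  if h : ∃ R : E →L[ℂ] E, IsResolventAt T z R then h.choose else 0

/-- The Riesz projection `-(2πi)⁻¹ ∮_{|ζ - z| = r} (T - ζ)⁻¹ dζ`. -/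
def rieszProj (T : E →ₗ.[ℂ] E) (z : ℂ) (r : ℝ) : E →L[ℂ] E :=
  -((2 * Real.pi * Complex.I : ℂ)⁻¹ • ∮ ζ in C(z, r), resolv T ζ)

/-- `z` is an isolated point of the spectrum of `T` and an eigenvalue of algebraic multiplicity
one: the range of the Riesz projection along any circle around `z` that separates `z` from the rest
of the spectrum is one-dimensional. -/
structure IsSimpleEigenvalue (T : E →ₗ.[ℂ] E) (z : ℂ) : Prop where
  isolated : ∃ r : ℝ, 0 < r ∧ spec T ∩ Metric.closedBall z r = {z}
  eigenvalue : ∃ x : T.domain, (x : E) ≠ 0 ∧ T x = z • (x : E)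
  multiplicity : ∀ r : ℝ, 0 < r → spec T ∩ Metric.closedBall z r = {z} →
    Module.finrank ℂ (LinearMap.range (rieszProj T z r).toLinearMap) = 1

/-- The spectrum of `T` is simple: it consists of isolated simple eigenvalues. -/
def HasSimpleSpectrum (T : E →ₗ.[ℂ] E) : Prop := ∀ z ∈ spec T, IsSimpleEigenvalue T z

end Spectral

/-- The basis `b₁' = α e₁`, `b₂' = β e₁ + e₂` of the dual lattice. -/
def dualVec (α β : ℝ) : Fin 2 → Plane := ![!₂[α, 0], !₂[β, 1]]

end PeriodicSchrodinger

end

open MeasureTheory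
open scoped ENNReal

noncomputable section

namespace PeriodicSchrodinger

/-! ### Resolvents of unbounded operators -/

section Resolvent

variable {E : Type*} [NormedAddCommGroup E] [NormedSpace ℂ E] {T : E →ₗ.[ℂ] E} {z : ℂ}

/-! `T1` linearizes the quadratic pencil z ↦ H(z, k₂). Eliminating the second component turns (T₁ -
z)(u, v) = (f, g) into -H(z, k₂) u = g - (C - z)(ω² f), so an inverse of H(z, k₂) yields the
resolvent of T₁ at z (`isResolventAt_T1`). It remains to invert H(z, k₂).

Since div A = 0 and A has mean zero, A = (∂₂φ, -∂₁φ) with φ periodic (`exists_isGauge`). In two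
dimensions this gives, for s = ±1, the factorization H(z, k₂) = θ P₋ₛ e^{2sφ} Pₛ θ + Q with θ = ω
e^{-sφ}, constant-coefficient Cauchy–Riemann operators P±ₛ and a bounded Q independent of z and k₂
(`hamiltonian_factorization`). On the Fourier side P±ₛ are multiplications by `crSym`, in which z
appears as an additive constant, so each index m contributes one simple zero in z to each symbol.

Two arithmetic facts and one estimate control these zeros. Zeros of the same symbol keep a fixed
distance, because the dual lattice is discrete (`le_norm_crSym_sub`). Zeros of opposite symbols are
at least π apart, because Re k₂ = π/2 + 2πn makes the imaginary parts of the zeros differ by odd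
multiples of π (`le_norm_crSym_sub_neg`). Finally, the two symbols are shifted against each other by
2|Im k₂| in the real direction. After approximation of e^{-2sφ} by a trigonometric polynomial, a
large shift forces one factor of each product of symbols to be large, so Pₛ⁻¹ e^{-2sφ} P₋ₛ⁻¹ has
small norm wherever both symbols stay away from zero (`exists_norm_principalInv_le`). There Q is
absorbed by a Neumann series.

Hence points far from all zeros are not in the spectrum (`notMem_spec_of_le`). Near a zero with
index m₀, the sign s is chosen so that the vanishing symbol belongs to Pₛ, and its value at m₀ is
moved away from zero by adding t. This changes H by an operator of rank one and makes it invertible;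
undoing the change gives the inverse of H wherever a scalar determinant d(z) is nonzero
(`isInverseOf_hamiltonian`). The determinant is uniformly close to 1 - t/(p + t), where p is the
original symbol value at m₀ (`norm_det_sub_le`), and a Cauchy estimate shows d' ≠ 0
(`deriv_ne_zero_of_near`). The resolvent is therefore a regular family plus d⁻¹ times a family of
rank one with d' ≠ 0, which forces a one-dimensional Riesz projection
(`isSimpleEigenvalue_of_local`).

The threshold for |Im k₂| does not depend on Re k₂, so a single l serves all n. -/

theorem IsResolventAt.unique {R R' : E →L[ℂ] E} (h : IsResolventAt T z R)
    (h' : IsResolventAt T z R') : R = R' := by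
  ext f
  obtain ⟨x, hx, hxf⟩ := h.right_inv f
  rw [← hx, ← h'.left_inv x, hxf]

theorem IsResolventAt.notMem_spec {R : E →L[ℂ] E} (h : IsResolventAt T z R) : z ∉ spec T :=
  fun hz => hz ⟨R, h⟩

theorem IsResolventAt.resolv_eq {R : E →L[ℂ] E} (h : IsResolventAt T z R) : resolv T z = R := by
  have hex : ∃ R : E →L[ℂ] E, IsResolventAt T z R := ⟨R, h⟩
  rw [resolv, dif_pos hex]
  exact hex.choose_spec.unique h

theorem isResolventAt_resolv (hz : z ∉ spec T) : IsResolventAt T z (resolv T z) := by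
  have hex : ∃ R : E →L[ℂ] E, IsResolventAt T z R := not_not.1 hz
  rw [resolv, dif_pos hex]
  exact hex.choose_spec

/-- On the domain, T - ζ = (1 - (ζ - z) R)(T - z); inverting both factors gives the formula. It
yields openness of the resolvent set and, through analyticity of inversion, holomorphy of the
resolvent. -/
theorem IsResolventAt.neumann {R : E →L[ℂ] E} (h : IsResolventAt T z R) {ζ : ℂ}
    (hζ : IsUnit (1 - (ζ - z) • R)) :
    IsResolventAt T ζ (R * Ring.inverse (1 - (ζ - z) • R)) := by
  constructor
  · intro f
    obtain ⟨x, hx, hxf⟩ := h.right_inv (Ring.inverse (1 - (ζ - z) • R) f)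
    refine ⟨x, hx, ?_⟩
    have h1 := DFunLike.congr_fun (Ring.mul_inverse_cancel _ hζ) f
    rw [mul_apply_eq_comp, sub_apply,
      smul_apply, one_apply_eq_self,
      one_apply_eq_self, ← hx, ← hxf] at h1
    rw [← h1]
    module
  · intro x
    have h1 := h.left_inv x
    have h2 : T x - ζ • (x : E) = (1 - (ζ - z) • R) (T x - z • (x : E)) := by
      rw [sub_apply, smul_apply, h1,
        one_apply_eq_self]
      module
    rw [h2, mul_apply_eq_comp, ← mul_apply_eq_comp (Ring.inverse _),
      Ring.inverse_mul_cancel _ hζ, one_apply_eq_self, h1]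

variable [CompleteSpace E]

theorem IsResolventAt.notMem_spec_of_norm_lt {R : E →L[ℂ] E} (h : IsResolventAt T z R) {ζ : ℂ}
    (hζ : ‖(ζ - z) • R‖ < 1) : ζ ∉ spec T :=
  (h.neumann (isUnit_one_sub_of_norm_lt_one hζ)).notMem_spec

theorem differentiableAt_resolv (hz : z ∉ spec T) : DifferentiableAt ℂ (resolv T) z := by
  have h := isResolventAt_resolv hz
  set R := resolv T z with hR
  have hcont : Continuous fun ζ : ℂ => ‖(ζ - z) • R‖ := by fun_prop
  have hev : ∀ᶠ ζ in nhds z, ‖(ζ - z) • R‖ < 1 :=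
    hcont.continuousAt.eventually_lt continuousAt_const (by simp)
  have heq : resolv T =ᶠ[nhds z] fun ζ => R * Ring.inverse (1 - (ζ - z) • R) := by
    filter_upwards [hev] with ζ hζ
    exact (h.neumann (isUnit_one_sub_of_norm_lt_one hζ)).resolv_eq
  refine DifferentiableAt.congr_of_eventuallyEq ?_ heq
  have h1 : DifferentiableAt ℂ (Ring.inverse : (E →L[ℂ] E) → _) (1 - (z - z) • R) :=
    differentiableAt_inverse (by simp)
  have h2 : DifferentiableAt ℂ (fun ζ : ℂ => 1 - (ζ - z) • R) z := by fun_prop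
  exact (DifferentiableAt.comp z h1 h2).const_mul R

/-- If the resolvent near a point `z` of the spectrum is the sum of a regular term and of
`d⁻¹ F`, where `d` has a simple zero at `z` and `F(z)` has rank one, then `z` is a simple
eigenvalue. -/
theorem isSimpleEigenvalue_of_local (hz : z ∈ spec T) {N F : ℂ → E →L[ℂ] E} {d : ℂ → ℂ} {d' : ℂ}
    (hN : ContinuousAt N z) (hF : DifferentiableAt ℂ F z) (hd : HasDerivAt d d' z) (hd' : d' ≠ 0)
    (hR : ∀ᶠ ζ in nhds z, d ζ ≠ 0 → IsResolventAt T ζ (N ζ + (d ζ)⁻¹ • F ζ))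
    {ℓ : E → ℂ} {v : E} (hrank : ∀ x, F z x = ℓ x • v) : IsSimpleEigenvalue T z := by
  -- Otherwise `hR` at ζ = z would provide a resolvent at a point of the spectrum.
  have hdz : d z = 0 := by
    by_contra h
    exact (hR.self_of_nhds h).notMem_spec hz
  have hne : ∀ᶠ ζ in nhdsWithin z {z}ᶜ, d ζ ≠ 0 := hd.eventually_ne hd'
  have hRne : ∀ᶠ ζ in nhdsWithin z {z}ᶜ, IsResolventAt T ζ (N ζ + (d ζ)⁻¹ • F ζ) := by
    filter_upwards [hne, hR.filter_mono nhdsWithin_le_nhds] with ζ h1 h2 using h2 h1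
  have hslope : Filter.Tendsto (fun ζ => (ζ - z) * (d ζ)⁻¹) (nhdsWithin z {z}ᶜ)
      (nhds d'⁻¹) := by
    have h := (hasDerivAt_iff_tendsto_slope.1 hd).inv₀ hd'
    refine h.congr fun ζ => ?_
    simp only [slope_def_field, hdz, sub_zero, inv_div]
    rw [div_eq_mul_inv]
  have hlim : Filter.Tendsto (fun ζ => (ζ - z) • resolv T ζ) (nhdsWithin z {z}ᶜ)
      (nhds (d'⁻¹ • F z)) := by
    have h1 : Filter.Tendsto (fun ζ => (ζ - z) • N ζ + ((ζ - z) * (d ζ)⁻¹) • F ζ)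
        (nhdsWithin z {z}ᶜ) (nhds ((z - z) • N z + d'⁻¹ • F z)) := by
      refine Filter.Tendsto.add (Filter.Tendsto.smul ?_ (hN.tendsto.mono_left nhdsWithin_le_nhds))
        (hslope.smul (hF.continuousAt.tendsto.mono_left nhdsWithin_le_nhds))
      exact ((continuous_id.sub continuous_const).tendsto z).mono_left nhdsWithin_le_nhds
    rw [sub_self, zero_smul, zero_add] at h1
    refine h1.congr' ?_
    filter_upwards [hRne] with ζ hζ
    rw [hζ.resolv_eq, smul_add, smul_smul]
  -- If F vanished at z, the simple zero of d would be cancelled and the resolvent would stay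
  -- bounded near z; the Neumann series from a nearby point would then reach z.
  have hFz : F z ≠ 0 := by
    intro h0
    have hFs : Filter.Tendsto (fun ζ => (ζ - z)⁻¹ • F ζ) (nhdsWithin z {z}ᶜ)
        (nhds (deriv F z)) := by
      have h := hasDerivAt_iff_tendsto_slope.1 hF.hasDerivAt
      refine h.congr fun ζ => ?_
      simp [slope_def_module, h0]
    have hb : Filter.Tendsto (fun ζ => N ζ + (d ζ)⁻¹ • F ζ) (nhdsWithin z {z}ᶜ)
        (nhds (N z + d'⁻¹ • deriv F z)) := by
      refine ((hN.tendsto.mono_left nhdsWithin_le_nhds).add (hslope.smul hFs)).congr' ?_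
      filter_upwards [self_mem_nhdsWithin] with ζ hζ
      have : ζ - z ≠ 0 := sub_ne_zero.2 hζ
      rw [smul_smul]
      congr 2
      field_simp
    have hs : Filter.Tendsto (fun ζ => ‖(z - ζ) • (N ζ + (d ζ)⁻¹ • F ζ)‖) (nhdsWithin z {z}ᶜ)
        (nhds 0) := by
      have h1 : Filter.Tendsto (fun ζ : ℂ => z - ζ) (nhdsWithin z {z}ᶜ) (nhds (z - z)) :=
        ((continuous_const.sub continuous_id).tendsto z).mono_left nhdsWithin_le_nhds
      have := (h1.smul hb).norm
      rwa [sub_self, zero_smul, norm_zero] at this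
    obtain ⟨ζ, h1, h2⟩ := ((hs.eventually (gt_mem_nhds one_pos)).and hRne).exists
    exact h2.notMem_spec_of_norm_lt h1 hz
  obtain ⟨y, hy⟩ : ∃ y, F z y ≠ 0 := by
    by_contra! h
    exact hFz (ContinuousLinearMap.ext h)
  have hv : v ≠ 0 := fun h => hy (by rw [hrank, h, smul_zero])
  have hℓ : ℓ y ≠ 0 := fun h => hy (by rw [hrank, h, zero_smul])
  refine ⟨?_, ?_, ?_⟩
  · obtain ⟨r, hr, hsub⟩ := (nhdsWithin_hasBasis Metric.nhds_basis_closedBall _).mem_iff.1 hRne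
    refine ⟨r, hr, Set.Subset.antisymm ?_ ?_⟩
    · rintro ζ ⟨h1, h2⟩
      by_contra hne
      exact IsResolventAt.notMem_spec (hsub ⟨h2, hne⟩) h1
    · rintro _ rfl
      exact ⟨hz, Metric.mem_closedBall_self hr.le⟩
  · set w : E := (d'⁻¹ • F z) y with hw
    have hlimy : Filter.Tendsto (fun ζ => (ζ - z) • resolv T ζ y) (nhdsWithin z {z}ᶜ)
        (nhds w) :=
      ((ContinuousLinearMap.apply ℂ E y).continuous.tendsto _).comp hlim
    obtain ⟨ζ₀, hζ₀⟩ := hRne.exists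
    set R := N ζ₀ + (d ζ₀)⁻¹ • F ζ₀
    -- The resolvent identity between ζ and ζ₀, multiplied by ζ - z, passes to the limit ζ → z. The
    -- resulting equation says that the residue vector w is an eigenvector.
    have key : R ((z - ζ₀) • w) = w := by
      have hid : Filter.Tendsto (fun ζ : ℂ => ζ - z) (nhdsWithin z {z}ᶜ) (nhds 0) := by
        have := ((continuous_id.sub continuous_const).tendsto (f := fun ζ : ℂ => ζ - z) z)
        rw [sub_self] at this
        exact this.mono_left nhdsWithin_le_nhds
      have hid' : Filter.Tendsto (fun ζ : ℂ => ζ - ζ₀) (nhdsWithin z {z}ᶜ) (nhds (z - ζ₀)) :=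
        ((continuous_id.sub continuous_const).tendsto (f := fun ζ : ℂ => ζ - ζ₀) z).mono_left
          nhdsWithin_le_nhds
      have h1 : Filter.Tendsto
          (fun ζ => R ((ζ - ζ₀) • ((ζ - z) • resolv T ζ y) + (ζ - z) • y))
          (nhdsWithin z {z}ᶜ) (nhds (R ((z - ζ₀) • w + (0 : ℂ) • y))) :=
        (R.continuous.tendsto _).comp
          ((hid'.smul hlimy).add (hid.smul tendsto_const_nhds))
      rw [zero_smul, add_zero] at h1
      refine tendsto_nhds_unique h1 (hlimy.congr' ?_)
      filter_upwards [hRne] with ζ hζ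
      obtain ⟨x, hx, hxy⟩ := hζ.right_inv y
      have h2 := hζ₀.left_inv ((ζ - z) • x)
      rw [T.map_smul, eq_add_of_sub_eq hxy, Submodule.coe_smul] at h2
      rw [hζ.resolv_eq, ← hx]
      refine h2.symm.trans (congrArg R ?_)
      module
    obtain ⟨x, hx, hxw⟩ := hζ₀.right_inv ((z - ζ₀) • w)
    rw [key] at hx
    refine ⟨x, ?_, ?_⟩
    · rw [hx, hw]
      simpa using ⟨hd', hy⟩
    · rw [eq_add_of_sub_eq hxw, hx]
      module
  · intro r hr hspec
    have hnot : ∀ ζ ∈ Metric.closedBall z r \ {z}, ζ ∉ spec T := by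
      rintro ζ ⟨h1, h2⟩ h3
      have : ζ ∈ spec T ∩ Metric.closedBall z r := ⟨h3, h1⟩
      rw [hspec] at this
      exact h2 this
    have hdiff : ∀ ζ ∈ Metric.closedBall z r \ {z},
        DifferentiableAt ℂ (fun ζ => (ζ - z) • resolv T ζ) ζ := fun ζ hζ =>
      (differentiableAt_id.sub_const z).smul (differentiableAt_resolv (hnot ζ hζ))
    -- The function (ζ - z)(T - ζ)⁻¹ is holomorphic on the punctured disc and has a limit at z, so
    -- Cauchy's formula evaluates the contour integral by that limit, a nonzero multiple of F z.
    have hint := Complex.circleIntegral_sub_center_inv_smul_of_differentiable_on_off_countable_of_tendsto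
      hr Set.countable_empty (fun ζ hζ => (hdiff ζ hζ).continuousAt.continuousWithinAt)
      (fun ζ hζ => hdiff ζ ⟨Metric.ball_subset_closedBall hζ.1.1, hζ.1.2⟩) hlim
    have hproj : rieszProj T z r = -(d'⁻¹ • F z) := by
      have : (∮ ζ in C(z, r), resolv T ζ)
          = ∮ ζ in C(z, r), (ζ - z)⁻¹ • ((ζ - z) • resolv T ζ) := by
        refine circleIntegral.integral_congr hr.le fun ζ hζ => ?_
        have : ζ - z ≠ 0 := sub_ne_zero.2 (Metric.ne_of_mem_sphere hζ hr.ne')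
        simp [smul_smul, inv_mul_cancel₀ this]
      rw [rieszProj, this, hint, smul_smul, inv_mul_cancel₀ Complex.two_pi_I_ne_zero, one_smul]
    have hrange : LinearMap.range (rieszProj T z r).toLinearMap = Submodule.span ℂ {v} := by
      refine le_antisymm ?_ ?_
      · rintro _ ⟨x, rfl⟩
        rw [Submodule.mem_span_singleton]
        refine ⟨-(d'⁻¹ * ℓ x), ?_⟩
        rw [hproj]
        simp [hrank, smul_smul]
      · rw [Submodule.span_singleton_le_iff_mem]
        refine ⟨-(d' * (ℓ y)⁻¹) • y, ?_⟩
        rw [map_smul, hproj]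
        simp only [ContinuousLinearMap.coe_coe, neg_apply, smul_apply, hrank, smul_neg,
          smul_smul]
        rw [show -(d' * (ℓ y)⁻¹) * (d'⁻¹ * ℓ y) = -1 by field_simp, neg_smul, one_smul, neg_neg]
    rw [hrange, finrank_span_singleton hv]

end Resolvent

/-! ### Fourier series on the elementary cell -/

section Fourier

variable {b : Module.Basis (Fin 2) ℝ Plane}

theorem IsPer.add_mem_span {X : Type*} {f : Plane → X} (hf : IsPer b f) {γ : Plane}
    (hγ : γ ∈ Submodule.span ℤ (Set.range b)) : ∀ x, f (x + γ) = f x := by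
  induction hγ using Submodule.span_induction with
  | mem y hy =>
    obtain ⟨j, rfl⟩ := hy
    exact fun x => hf x j
  | zero => simp
  | add y z _ _ hy hz => exact fun x => by rw [← add_assoc, hz, hy]
  | smul n y _ hy =>
    intro x
    induction n using Int.induction_on generalizing x with
    | zero => simp
    | succ n ih => rw [add_smul, one_smul, ← add_assoc, hy, ih]
    | pred n ih => rw [← ih x, ← hy (x + (-(n : ℤ) - 1) • y), sub_smul, one_smul]; congr 1; abel

/-- A continuous periodic function is bounded. -/
theorem IsPer.exists_norm_le {F : Type*} [NormedAddCommGroup F] {f : Plane → F} (hf : IsPer b f)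
    (hc : Continuous f) : ∃ C, ∀ x, ‖f x‖ ≤ C := by
  obtain ⟨C, hC⟩ := ((ZSpan.fundamentalDomain_isBounded b).isCompact_closure.image
    hc).isBounded.exists_norm_le
  refine ⟨C, fun x => ?_⟩
  have h : f (ZSpan.fract b x) = f x := by
    rw [← hf.add_mem_span (ZSpan.floor b x).2 (ZSpan.fract b x), ZSpan.fract_apply, sub_add_cancel]
  rw [← h]
  exact hC _ ⟨_, subset_closure (ZSpan.fract_mem_fundamentalDomain b x), rfl⟩

/-- The integral of a periodic function over the cell is invariant under translations. -/
theorem IsPer.setIntegral_comp_add {F : Type*} [NormedAddCommGroup F] [NormedSpace ℝ F]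
    {f : Plane → F} (hf : IsPer b f) (a : Plane) :
    ∫ x in cell b, f (x + a) = ∫ x in cell b, f x := by
  let G := (Submodule.span ℤ (Set.range b)).toAddSubgroup
  have h1 : IsAddFundamentalDomain G (cell b) (volume : Measure Plane) :=
    ZSpan.isAddFundamentalDomain' b volume
  -- The translated cell is again a fundamental domain, and a periodic function has the same
  -- integral over any two of them.
  have h2 : IsAddFundamentalDomain G ((fun x => x + -a) ⁻¹' (cell b)) (volume : Measure Plane) :=
    h1.preimage_of_equiv (measurePreserving_add_right volume (-a)).quasiMeasurePreserving
      (e := id) Function.bijective_id (fun g x => by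
        simp only [id, AddSubgroup.vadd_def, vadd_eq_add]; abel)
  have hcount : Countable G :=
    inferInstanceAs (Countable (Submodule.span ℤ (Set.range b)))
  have h3 := h1.setIntegral_eq h2 (f := f) (fun g x => by
    rw [AddSubgroup.vadd_def, vadd_eq_add, add_comm]
    exact hf.add_mem_span g.2 x)
  have h4 := (measurePreserving_add_right (volume : Measure Plane) a).setIntegral_preimage_emb
    (measurableEmbedding_addRight a) f ((fun x => x + -a) ⁻¹' (cell b))
  rw [h3, ← h4]
  congr 2
  ext x
  simp

/-- The integral of a partial derivative of a periodic `C¹` function vanishes. -/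
theorem integral_pd_eq_zero {f : Plane → ℂ} (hf : IsC1Per b f) (j : Fin 2) :
    ∫ x in cell b, pd j f x = 0 := by
  have := isFiniteMeasure_cell b
  have hc := continuous_pd hf.contDiff j
  obtain ⟨C, hC⟩ := (hf.per.pd j).exists_norm_le hc
  set e : Plane := EuclideanSpace.single j 1
  have hline : ∀ x : Plane, ∀ t : ℝ,
      HasDerivAt (fun s : ℝ => f (x + s • e)) (pd j f (x + t • e)) t := by
    intro x t
    have h1 := (hf.contDiff.differentiable one_ne_zero (x + t • e)).hasFDerivAt
    have h2 : HasDerivAt (fun s : ℝ => x + s • e) e t := by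
      simpa using ((hasDerivAt_id t).smul_const e).const_add x
    exact h1.comp_hasDerivAt t h2
  have key := hasDerivAt_integral_of_dominated_loc_of_deriv_le (μ := cellMeasure b)
    (F := fun (t : ℝ) x => f (x + t • e)) (F' := fun t x => pd j f (x + t • e)) (x₀ := 0)
    (s := Set.univ) (bound := fun _ => C) Filter.univ_mem
    (Filter.Eventually.of_forall fun t =>
      (hf.contDiff.continuous.comp (continuous_id.add continuous_const)).aestronglyMeasurable)
    (((memLp_top_of_continuous (hf.contDiff.continuous.comp
      (continuous_id.add continuous_const))).mono_exponent le_top).integrable le_rfl)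
    ((hc.comp (continuous_id.add continuous_const)).aestronglyMeasurable)
    (Filter.Eventually.of_forall fun x t _ => hC _) (integrable_const C)
    (Filter.Eventually.of_forall fun x t _ => hline x t)
  -- The integral of the translate does not depend on t, while its t-derivative at 0 is the integral
  -- of ∂ⱼf.
  have h2 : (fun t : ℝ => ∫ x in cell b, f (x + t • e)) = fun _ => ∫ x in cell b, f x :=
    funext fun t => hf.per.setIntegral_comp_add _
  have h3 := key.2
  rw [h2] at h3
  simpa using h3.unique (hasDerivAt_const (0 : ℝ) _)

variable (b)

/-- The linear functional `x ↦ ∑ mᵢ tᵢ`, where `x = ∑ tᵢ bᵢ`. -/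
def phase (m : Fin 2 → ℤ) : Plane →L[ℝ] ℝ :=
  LinearMap.toContinuousLinearMap (∑ i, (m i : ℝ) • b.coord i)

/-- The frequencies of the exponentials: `-i ∂ⱼ χₘ = freq m j • χₘ`. -/
def freq (m : Fin 2 → ℤ) (j : Fin 2) : ℝ := 2 * Real.pi * phase b m (EuclideanSpace.single j 1)

/-- The periodic exponential with index `m`. -/
def chi (m : Fin 2 → ℤ) (x : Plane) : ℂ := Complex.exp (((2 * Real.pi * phase b m x : ℝ) : ℂ) * Complex.I)

variable {b}

theorem phase_apply (m : Fin 2 → ℤ) (x : Plane) : phase b m x = ∑ i, (m i : ℝ) * b.repr x i := by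
  simp [phase]

theorem phase_add (m n : Fin 2 → ℤ) : phase b (m + n) = phase b m + phase b n := by
  ext x
  simp only [phase_apply, Pi.add_apply, Int.cast_add, add_apply, add_mul, Finset.sum_add_distrib]

theorem phase_neg (m : Fin 2 → ℤ) : phase b (-m) = -phase b m := by
  ext x
  simp [phase_apply, Finset.sum_neg_distrib]

theorem freq_add (m n : Fin 2 → ℤ) (j : Fin 2) : freq b (m + n) j = freq b m j + freq b n j := by
  simp only [freq, phase_add, add_apply]; ring

theorem freq_neg (m : Fin 2 → ℤ) (j : Fin 2) : freq b (-m) j = -freq b m j := by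
  simp only [freq, phase_neg, neg_apply]; ring

theorem chi_add (m n : Fin 2 → ℤ) (x : Plane) : chi b (m + n) x = chi b m x * chi b n x := by
  rw [chi, chi, chi, ← Complex.exp_add, phase_add]
  congr 1
  push_cast [add_apply]
  ring

theorem chi_zero (x : Plane) : chi b 0 x = 1 := by
  simp [chi, phase_apply]

theorem norm_chi (m : Fin 2 → ℤ) (x : Plane) : ‖chi b m x‖ = 1 :=
  Complex.norm_exp_ofReal_mul_I _

theorem conj_chi (m : Fin 2 → ℤ) (x : Plane) : (starRingEnd ℂ) (chi b m x) = chi b (-m) x := by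
  rw [chi, chi, ← Complex.exp_conj, map_mul, Complex.conj_ofReal, Complex.conj_I, phase_neg]
  congr 1
  push_cast [neg_apply]
  ring

theorem isC1Per_chi (m : Fin 2 → ℤ) : IsC1Per b (chi b m) where
  contDiff := ((Complex.ofRealCLM.contDiff.comp
    (contDiff_const.mul (phase b m).contDiff)).mul contDiff_const).cexp
  per x j := by
    have h : phase b m (b j) = m j := by
      rw [phase_apply]
      simp [Finsupp.single_apply]
    rw [chi, map_add, h, chi]
    have : ((2 * Real.pi * (phase b m x + m j) : ℝ) : ℂ) * Complex.I
        = ((2 * Real.pi * phase b m x : ℝ) : ℂ) * Complex.I + m j * (2 * Real.pi * Complex.I) := by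
      push_cast; ring
    rw [this, Complex.exp_add, Complex.exp_int_mul_two_pi_mul_I, mul_one]

theorem pd_chi (m : Fin 2 → ℤ) (j : Fin 2) (x : Plane) :
    pd j (chi b m) x = Complex.I * freq b m j * chi b m x := by
  have h1 : HasFDerivAt (fun x => ((2 * Real.pi * phase b m x : ℝ) : ℂ) * Complex.I) _ x :=
    ((Complex.ofRealCLM.hasFDerivAt.comp x
      (((phase b m).hasFDerivAt (x := x)).const_mul (2 * Real.pi))).mul_const Complex.I)
  have h2 := h1.cexp
  rw [pd, show chi b m = fun x => Complex.exp (((2 * Real.pi * phase b m x : ℝ) : ℂ) * Complex.I)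
    from rfl, h2.fderiv]
  simp [freq]
  ring

theorem cell_measureReal_pos (b : Module.Basis (Fin 2) ℝ Plane) : 0 < volume.real (cell b) :=
  ENNReal.toReal_pos (ZSpan.measure_fundamentalDomain_ne_zero b)
    (ZSpan.fundamentalDomain_isBounded b).measure_lt_top.ne

/-- For m ≠ 0, choose i with mᵢ ≠ 0: translation by bᵢ/(2mᵢ) multiplies the exponential by e^{iπ} =
-1 but preserves its integral. -/
theorem integral_chi (m : Fin 2 → ℤ) :
    ∫ x in cell b, chi b m x = if m = 0 then ((volume.real (cell b) : ℝ) : ℂ) else 0 := by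
  split_ifs with h
  · subst h
    simp [chi_zero]
  · obtain ⟨i, hi⟩ : ∃ i, m i ≠ 0 := by
      by_contra! h'
      exact h (funext h')
    have hi' : (m i : ℝ) ≠ 0 := by exact_mod_cast hi
    have h1 := (isC1Per_chi (b := b) m).per.setIntegral_comp_add ((2 * (m i : ℝ))⁻¹ • b i)
    have h2 : ∀ x, chi b m (x + (2 * (m i : ℝ))⁻¹ • b i) = -chi b m x := by
      intro x
      have h : phase b m (b i) = m i := by
        rw [phase_apply]
        simp [Finsupp.single_apply]
      have h3 : ((2 * Real.pi * (phase b m x + (2 * (m i : ℝ))⁻¹ • (m i : ℝ)) : ℝ) : ℂ) * Complex.I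
          = ((2 * Real.pi * phase b m x : ℝ) : ℂ) * Complex.I + Real.pi * Complex.I := by
        have : 2 * Real.pi * (phase b m x + (2 * (m i : ℝ))⁻¹ • (m i : ℝ))
            = 2 * Real.pi * phase b m x + Real.pi := by
          rw [smul_eq_mul]; field_simp
        rw [this]; push_cast; ring
      rw [chi, map_add, map_smul, h, h3, Complex.exp_add, Complex.exp_pi_mul_I, chi]
      ring
    simp only [h2] at h1
    rw [integral_neg] at h1
    exact self_eq_neg.1 h1.symm

/-- Continuous periodic functions are uniform limits of trigonometric polynomials. -/
theorem exists_trigPoly_near {f : Plane → ℂ} (hf : Continuous f) (hp : IsPer b f) {ε : ℝ}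
    (hε : 0 < ε) : ∃ a : (Fin 2 → ℤ) →₀ ℂ, ∀ x, ‖f x - a.sum fun m c => c * chi b m x‖ ≤ ε := by
  let lin : (Fin 2 → ℝ) → Plane := fun t => b.equivFun.symm t
  have hlin : Continuous lin := LinearMap.continuous_of_finiteDimensional b.equivFun.symm.toLinearMap
  -- An arbitrary, discontinuous choice of representatives. By periodicity `F₀` does not depend on
  -- it, and continuity on the torus follows from the quotient topology; density of trigonometric
  -- polynomials is then applied there.
  let rep : AddCircle (1 : ℝ) → ℝ := Function.surjInv QuotientAddGroup.mk_surjective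
  have hrep : ∀ τ, (rep τ : AddCircle (1 : ℝ)) = τ := Function.surjInv_eq _
  let F₀ : UnitAddTorus (Fin 2) → ℂ := fun τ => f (lin fun i => rep (τ i))
  let π : (Fin 2 → ℝ) → UnitAddTorus (Fin 2) := Pi.map fun _ => ((↑) : ℝ → AddCircle (1 : ℝ))
  have hπ : IsOpenQuotientMap π := IsOpenQuotientMap.piMap fun _ =>
    QuotientAddGroup.isOpenQuotientMap_mk
  have hF : ∀ t, F₀ (π t) = f (lin t) := by
    intro t
    have h1 : ∀ i, ∃ n : ℤ, rep (t i : AddCircle (1 : ℝ)) = t i + n := by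
      intro i
      have h := hrep (t i : AddCircle (1 : ℝ))
      rw [← sub_eq_zero, ← AddCircle.coe_sub, AddCircle.coe_eq_zero_iff] at h
      obtain ⟨n, hn⟩ := h
      exact ⟨n, by rw [zsmul_one] at hn; linarith⟩
    choose n hn using h1
    have h2 : lin (fun i => rep (π t i)) = lin t + ∑ i, n i • b i := by
      have : (fun i => rep (π t i)) = t + fun i => (n i : ℝ) := funext hn
      rw [this]
      simp only [lin, map_add]
      congr 1
      simp [Module.Basis.equivFun_symm_apply, Int.cast_smul_eq_zsmul]
    change f (lin fun i => rep (π t i)) = _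
    rw [h2]
    exact hp.add_mem_span (Submodule.sum_mem _ fun i _ =>
      Submodule.smul_mem _ _ (Submodule.subset_span ⟨i, rfl⟩)) _
  let F : C(UnitAddTorus (Fin 2), ℂ) :=
    ⟨F₀, hπ.isQuotientMap.continuous_iff.2 ((hf.comp hlin).congr fun t => (hF t).symm)⟩
  have hmem : F ∈ (Submodule.span ℂ (Set.range (UnitAddTorus.mFourier (d := Fin 2)))).topologicalClosure := by
    rw [UnitAddTorus.span_mFourier_closure_eq_top]; trivial
  rw [← SetLike.mem_coe, Submodule.topologicalClosure_coe, Metric.mem_closure_iff] at hmem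
  obtain ⟨g, hg, hgF⟩ := hmem ε hε
  obtain ⟨a, rfl⟩ := (Finsupp.mem_span_range_iff_exists_finsupp).1 hg
  refine ⟨a, fun x => ?_⟩
  have hx : lin (b.equivFun x) = x := b.equivFun.symm_apply_apply x
  have h1 := (ContinuousMap.dist_apply_le_dist (f := F)
    (g := a.sum fun i c => c • UnitAddTorus.mFourier i) (π (b.equivFun x))).trans hgF.le
  rw [dist_eq_norm] at h1
  have e1 : F (π (b.equivFun x)) = f x := by
    change F₀ _ = _
    rw [hF, hx]
  have e2 : (a.sum fun i c => c • UnitAddTorus.mFourier i) (π (b.equivFun x))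
      = a.sum fun m c => c * chi b m x := by
    simp only [Finsupp.sum, ContinuousMap.coe_sum, Finset.sum_apply]
    refine Finset.sum_congr rfl fun m _ => ?_
    rw [ContinuousMap.smul_apply, smul_eq_mul]
    congr 1
    simp only [UnitAddTorus.mFourier, ContinuousMap.coe_mk, π, Pi.map_apply, fourier_coe_apply]
    rw [← Complex.exp_sum, chi, phase_apply]
    congr 1
    push_cast
    rw [Finset.mul_sum, Finset.sum_mul]
    refine Finset.sum_congr rfl fun i _ => ?_
    simp only [Module.Basis.equivFun_apply]
    ring
  rwa [e1, e2] at h1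

end Fourier

/-! ### Fourier coefficients and Fourier multipliers -/

section Multipliers

variable {b : Module.Basis (Fin 2) ℝ Plane}

theorem memLp_two_of_continuous {m : Plane → ℂ} (hm : Continuous m) : MemLp m 2 (cellMeasure b) :=
  have := isFiniteMeasure_cell b
  (memLp_top_of_continuous hm).mono_exponent le_top

theorem continuous_chi (m : Fin 2 → ℤ) : Continuous (chi b m) :=
  (isC1Per_chi m).contDiff.continuous

variable (b) in
/-- The exponentials as elements of `L²(Ω)`. -/
def chiL2 (m : Fin 2 → ℤ) : L2 b := (memLp_two_of_continuous (continuous_chi (b := b) m)).toLp _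

variable (b) in
/-- The (unnormalized) Fourier coefficients `∫_Ω u χ̄ₘ`. -/
def coef (m : Fin 2 → ℤ) : L2 b →L[ℂ] ℂ := innerSL ℂ (chiL2 b m)

theorem coeFn_chiL2 (m : Fin 2 → ℤ) : chiL2 b m =ᵐ[cellMeasure b] chi b m :=
  MemLp.coeFn_toLp _

theorem coef_apply (m : Fin 2 → ℤ) (u : L2 b) :
    coef b m u = ∫ x in cell b, u x * chi b (-m) x := by
  rw [coef, innerSL_apply_apply, L2.inner_def]
  refine integral_congr_ae ?_
  filter_upwards [coeFn_chiL2 (b := b) m] with x hx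
  rw [hx, RCLike.inner_apply, conj_chi]

theorem coef_chiL2 (m n : Fin 2 → ℤ) :
    coef b m (chiL2 b n) = if n = m then ((volume.real (cell b) : ℝ) : ℂ) else 0 := by
  rw [coef_apply]
  have : ∫ x in cell b, chiL2 b n x * chi b (-m) x = ∫ x in cell b, chi b (n - m) x := by
    refine integral_congr_ae ?_
    filter_upwards [coeFn_chiL2 (b := b) n] with x hx
    rw [hx, ← chi_add, sub_eq_add_neg]
  rw [this, integral_chi]
  simp only [sub_eq_zero]

/-- A function in `L²(Ω)` with vanishing Fourier coefficients is zero. -/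
theorem eq_zero_of_coef (u : L2 b) (h : ∀ m, coef b m u = 0) : u = 0 := by
  have := isFiniteMeasure_cell b
  refine eq_zero_of_forall_integral u fun φ hφ => ?_
  have hint : Integrable u (cellMeasure b) := (Lp.memLp u).integrable (by norm_num)
  have h' : ∀ m, ∫ x in cell b, u x * chi b m x = 0 := fun m => by
    have := h (-m)
    rwa [coef_apply, neg_neg] at this
  rw [← norm_le_zero_iff]
  refine le_of_forall_pos_le_add fun ε hε => ?_
  rw [zero_add]
  set K := ∫ x in cell b, ‖u x‖
  have hK : 0 ≤ K := integral_nonneg fun _ => norm_nonneg _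
  -- The uniform error is integrated against |u|, whose integral is K; the summand 1 avoids division
  -- by zero.
  obtain ⟨a, ha⟩ := exists_trigPoly_near hφ.contDiff.continuous hφ.per
    (ε := ε / (K + 1)) (by positivity)
  set g : Plane → ℂ := fun x => a.sum fun m c => c * chi b m x with hg
  have hgc : Continuous g := continuous_finsetSum _ fun m _ => continuous_const.mul (continuous_chi m)
  have hg0 : ∫ x in cell b, u x * g x = 0 := by
    have : ∀ x, u x * g x = ∑ m ∈ a.support, a m * (u x * chi b m x) := fun x => by
      simp only [hg, Finsupp.sum, Finset.mul_sum]
      exact Finset.sum_congr rfl fun m _ => by ring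
    simp_rw [this]
    rw [integral_finsetSum]
    · simp only [integral_const_mul, h', mul_zero, Finset.sum_const_zero]
    · exact fun m _ => (integrable_mul u (continuous_chi m)).const_mul _
  have e : ∫ x in cell b, u x * φ x = ∫ x in cell b, u x * (φ x - g x) := by
    simp only [mul_sub]
    rw [integral_sub (integrable_mul u hφ.contDiff.continuous) (integrable_mul u hgc), hg0, sub_zero]
  rw [e]
  calc ‖∫ x in cell b, u x * (φ x - g x)‖ ≤ ∫ x in cell b, ‖u x‖ * (ε / (K + 1)) := by
        refine norm_integral_le_of_norm_le (hint.norm.mul_const _)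
          (Filter.Eventually.of_forall fun x => ?_)
        rw [norm_mul]
        exact mul_le_mul_of_nonneg_left (ha x) (norm_nonneg _)
    _ = K * (ε / (K + 1)) := integral_mul_const _ _
    _ ≤ ε := by
        rw [mul_div_assoc', div_le_iff₀ (by positivity)]
        nlinarith

theorem ext_coef {u v : L2 b} (h : ∀ m, coef b m u = coef b m v) : u = v := by
  rw [← sub_eq_zero]
  exact eq_zero_of_coef _ fun m => by rw [map_sub, h, sub_self]

variable (b) in
/-- The normalizing factor `|Ω|^{-1/2}`. -/
def cellNorm : ℝ := (Real.sqrt (volume.real (cell b)))⁻¹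

theorem cellNorm_pos : 0 < cellNorm b := inv_pos.2 (Real.sqrt_pos.2 (cell_measureReal_pos b))

theorem cellNorm_sq_mul : cellNorm b ^ 2 * volume.real (cell b) = 1 := by
  have h := cell_measureReal_pos b
  rw [cellNorm, inv_pow, Real.sq_sqrt h.le, inv_mul_cancel₀ h.ne']

theorem orthonormal_chiL2 : Orthonormal ℂ fun m => (cellNorm b : ℂ) • chiL2 b m := by
  rw [orthonormal_iff_ite]
  intro m n
  have h : inner ℂ (chiL2 b m) (chiL2 b n) = coef b m (chiL2 b n) := rfl
  rw [inner_smul_left, inner_smul_right, h, coef_chiL2, Complex.conj_ofReal]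
  simp only [eq_comm (a := n)]
  split_ifs
  · rw [← mul_assoc, ← sq]
    exact_mod_cast cellNorm_sq_mul (b := b)
  · simp

variable (b) in
/-- The orthonormal basis of normalized exponentials. -/
def fourierBasis : HilbertBasis (Fin 2 → ℤ) ℂ (L2 b) :=
  HilbertBasis.mkOfOrthogonalEqBot orthonormal_chiL2 (by
    rw [Submodule.eq_bot_iff]
    intro u hu
    refine eq_zero_of_coef u fun m => ?_
    have h := (Submodule.mem_orthogonal _ _).1 hu _ (Submodule.subset_span ⟨m, rfl⟩)
    rw [inner_smul_left, Complex.conj_ofReal] at h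
    exact (mul_eq_zero.1 h).resolve_left (by exact_mod_cast cellNorm_pos.ne'))

theorem fourierBasis_repr (u : L2 b) (m : Fin 2 → ℤ) :
    (fourierBasis b).repr u m = cellNorm b * coef b m u := by
  rw [HilbertBasis.repr_apply_apply, fourierBasis, HilbertBasis.coe_mkOfOrthogonalEqBot,
    inner_smul_left, Complex.conj_ofReal]
  rfl

/-- Bounded Fourier multipliers. -/
theorem exists_multiplier {a : (Fin 2 → ℤ) → ℂ} {C : ℝ} (hC : ∀ m, ‖a m‖ ≤ C) :
    ∃ M : L2 b →L[ℂ] L2 b, (∀ u m, coef b m (M u) = a m * coef b m u) ∧ ‖M‖ ≤ C := by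
  have hC0 : 0 ≤ C := (norm_nonneg _).trans (hC 0)
  let U := (fourierBasis b).repr
  let D := lp.mapCLM (𝕜 := ℂ) (E := fun _ : Fin 2 → ℤ => ℂ) (F := fun _ => ℂ) 2
    (fun m => ContinuousLinearMap.mul ℂ ℂ (a m)) hC0 (fun m => by simpa using hC m)
  refine ⟨U.symm.toContinuousLinearEquiv.toContinuousLinearMap ∘L D ∘L
    U.toContinuousLinearEquiv.toContinuousLinearMap, fun u m => ?_, ?_⟩
  · have h : (cellNorm b : ℂ) ≠ 0 := by exact_mod_cast cellNorm_pos.ne'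
    refine mul_left_cancel₀ h ?_
    rw [← fourierBasis_repr]
    change U (U.symm (D (U u))) m = _
    rw [LinearIsometryEquiv.apply_symm_apply]
    change a m * (U u) m = _
    rw [fourierBasis_repr]
    ring
  · refine ContinuousLinearMap.opNorm_le_bound _ hC0 fun u => ?_
    change ‖U.symm (D (U u))‖ ≤ _
    rw [LinearIsometryEquiv.norm_map, ← LinearIsometryEquiv.norm_map U u]
    exact D.le_of_opNorm_le (lp.norm_mapCLM_le 2 _ hC0 _) _

theorem norm_mulL2_le {m : Plane → ℂ} (hm : MemLp m ∞ (cellMeasure b)) {C : ℝ}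
    (hC0 : 0 ≤ C) (hC : ∀ x, ‖m x‖ ≤ C) : ‖mulL2 b m hm‖ ≤ C := by
  refine ContinuousLinearMap.opNorm_le_bound _ hC0 fun u => ?_
  refine Lp.norm_le_mul_norm_of_ae_le_mul ?_
  filter_upwards [coeFn_mulL2 hm u] with x hx
  rw [hx, norm_mul]
  exact mul_le_mul_of_nonneg_right (hC x) (norm_nonneg _)

/-- Multiplication by an exponential is a shift of Fourier indices. This is how the variable weight
interacts with the symbols. -/
theorem coef_mulL2_chi (m n : Fin 2 → ℤ) (u : L2 b) :
    coef b m (mulL2 b (chi b n) (memLp_top_of_continuous (continuous_chi n)) u)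
      = coef b (m - n) u := by
  rw [coef_apply, coef_apply, integral_mulL2]
  refine integral_congr_ae (Filter.Eventually.of_forall fun x => ?_)
  simp only [← chi_add]
  congr 2
  abel

/-- Weak derivatives in terms of Fourier coefficients. -/
theorem isWeakDeriv_iff_coef {j : Fin 2} {u p : L2 b} :
    IsWeakDeriv b j u p ↔ ∀ m, coef b m p = Complex.I * freq b m j * coef b m u := by
  constructor
  · intro h m
    have h1 := h (chi b (-m)) (isC1Per_chi _)
    simp only [pd_chi, freq_neg] at h1
    have h2 : ∫ x in cell b, u x * (Complex.I * ((-freq b m j : ℝ) : ℂ) * chi b (-m) x)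
        = -(Complex.I * freq b m j) * ∫ x in cell b, u x * chi b (-m) x := by
      rw [← integral_const_mul]
      refine integral_congr_ae (Filter.Eventually.of_forall fun x => ?_)
      push_cast
      ring
    rw [h2] at h1
    rw [coef_apply, coef_apply]
    linear_combination h1
  · intro h φ hφ
    have := isFiniteMeasure_cell b
    -- Parseval's identity for the bilinear pairing; the factor `cellNorm b ^ 2` is 1/|Ω|. Both
    -- sides of the weak derivative relation are then compared coefficient by coefficient.
    have hpair : ∀ (v : L2 b) {ψ : Plane → ℂ} (hψ : Continuous ψ),
        HasSum (fun m => (cellNorm b : ℂ) ^ 2 * (∫ x in cell b, ψ x * chi b m x) * coef b m v)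
          (∫ x in cell b, v x * ψ x) := by
      intro v ψ hψ
      set w : L2 b := (memLp_two_of_continuous (b := b) (Complex.continuous_conj.comp hψ)).toLp _
        with hw
      have hwx : w =ᵐ[cellMeasure b] fun x => (starRingEnd ℂ) (ψ x) := MemLp.coeFn_toLp _
      have h1 := (fourierBasis b).hasSum_inner_mul_inner w v
      have h2 : inner ℂ w v = ∫ x in cell b, v x * ψ x := by
        rw [L2.inner_def]
        refine integral_congr_ae ?_
        filter_upwards [hwx] with x hx
        rw [hx, RCLike.inner_apply, RingHomCompTriple.comp_apply, RingHom.id_apply]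
      rw [h2] at h1
      refine h1.congr_fun fun m => ?_
      rw [← HilbertBasis.repr_apply_apply, fourierBasis_repr, fourierBasis,
        HilbertBasis.coe_mkOfOrthogonalEqBot, inner_smul_right]
      have h3 : inner ℂ w (chiL2 b m) = ∫ x in cell b, ψ x * chi b m x := by
        rw [L2.inner_def]
        refine integral_congr_ae ?_
        filter_upwards [hwx, coeFn_chiL2 (b := b) m] with x hx hx'
        rw [hx, hx', RCLike.inner_apply, RingHomCompTriple.comp_apply, RingHom.id_apply, mul_comm]
      rw [h3]
      ring
    have h1 := hpair u (continuous_pd hφ.contDiff j)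
    have h2 := hpair p hφ.contDiff.continuous
    refine h1.unique (h2.neg.congr_fun fun m => ?_)
    have h3 : ∫ x in cell b, pd j φ x * chi b m x
        = -(Complex.I * freq b m j) * ∫ x in cell b, φ x * chi b m x := by
      have hprod : IsC1Per b fun x => φ x * chi b m x :=
        ⟨hφ.contDiff.mul (isC1Per_chi m).contDiff, fun x i => by
          rw [hφ.per x i, (isC1Per_chi m).per x i]⟩
      have h4 := integral_pd_eq_zero hprod j
      simp only [pd_mul hφ.contDiff (isC1Per_chi m).contDiff, pd_chi] at h4
      rw [integral_add] at h4
      · have h5 : ∫ x in cell b, φ x * (Complex.I * freq b m j * chi b m x)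
            = Complex.I * freq b m j * ∫ x in cell b, φ x * chi b m x := by
          rw [← integral_const_mul]
          exact integral_congr_ae (Filter.Eventually.of_forall fun x => by ring)
        rw [h5] at h4
        linear_combination h4
      · exact (memLp_two_of_continuous (b := b) (hφ.contDiff.continuous.mul
          (continuous_const.mul (continuous_chi m)))).integrable (by norm_num)
      · exact (memLp_two_of_continuous (b := b) ((continuous_pd hφ.contDiff j).mul
          (continuous_chi m))).integrable (by norm_num)
    rw [h3, h m]
    ring

end Multipliers

/-! ### Continuous operators between the Sobolev spaces -/

section SobolevOperators

variable {b : Module.Basis (Fin 2) ℝ Plane}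

variable (b) in
/-- The inclusion `H¹_per(Ω) → L²(Ω)` as a bounded operator. -/
def valL : H1 b →L[ℂ] L2 b :=
  ⟨H1.val b, (PiLp.continuous_apply 2 _ 0).comp continuous_subtype_val⟩

variable (b) in
/-- The weak derivative `∂ⱼ : H¹_per(Ω) → L²(Ω)` as a bounded operator. -/
def derivL (j : Fin 2) : H1 b →L[ℂ] L2 b :=
  ⟨H1.deriv b j, (PiLp.continuous_apply 2 _ j.succ).comp continuous_subtype_val⟩

theorem valL_apply (u : H1 b) : valL b u = H1.val b u := rfl

theorem derivL_apply (j : Fin 2) (u : H1 b) : derivL b j u = H1.deriv b j u := rfl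

theorem continuous_H1_of {X : Type*} [TopologicalSpace X] {f : X → H1 b}
    (h0 : Continuous fun x => H1.val b (f x)) (h : ∀ j, Continuous fun x => H1.deriv b j (f x)) :
    Continuous f := by
  refine continuous_induced_rng.2 ?_
  have : (Subtype.val ∘ f) = fun x => WithLp.toLp 2 (fun i => (f x).1 i) := rfl
  rw [this]
  refine (PiLp.continuous_toLp 2 _).comp (continuous_pi fun i => ?_)
  exact Fin.cases h0 h i

variable (b) in
/-- Multiplication by a periodic `C¹` function in `H¹_per(Ω)` as a bounded operator. -/
def mulH1L (m : Plane → ℂ) (hm : IsC1Per b m) : H1 b →L[ℂ] H1 b :=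
  ⟨mulH1 b m hm, continuous_H1_of
    ((mulL2 b m (memLp_top_of_continuous hm.contDiff.continuous)).continuous.comp
      (valL b).continuous)
    fun j => ((mulL2 b m (memLp_top_of_continuous hm.contDiff.continuous)).continuous.comp
      (derivL b j).continuous).add
      ((mulL2 b (pd j m) (memLp_top_of_continuous (continuous_pd hm.contDiff j))).continuous.comp
        (valL b).continuous)⟩

theorem val_mulH1 {m : Plane → ℂ} (hm : IsC1Per b m) (u : H1 b) : H1.val b (mulH1 b m hm u)
    = mulL2 b m (memLp_top_of_continuous hm.contDiff.continuous) (H1.val b u) := rfl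

theorem coeFn_val_mulH1 {m : Plane → ℂ} (hm : IsC1Per b m) (u : H1 b) :
    H1.val b (mulH1 b m hm u) =ᵐ[cellMeasure b] fun x => m x * H1.val b u x :=
  coeFn_mulL2 _ _

theorem coeFn_deriv_mulH1 {m : Plane → ℂ} (hm : IsC1Per b m) (j : Fin 2) (u : H1 b) :
    H1.deriv b j (mulH1 b m hm u) =ᵐ[cellMeasure b]
      fun x => m x * H1.deriv b j u x + pd j m x * H1.val b u x := by
  have h : H1.deriv b j (mulH1 b m hm u)
      = mulL2 b m (memLp_top_of_continuous hm.contDiff.continuous) (H1.deriv b j u)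
        + mulL2 b (pd j m) (memLp_top_of_continuous (continuous_pd hm.contDiff j))
          (H1.val b u) := rfl
  rw [h]
  filter_upwards [Lp.coeFn_add (mulL2 b m (memLp_top_of_continuous hm.contDiff.continuous)
      (H1.deriv b j u)) (mulL2 b (pd j m) (memLp_top_of_continuous (continuous_pd hm.contDiff j))
        (H1.val b u)),
    coeFn_mulL2 (memLp_top_of_continuous hm.contDiff.continuous) (H1.deriv b j u),
    coeFn_mulL2 (memLp_top_of_continuous (continuous_pd hm.contDiff j)) (H1.val b u)]
    with x h1 h2 h3
  rw [h1, Pi.add_apply, h2, h3]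

theorem coef_deriv (m : Fin 2 → ℤ) (j : Fin 2) (u : H1 b) :
    coef b m (H1.deriv b j u) = Complex.I * freq b m j * coef b m (H1.val b u) :=
  isWeakDeriv_iff_coef.1 (u.2 j) m

theorem mem_H2_iff {u : H1 b} : u ∈ H2 b ↔ ∀ j, ∃ v : H1 b, H1.val b v = H1.deriv b j u := by
  simp only [H2, Submodule.mem_iInf, Submodule.mem_comap, LinearMap.mem_range]

/-- The second weak derivatives are symmetric. -/
theorem H2.deriv_comm (u : H2 b) :
    H1.deriv b 1 (H2.deriv b 0 u) = H1.deriv b 0 (H2.deriv b 1 u) := by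
  refine ext_coef fun m => ?_
  rw [coef_deriv, coef_deriv, H2.val_deriv, H2.val_deriv, coef_deriv, coef_deriv]
  ring

theorem mulH1_mem_H2 {m : Plane → ℂ} (hm : IsC1Per b m) (hm' : ∀ j, IsC1Per b (pd j m))
    {u : H1 b} (hu : u ∈ H2 b) : mulH1 b m hm u ∈ H2 b := by
  rw [mem_H2_iff] at hu ⊢
  intro j
  obtain ⟨v, hv⟩ := hu j
  refine ⟨mulH1 b m hm v + mulH1 b (pd j m) (hm' j) u, ?_⟩
  rw [map_add, val_mulH1, val_mulH1, hv]
  rfl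

/-- The exponentials as elements of `H¹_per(Ω)`. -/
theorem exists_chiH1 (m : Fin 2 → ℤ) : ∃ u : H1 b, H1.val b u = chiL2 b m := by
  have h : ∀ j, IsWeakDeriv b j (chiL2 b m) ((Complex.I * freq b m j) • chiL2 b m) := by
    intro j
    rw [isWeakDeriv_iff_coef]
    intro n
    rw [map_smul, smul_eq_mul, coef_chiL2]
    split_ifs with h
    · rw [h]
    · simp
  exact ⟨⟨WithLp.toLp 2 (Fin.cases (motive := fun _ => L2 b) (chiL2 b m)
    (fun j => (Complex.I * freq b m j) • chiL2 b m)), h⟩, rfl⟩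

variable (b) in
/-- The exponentials as elements of `H¹_per(Ω)`. -/
def chiH1 (m : Fin 2 → ℤ) : H1 b := (exists_chiH1 m).choose

theorem val_chiH1 (m : Fin 2 → ℤ) : H1.val b (chiH1 b m) = chiL2 b m := (exists_chiH1 m).choose_spec

/-! ### Inverses of elliptic Fourier multipliers of order one -/

variable (b) in
/-- The symbol `p` is elliptic of order one and does not vanish. -/
def IsElliptic (p : (Fin 2 → ℤ) → ℂ) : Prop :=
  ∃ C : ℝ, ∀ m, 1 ≤ C * ‖p m‖ ∧ ∀ j, |freq b m j| ≤ C * ‖p m‖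

theorem IsElliptic.ne_zero {p : (Fin 2 → ℤ) → ℂ} (hp : IsElliptic b p) (m : Fin 2 → ℤ) :
    p m ≠ 0 := by
  obtain ⟨C, hC⟩ := hp
  intro h
  have := (hC m).1
  rw [h, norm_zero, mul_zero] at this
  linarith

/-- Ellipticity bounds both p⁻¹ and the frequencies times p⁻¹, so the inverse multiplier and its two
partial derivatives are bounded in L². -/
theorem exists_invOp {p : (Fin 2 → ℤ) → ℂ} (hp : IsElliptic b p) : ∃ S : L2 b →L[ℂ] H1 b,
    ∀ u m, coef b m (H1.val b (S u)) = (p m)⁻¹ * coef b m u := by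
  have hne := hp.ne_zero
  obtain ⟨C, hC⟩ := hp
  have hpos : ∀ m, 0 < ‖p m‖ := fun m => norm_pos_iff.2 (hne m)
  obtain ⟨M, hM, -⟩ := exists_multiplier (b := b) (a := fun m => (p m)⁻¹) (C := C) fun m => by
    rw [norm_inv, inv_le_iff_one_le_mul₀ (hpos m)]
    exact (hC m).1
  have hD := fun j : Fin 2 => exists_multiplier (b := b)
    (a := fun m => Complex.I * freq b m j * (p m)⁻¹) (C := C) fun m => by
      rw [norm_mul, norm_mul, norm_inv, Complex.norm_I, one_mul, Complex.norm_real,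
        Real.norm_eq_abs, ← div_eq_mul_inv, div_le_iff₀ (hpos m)]
      exact (hC m).2 j
  choose D hD _ using hD
  let f : L2 b →ₗ[ℂ] PiLp 2 (fun _ : Fin 3 => L2 b) :=
    { toFun := fun u => WithLp.toLp 2 (Fin.cases (motive := fun _ => L2 b) (M u) fun j => D j u)
      map_add' := fun u v => PiLp.ext fun i => Fin.cases (map_add M u v) (fun j => map_add (D j) u v) i
      map_smul' := fun c u =>
        PiLp.ext fun i => Fin.cases (map_smul M c u) (fun j => map_smul (D j) c u) i }
  have hf : ∀ u, f u ∈ H1 b := fun u j => isWeakDeriv_iff_coef.2 fun m => by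
    change coef b m (D j u) = Complex.I * freq b m j * coef b m (M u)
    rw [hD, hM, mul_assoc]
  refine ⟨⟨f.codRestrict (H1 b) hf, continuous_H1_of M.continuous fun j => (D j).continuous⟩,
    fun u m => hM u m⟩

open Classical in
variable (b) in
/-- The inverse of the Fourier multiplier with elliptic symbol `p` (zero if `p` is not elliptic). -/
def invOp (p : (Fin 2 → ℤ) → ℂ) : L2 b →L[ℂ] H1 b :=
  if h : IsElliptic b p then (exists_invOp h).choose else 0

theorem coef_invOp {p : (Fin 2 → ℤ) → ℂ} (hp : IsElliptic b p) (u : L2 b) (m : Fin 2 → ℤ) :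
    coef b m (H1.val b (invOp b p u)) = (p m)⁻¹ * coef b m u := by
  rw [invOp, dif_pos hp]
  exact (exists_invOp hp).choose_spec u m

theorem val_invOp_eq_iff {p : (Fin 2 → ℤ) → ℂ} (hp : IsElliptic b p) {u v : L2 b} :
    H1.val b (invOp b p u) = v ↔ ∀ m, coef b m u = p m * coef b m v := by
  constructor
  · rintro rfl m
    rw [coef_invOp hp, mul_inv_cancel_left₀ (hp.ne_zero m)]
  · intro h
    refine ext_coef fun m => ?_
    rw [coef_invOp hp, h, inv_mul_cancel_left₀ (hp.ne_zero m)]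

theorem norm_valL_comp_invOp_le {p : (Fin 2 → ℤ) → ℂ} (hp : IsElliptic b p) {δ : ℝ} (hδ : 0 < δ)
    (h : ∀ m, δ ≤ ‖p m‖) : ‖valL b ∘L invOp b p‖ ≤ δ⁻¹ := by
  obtain ⟨M, hM, hM'⟩ := exists_multiplier (b := b) (a := fun m => (p m)⁻¹) (C := δ⁻¹) fun m => by
    rw [norm_inv]
    exact inv_anti₀ hδ (h m)
  have : valL b ∘L invOp b p = M := by
    ext1 u
    exact ext_coef fun m => by rw [hM]; exact coef_invOp hp u m
  rw [this]
  exact hM'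

/-- Fourier multipliers commute with ∂ⱼ, so the gain of one derivative applies to ∂ⱼy as well. -/
theorem invOp_mem_H2 {p : (Fin 2 → ℤ) → ℂ} (hp : IsElliptic b p) (y : H1 b) :
    invOp b p (H1.val b y) ∈ H2 b := by
  rw [mem_H2_iff]
  intro j
  refine ⟨invOp b p (H1.deriv b j y), (val_invOp_eq_iff hp).2 fun m => ?_⟩
  rw [coef_deriv, coef_deriv, coef_invOp hp, mul_left_comm, mul_inv_cancel_left₀ (hp.ne_zero m)]

/-- The resolvent identity S_ζ (1 - (z - ζ) S_z) = S_z expresses S_ζ through the fixed operator S_z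
and an inverse that is analytic near ζ = z. Differentiability thus holds in the norm of operators
into H¹. -/
theorem differentiableAt_invOp {q : (Fin 2 → ℤ) → ℂ} {z : ℂ}
    (h : ∀ᶠ ζ in nhds z, IsElliptic b fun m => q m + ζ) :
    DifferentiableAt ℂ (fun ζ => invOp b fun m => q m + ζ) z := by
  have hz := h.self_of_nhds
  set S := invOp b fun m => q m + z
  have h1 : ∀ᶠ ζ in nhds z, ‖(z - ζ) • (valL b ∘L S)‖ < 1 := by
    have hc : Continuous fun ζ : ℂ => ‖(z - ζ) • (valL b ∘L S)‖ := by fun_prop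
    exact hc.continuousAt.eventually_lt continuousAt_const (by simp)
  have heq : (fun ζ => invOp b fun m => q m + ζ) =ᶠ[nhds z]
      fun ζ => S ∘L Ring.inverse (1 - (z - ζ) • (valL b ∘L S)) := by
    filter_upwards [h, h1] with ζ hζ hζ1
    have hu : IsUnit (1 - (z - ζ) • (valL b ∘L S)) := isUnit_one_sub_of_norm_lt_one hζ1
    have key : (invOp b fun m => q m + ζ) ∘L (1 - (z - ζ) • (valL b ∘L S)) = S := by
      ext1 u
      refine H1.val_injective b ?_
      rw [ContinuousLinearMap.comp_apply, val_invOp_eq_iff hζ]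
      intro m
      rw [sub_apply, smul_apply, one_apply_eq_self, map_sub, map_smul,
        ContinuousLinearMap.comp_apply, valL_apply, coef_invOp hz]
      have := hz.ne_zero m
      simp only [smul_eq_mul] at this ⊢
      field_simp
      ring
    calc (invOp b fun m => q m + ζ)
        = (invOp b fun m => q m + ζ) ∘L ((1 - (z - ζ) • (valL b ∘L S)) *
            Ring.inverse (1 - (z - ζ) • (valL b ∘L S))) := by
          rw [Ring.mul_inverse_cancel _ hu]; rfl
      _ = _ := by
          rw [ContinuousLinearMap.mul_def, ← ContinuousLinearMap.comp_assoc, key]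
  refine DifferentiableAt.congr_of_eventuallyEq ?_ heq
  have h2 : DifferentiableAt ℂ (Ring.inverse : (L2 b →L[ℂ] L2 b) → _)
      (1 - (z - z) • (valL b ∘L S)) := differentiableAt_inverse (by simp)
  have h3 : DifferentiableAt ℂ (fun ζ : ℂ => 1 - (z - ζ) • (valL b ∘L S)) z := by fun_prop
  have h4 : DifferentiableAt ℂ (fun ζ : ℂ => Ring.inverse (1 - (z - ζ) • (valL b ∘L S))) z :=
    DifferentiableAt.comp (g := Ring.inverse) z h2 h3
  exact (differentiableAt_const S).clm_comp h4

/-! ### Cauchy–Riemann operators -/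

variable (b) in
/-- The operator `-i ∂₁ + σ ∂₂ + μ`. -/
def crOp (σ μ : ℂ) : H1 b →L[ℂ] L2 b :=
  (-Complex.I) • derivL b 0 + σ • derivL b 1 + μ • valL b

variable (b) in
/-- The symbol of the operator `-i ∂₁ + σ ∂₂ + μ`. -/
def crSym (σ μ : ℂ) (m : Fin 2 → ℤ) : ℂ := freq b m 0 + σ * Complex.I * freq b m 1 + μ

theorem coef_crOp (σ μ : ℂ) (u : H1 b) (m : Fin 2 → ℤ) :
    coef b m (crOp b σ μ u) = crSym b σ μ m * coef b m (H1.val b u) := by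
  simp only [crOp, add_apply, smul_apply, map_add, map_smul, derivL_apply, valL_apply, coef_deriv,
    smul_eq_mul, crSym]
  linear_combination (-(freq b m 0 : ℂ) * coef b m (H1.val b u)) * Complex.I_mul_I

/-- For σ = ±1 the two frequencies are, up to sign, the real and imaginary parts of the leading term
of `crSym`. The bounded corrections t and ‖μ‖ are absorbed using the lower bound δ ≤ ‖p m‖. -/
theorem isElliptic_of_le {σ μ : ℂ} (hσ : σ = 1 ∨ σ = -1) {p : (Fin 2 → ℤ) → ℂ} {t δ : ℝ}
    (hδ : 0 < δ) (hp : ∀ m, δ ≤ ‖p m‖) (ht : ∀ m, ‖p m - crSym b σ μ m‖ ≤ t) :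
    IsElliptic b p := by
  have ht0 : 0 ≤ t := (norm_nonneg _).trans (ht 0)
  refine ⟨δ⁻¹ + (1 + (t + ‖μ‖) * δ⁻¹), fun m => ?_⟩
  have h1 : 1 ≤ δ⁻¹ * ‖p m‖ := by
    rw [inv_mul_eq_div, le_div_iff₀ hδ, one_mul]; exact hp m
  have hf : ∀ j, |freq b m j| ≤ ‖(freq b m 0 : ℂ) + σ * Complex.I * freq b m 1‖ := by
    have hre : ((freq b m 0 : ℂ) + σ * Complex.I * freq b m 1).re = freq b m 0 := by
      rcases hσ with rfl | rfl <;> simp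
    have him : |((freq b m 0 : ℂ) + σ * Complex.I * freq b m 1).im| = |freq b m 1| := by
      rcases hσ with rfl | rfl <;> simp
    intro j
    fin_cases j
    · have := Complex.abs_re_le_norm ((freq b m 0 : ℂ) + σ * Complex.I * freq b m 1)
      rwa [hre] at this
    · have := Complex.abs_im_le_norm ((freq b m 0 : ℂ) + σ * Complex.I * freq b m 1)
      rwa [him] at this
  have h2 : ‖(freq b m 0 : ℂ) + σ * Complex.I * freq b m 1‖ ≤ ‖p m‖ + t + ‖μ‖ := by
    have e : (freq b m 0 : ℂ) + σ * Complex.I * freq b m 1 = p m - (p m - crSym b σ μ m) - μ := by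
      rw [crSym]; ring
    rw [e]
    exact (norm_sub_le _ _).trans (add_le_add_left ((norm_sub_le _ _).trans
      (add_le_add_right (ht m) _)) _)
  have h3 : (t + ‖μ‖) * 1 ≤ (t + ‖μ‖) * (δ⁻¹ * ‖p m‖) :=
    mul_le_mul_of_nonneg_left h1 (by positivity)
  have h4 := norm_nonneg (p m)
  have h5 : 0 ≤ (t + ‖μ‖) * (δ⁻¹ * ‖p m‖) := by positivity
  refine ⟨by nlinarith, fun j => ?_⟩
  have := hf j
  nlinarith

end SobolevOperators

/-! ### Calculus of partial derivatives -/

section Calculus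

variable {b : Module.Basis (Fin 2) ℝ Plane}

theorem pd_eq_of_hasFDerivAt {F : Type*} [NormedAddCommGroup F] [NormedSpace ℝ F] {f : Plane → F}
    {f' : Plane →L[ℝ] F} {x : Plane} (h : HasFDerivAt f f' x) (j : Fin 2) :
    pd j f x = f' (EuclideanSpace.single j 1) := by
  rw [pd, h.fderiv]

theorem pd_ofReal {f : Plane → ℝ} (hf : ContDiff ℝ 1 f) (j : Fin 2) (x : Plane) :
    pd j (fun y => (f y : ℂ)) x = ((pd j f x : ℝ) : ℂ) :=
  pd_eq_of_hasFDerivAt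
    (Complex.ofRealCLM.hasFDerivAt.comp x (hf.differentiable one_ne_zero x).hasFDerivAt) j

theorem contDiff_pd {F : Type*} [NormedAddCommGroup F] [NormedSpace ℝ F] {f : Plane → F}
    (hf : ContDiff ℝ 2 f) (j : Fin 2) : ContDiff ℝ 1 (pd j f) :=
  (hf.fderiv_right (m := 1) (by norm_num)).clm_apply contDiff_const

theorem isC1Per_ofReal {f : Plane → ℝ} (hf : ContDiff ℝ 1 f) (hp : IsPer b f) :
    IsC1Per b fun x => (f x : ℂ) :=
  ⟨Complex.ofRealCLM.contDiff.comp hf, fun x j => by rw [hp x j]⟩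

theorem isC1Per_pd {f : Plane → ℂ} (hf : ContDiff ℝ 2 f) (hp : IsPer b f) (j : Fin 2) :
    IsC1Per b (pd j f) :=
  ⟨contDiff_pd hf j, hp.pd j⟩

theorem pd_mul_exp {f g : Plane → ℝ} (hf : ContDiff ℝ 1 f) (hg : ContDiff ℝ 1 g) (j : Fin 2)
    (x : Plane) : pd j (fun y => f y * Real.exp (g y)) x
      = (pd j f x + f x * pd j g x) * Real.exp (g x) := by
  have h := (hf.differentiable one_ne_zero x).hasFDerivAt.mul
    ((hg.differentiable one_ne_zero x).hasFDerivAt.exp)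
  refine (pd_eq_of_hasFDerivAt h j).trans ?_
  simp only [add_apply, smul_apply, smul_eq_mul, pd]
  ring

theorem pd_const_mul {f : Plane → ℝ} (hf : ContDiff ℝ 1 f) (a : ℝ) (j : Fin 2) (x : Plane) :
    pd j (fun y => a * f y) x = a * pd j f x := by
  rw [pd_eq_of_hasFDerivAt ((hf.differentiable one_ne_zero x).hasFDerivAt.const_mul a)]
  simp [pd]

theorem pd_sq {f : Plane → ℝ} (hf : ContDiff ℝ 1 f) (j : Fin 2) (x : Plane) :
    pd j (fun y => f y ^ 2) x = 2 * f x * pd j f x := by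
  rw [pd_eq_of_hasFDerivAt ((hf.differentiable one_ne_zero x).hasFDerivAt.pow 2)]
  simp [pd]

end Calculus

/-! ### The scalar potential of the magnetic field -/

namespace Coefficients

variable {b : Module.Basis (Fin 2) ℝ Plane} (c : Coefficients b)

/-- `φ` is a periodic function of class `C²` with `A = (∂₂φ, -∂₁φ)`. -/
structure IsGauge (φ : Plane → ℝ) : Prop where
  contDiff : ContDiff ℝ 2 φ
  per : IsPer b φ
  pd_zero : ∀ x, pd 0 φ x = -c.A x 1
  pd_one : ∀ x, pd 1 φ x = c.A x 0

/-- The 1-form -A₂ dx₁ + A₁ dx₂ is closed because div A = 0, so the Poincaré lemma on the plane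
gives a primitive. Mean value zero of A is what makes this primitive periodic. -/
theorem exists_isGauge : ∃ φ, c.IsGauge φ := by
  have := isFiniteMeasure_cell b
  let P : Fin 2 → Plane →L[ℝ] ℝ := fun j => EuclideanSpace.proj j
  let e : Fin 2 → Plane := fun j => EuclideanSpace.single j 1
  let w : Plane → Plane →L[ℝ] ℝ := fun x => -(c.A x 1) • P 0 + (c.A x 0) • P 1
  have hA : ∀ j, ContDiff ℝ 1 fun x => c.A x j := fun j => (P j).contDiff.comp c.A_contDiff
  have hw : ContDiff ℝ 1 w :=
    ((hA 1).neg.smul contDiff_const).add ((hA 0).smul contDiff_const)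
  have hdecomp : ∀ u : Plane, u = u 0 • e 0 + u 1 • e 1 := by
    intro u
    ext j
    fin_cases j <;> simp [e]
  have hpdA : ∀ i j x, fderiv ℝ (fun x => c.A x j) x (e i) = pd i c.A x j := by
    intro i j x
    have h := (P j).hasFDerivAt.comp x (c.A_contDiff.differentiable one_ne_zero x).hasFDerivAt
    have h' : HasFDerivAt (fun x => c.A x j) _ x := h
    rw [h'.fderiv]
    rfl
  have hdw : ∀ x u v, fderiv ℝ w x u v
      = -(fderiv ℝ (fun x => c.A x 1) x u) * v 0 + (fderiv ℝ (fun x => c.A x 0) x u) * v 1 := by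
    intro x u v
    have h1 := ((hA 1).differentiable one_ne_zero x).hasFDerivAt
    have h0 := ((hA 0).differentiable one_ne_zero x).hasFDerivAt
    have h : HasFDerivAt w _ x := (h1.neg.smul_const (P 0)).add (h0.smul_const (P 1))
    rw [h.fderiv]
    simp [P]
  have hsymm : ∀ x ∈ (Set.univ : Set Plane), ∀ u v, fderiv ℝ w x u v = fderiv ℝ w x v u := by
    intro x _ u v
    have hdiv := c.A_div x
    rw [Fin.sum_univ_two] at hdiv
    have hu : ∀ j, fderiv ℝ (fun x => c.A x j) x u = u 0 * pd 0 c.A x j + u 1 * pd 1 c.A x j := by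
      intro j
      conv_lhs => rw [hdecomp u]
      rw [map_add, map_smul, map_smul, hpdA, hpdA, smul_eq_mul, smul_eq_mul]
    have hv : ∀ j, fderiv ℝ (fun x => c.A x j) x v = v 0 * pd 0 c.A x j + v 1 * pd 1 c.A x j := by
      intro j
      conv_lhs => rw [hdecomp v]
      rw [map_add, map_smul, map_smul, hpdA, hpdA, smul_eq_mul, smul_eq_mul]
    rw [hdw, hdw, hu, hu, hv, hv]
    linear_combination (u 0 * v 1 - u 1 * v 0) * hdiv
  obtain ⟨f, hf⟩ := convex_univ.exists_forall_hasFDerivAt_of_fderiv_symmetric isOpen_univ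
    (hw.differentiable one_ne_zero).differentiableOn hsymm
  have hf' : ∀ x, HasFDerivAt f (w x) x := fun x => hf x trivial
  have hfd : fderiv ℝ f = w := funext fun x => (hf' x).fderiv
  have hf2 : ContDiff ℝ 2 f := by
    rw [show (2 : WithTop ℕ∞) = 1 + 1 by norm_num, contDiff_succ_iff_fderiv]
    refine ⟨fun x => (hf' x).differentiableAt, by simp, ?_⟩
    rwa [hfd]
  have hwe : ∀ x, w x (e 0) = -c.A x 1 ∧ w x (e 1) = c.A x 0 := by
    intro x
    simp [w, P, e]
  refine ⟨f, hf2, ?_, fun x => ?_, fun x => ?_⟩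
  -- The gradient of f is periodic, so f is periodic up to additive constants; these define a linear
  -- form ℓ for which f - ℓ is periodic.
  · have hconst : ∀ j x, f (x + b j) - f x = f (0 + b j) - f 0 := by
      intro j x
      have hd : ∀ y, HasFDerivAt (fun y => f (y + b j) - f y) (0 : Plane →L[ℝ] ℝ) y := by
        intro y
        have h1 : HasFDerivAt (fun y => f (y + b j)) (w (y + b j)) y :=
          
          ((hf' (y + b j)).comp y ((hasFDerivAt_id y).add_const (b j)) :)
        have h2 : w (y + b j) = w y := by simp only [w, c.A_per y j]
        rw [h2] at h1
        simpa using h1.fun_sub (hf' y)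
      exact is_const_of_fderiv_eq_zero (fun y => (hd y).differentiableAt) (fun y => (hd y).fderiv) x 0
    let ℓ : Plane →L[ℝ] ℝ :=
      LinearMap.toContinuousLinearMap (∑ i, (f (0 + b i) - f 0) • b.coord i)
    have hℓ : ∀ j, ℓ (b j) = f (0 + b j) - f 0 := by
      intro j
      fin_cases j <;> simp [ℓ]
    have hg : ContDiff ℝ 1 fun x => f x - ℓ x :=
      (hf2.of_le (by norm_num)).sub ℓ.contDiff
    have hgp : IsPer b fun x => f x - ℓ x := by
      intro x j
      simp only [map_add, hℓ, ← hconst j x]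
      ring
    have hAint : Integrable c.A (cellMeasure b) := by
      obtain ⟨C, hC⟩ := c.A_per.exists_norm_le c.A_contDiff.continuous
      exact Integrable.of_bound c.A_contDiff.continuous.aestronglyMeasurable C
        (Filter.Eventually.of_forall hC)
    have hAj : ∀ j, ∫ x in cell b, c.A x j = 0 := by
      intro j
      have := (P j).integral_comp_comm hAint
      rw [c.A_mean, map_zero] at this
      exact this
    have hAji : ∀ j, Integrable (fun x => c.A x j) (cellMeasure b) := fun j =>
      (P j).integrable_comp hAint
    have hpd : ∀ j x, pd j (fun x => f x - ℓ x) x = w x (e j) - ℓ (e j) := fun j x =>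
      pd_eq_of_hasFDerivAt ((hf' x).fun_sub ℓ.hasFDerivAt) j
    have hint : ∀ j, ∫ x in cell b, (w x (e j) - ℓ (e j)) = 0 := by
      intro j
      have h := integral_pd_eq_zero (isC1Per_ofReal hg hgp) j
      simp only [pd_ofReal hg, hpd] at h
      exact Complex.ofReal_eq_zero.1 ((integral_ofReal (𝕜 := ℂ)
        (f := fun x => w x (e j) - ℓ (e j)) (μ := cellMeasure b)).symm.trans h)
    have hw0 : ∀ j, ∫ x in cell b, w x (e j) = 0 ∧ Integrable (fun x => w x (e j)) (cellMeasure b) := by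
      intro j
      fin_cases j
      · simp only [Fin.zero_eta, (hwe _).1]
        exact ⟨by rw [integral_neg, hAj, neg_zero], (hAji 1).neg⟩
      · simp only [Fin.mk_one, (hwe _).2]
        exact ⟨hAj 0, hAji 0⟩
    -- The gradient of the periodic function f - ℓ integrates to zero, and so does that of f; hence
    -- ℓ(eⱼ)|Ω| = 0.
    have hℓ0 : ∀ j, ℓ (e j) = 0 := by
      intro j
      have h := hint j
      rw [integral_sub (hw0 j).2 (integrable_const _), (hw0 j).1, integral_const, zero_sub,
        neg_eq_zero, smul_eq_mul, mul_eq_zero] at h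
      refine h.resolve_left ?_
      rw [measureReal_restrict_apply_univ]
      exact (cell_measureReal_pos b).ne'
    intro x j
    have h := hgp x j
    have hz : ∀ y, ℓ y = 0 := fun y => by
      rw [hdecomp y, map_add, map_smul, map_smul, hℓ0, hℓ0]; simp
    simpa [hz] using h
  · exact (pd_eq_of_hasFDerivAt (hf' x) 0).trans (hwe x).1
  · exact (pd_eq_of_hasFDerivAt (hf' x) 1).trans (hwe x).2

/-! ### The factors of the operator -/

/-- The factor `θ = ω e^{-sφ}`. -/
def theta (φ : Plane → ℝ) (s : ℝ) (x : Plane) : ℂ := ((c.ω x * Real.exp (-s * φ x) : ℝ) : ℂ)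

/-- The inverse of the factor `θ`. -/
def thetaInv (φ : Plane → ℝ) (s : ℝ) (x : Plane) : ℂ :=
  (((c.ω x)⁻¹ * Real.exp (s * φ x) : ℝ) : ℂ)

/-- The weight `e^{2sφ}`. -/
def weight (φ : Plane → ℝ) (s : ℝ) (x : Plane) : ℂ := ((1 * Real.exp (2 * s * φ x) : ℝ) : ℂ)

variable {c} {φ : Plane → ℝ}

theorem theta_mul_thetaInv (s : ℝ) (x : Plane) : c.theta φ s x * c.thetaInv φ s x = 1 := by
  rw [theta, thetaInv, ← Complex.ofReal_mul]
  have h : Real.exp (-s * φ x) * Real.exp (s * φ x) = 1 := by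
    rw [← Real.exp_add]; simp
  have := c.ω_ne_zero x
  norm_cast
  calc _ = c.ω x * (c.ω x)⁻¹ * (Real.exp (-s * φ x) * Real.exp (s * φ x)) := by ring
    _ = 1 := by rw [h, mul_inv_cancel₀ this, one_mul]

theorem weight_mul_weight_neg (s : ℝ) (x : Plane) : weight φ s x * weight φ (-s) x = 1 := by
  rw [weight, weight, ← Complex.ofReal_mul, one_mul, one_mul, ← Real.exp_add]
  simp

theorem contDiff_theta (hφ : c.IsGauge φ) (s : ℝ) : ContDiff ℝ 2 (c.theta φ s) :=
  Complex.ofRealCLM.contDiff.comp (c.ω_contDiff.mul (contDiff_const.mul hφ.contDiff).exp)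

theorem contDiff_thetaInv (hφ : c.IsGauge φ) (s : ℝ) : ContDiff ℝ 2 (c.thetaInv φ s) :=
  Complex.ofRealCLM.contDiff.comp
    ((c.ω_contDiff.inv c.ω_ne_zero).mul (contDiff_const.mul hφ.contDiff).exp)

theorem contDiff_weight (hφ : c.IsGauge φ) (s : ℝ) : ContDiff ℝ 2 (weight φ s) :=
  Complex.ofRealCLM.contDiff.comp (contDiff_const.mul (contDiff_const.mul hφ.contDiff).exp)

theorem isPer_theta (hφ : c.IsGauge φ) (s : ℝ) : IsPer b (c.theta φ s) := fun x j => by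
  rw [theta, c.ω_per x j, hφ.per x j, theta]

theorem isPer_thetaInv (hφ : c.IsGauge φ) (s : ℝ) : IsPer b (c.thetaInv φ s) := fun x j => by
  rw [thetaInv, c.ω_per x j, hφ.per x j, thetaInv]

theorem isPer_weight (hφ : c.IsGauge φ) (s : ℝ) : IsPer b (weight φ s) := fun x j => by
  rw [weight, hφ.per x j, weight]

theorem isC1Per_theta (hφ : c.IsGauge φ) (s : ℝ) : IsC1Per b (c.theta φ s) :=
  ⟨(contDiff_theta hφ s).of_le (by norm_num), isPer_theta hφ s⟩

theorem isC1Per_thetaInv (hφ : c.IsGauge φ) (s : ℝ) : IsC1Per b (c.thetaInv φ s) :=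
  ⟨(contDiff_thetaInv hφ s).of_le (by norm_num), isPer_thetaInv hφ s⟩

theorem isC1Per_weight (hφ : c.IsGauge φ) (s : ℝ) : IsC1Per b (weight φ s) :=
  ⟨(contDiff_weight hφ s).of_le (by norm_num), isPer_weight hφ s⟩

theorem pd_theta (hφ : c.IsGauge φ) (s : ℝ) (j : Fin 2) (x : Plane) :
    pd j (c.theta φ s) x
    = ((((pd j c.ω x - s * c.ω x * pd j φ x) * Real.exp (-s * φ x) : ℝ)) : ℂ) := by
  have h1 : ContDiff ℝ 1 c.ω := c.ω_contDiff.of_le (by norm_num)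
  have h2 : ContDiff ℝ 1 φ := hφ.contDiff.of_le (by norm_num)
  have h3 : ContDiff ℝ 1 fun x => -s * φ x := contDiff_const.mul h2
  have h := pd_ofReal (h1.mul h3.exp) j x
  have h4 := pd_mul_exp h1 h3 j x
  rw [pd_const_mul h2] at h4
  refine h.trans ?_
  refine (congrArg Complex.ofReal h4).trans ?_
  push_cast
  ring

theorem pd_weight (hφ : c.IsGauge φ) (s : ℝ) (j : Fin 2) (x : Plane) :
    pd j (weight φ s) x = 2 * s * ((pd j φ x : ℝ) : ℂ) * weight φ s x := by
  have h2 : ContDiff ℝ 1 φ := hφ.contDiff.of_le (by norm_num)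
  have h3 : ContDiff ℝ 1 fun x => 2 * s * φ x := contDiff_const.mul h2
  -- The constant factor 1 in `weight` lets `pd_mul_exp` apply as it does for `theta`.
  have h1 : ContDiff ℝ 1 fun _ : Plane => (1 : ℝ) := contDiff_const
  have h := pd_ofReal (h1.mul h3.exp) j x
  have h4 := pd_mul_exp h1 h3 j x
  rw [pd_const_mul h2] at h4
  refine h.trans ?_
  refine (congrArg Complex.ofReal h4).trans ?_
  have : pd j (fun _ : Plane => (1 : ℝ)) x = 0 := by simp [pd]
  rw [this, weight]
  push_cast
  ring

end Coefficients

namespace Coefficients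

variable {b : Module.Basis (Fin 2) ℝ Plane} {c : Coefficients b} {φ : Plane → ℝ}

/-! ### Pointwise form of the operators -/

theorem coeFn_val_momentum' (k : Fin 2 → ℂ) (j : Fin 2) (u : H2 b) :
    H1.val b (c.momentum' k j u) =ᵐ[cellMeasure b] fun x =>
      -Complex.I * H1.deriv b j (u : H1 b) x + (k j - (c.A x j : ℂ)) * H1.val b (u : H1 b) x := by
  have h : H1.val b (c.momentum' k j u) = (-Complex.I) • H1.deriv b j (u : H1 b)
      + H1.val b (mulH1 b (fun x => k j - (c.A x j : ℂ)) (c.isC1Per_sub_A (k j) j) (u : H1 b)) := by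
    rw [← H2.val_deriv]; rfl
  rw [h]
  filter_upwards [Lp.coeFn_add ((-Complex.I) • H1.deriv b j (u : H1 b))
      (H1.val b (mulH1 b (fun x => k j - (c.A x j : ℂ)) (c.isC1Per_sub_A (k j) j) (u : H1 b))),
    Lp.coeFn_smul (-Complex.I) (H1.deriv b j (u : H1 b)),
    coeFn_val_mulH1 (c.isC1Per_sub_A (k j) j) (u : H1 b)] with x h1 h2 h3
  rw [h1, Pi.add_apply, h2, h3, Pi.smul_apply, smul_eq_mul]

theorem pd_sub_A (z : ℂ) (i j : Fin 2) (x : Plane) :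
    pd i (fun x => z - (c.A x j : ℂ)) x = -((pd i c.A x j : ℝ) : ℂ) := by
  have h := ((Complex.ofRealCLM.hasFDerivAt.comp x ((EuclideanSpace.proj (𝕜 := ℝ) j).hasFDerivAt.comp
    x (c.A_contDiff.differentiable one_ne_zero x).hasFDerivAt))).const_sub z
  refine (pd_eq_of_hasFDerivAt h i).trans ?_
  simp [pd]

theorem coeFn_deriv_momentum' (k : Fin 2 → ℂ) (i j : Fin 2) (u : H2 b) :
    H1.deriv b i (c.momentum' k j u) =ᵐ[cellMeasure b] fun x =>
      -Complex.I * H1.deriv b i (H2.deriv b j u) x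
        + (k j - (c.A x j : ℂ)) * H1.deriv b i (u : H1 b) x
        - ((pd i c.A x j : ℝ) : ℂ) * H1.val b (u : H1 b) x := by
  have h : H1.deriv b i (c.momentum' k j u) = (-Complex.I) • H1.deriv b i (H2.deriv b j u)
      + H1.deriv b i (mulH1 b (fun x => k j - (c.A x j : ℂ)) (c.isC1Per_sub_A (k j) j) (u : H1 b)) :=
    rfl
  rw [h]
  filter_upwards [Lp.coeFn_add ((-Complex.I) • H1.deriv b i (H2.deriv b j u))
      (H1.deriv b i (mulH1 b (fun x => k j - (c.A x j : ℂ)) (c.isC1Per_sub_A (k j) j) (u : H1 b))),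
    Lp.coeFn_smul (-Complex.I) (H1.deriv b i (H2.deriv b j u)),
    coeFn_deriv_mulH1 (c.isC1Per_sub_A (k j) j) i (u : H1 b)] with x h1 h2 h3
  rw [h1, Pi.add_apply, h2, h3, Pi.smul_apply, smul_eq_mul, pd_sub_A]
  ring

theorem coeFn_momentum (k : Fin 2 → ℂ) (j : Fin 2) (w : H1 b) :
    c.momentum k j w =ᵐ[cellMeasure b] fun x =>
      -Complex.I * H1.deriv b j w x + (k j - (c.A x j : ℂ)) * H1.val b w x := by
  have h : c.momentum k j w = (-Complex.I) • H1.deriv b j w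
      + H1.val b (mulH1 b (fun x => k j - (c.A x j : ℂ)) (c.isC1Per_sub_A (k j) j) w) := rfl
  rw [h]
  filter_upwards [Lp.coeFn_add ((-Complex.I) • H1.deriv b j w)
      (H1.val b (mulH1 b (fun x => k j - (c.A x j : ℂ)) (c.isC1Per_sub_A (k j) j) w)),
    Lp.coeFn_smul (-Complex.I) (H1.deriv b j w),
    coeFn_val_mulH1 (c.isC1Per_sub_A (k j) j) w] with x h1 h2 h3
  rw [h1, Pi.add_apply, h2, h3, Pi.smul_apply, smul_eq_mul]

theorem pd_ωsq (j : Fin 2) (x : Plane) : pd j (fun x => (((c.ω x) ^ 2 : ℝ) : ℂ)) x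
    = 2 * (c.ω x : ℂ) * ((pd j c.ω x : ℝ) : ℂ) := by
  have h1 : ContDiff ℝ 1 c.ω := c.ω_contDiff.of_le (by norm_num)
  rw [pd_ofReal (h1.pow 2), pd_sq h1]
  push_cast
  ring

/-- The operator `H(k)` in terms of the weak derivatives up to the second order. -/
theorem coeFn_hamiltonian (k : Fin 2 → ℂ) (u : H2 b) :
    c.hamiltonian k u =ᵐ[cellMeasure b] fun x =>
      (∑ j : Fin 2, ((c.ω x : ℂ) ^ 2 * (-H1.deriv b j (H2.deriv b j u) x
          - 2 * Complex.I * (k j - (c.A x j : ℂ)) * H1.deriv b j (u : H1 b) x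
          + (k j - (c.A x j : ℂ)) ^ 2 * H1.val b (u : H1 b) x)
        - 2 * Complex.I * (c.ω x : ℂ) * ((pd j c.ω x : ℝ) : ℂ)
          * (-Complex.I * H1.deriv b j (u : H1 b) x
            + (k j - (c.A x j : ℂ)) * H1.val b (u : H1 b) x)))
      + (c.V x : ℂ) * H1.val b (u : H1 b) x := by
  let W : Fin 2 → H1 b := fun j =>
    mulH1 b (fun x => (((c.ω x) ^ 2 : ℝ) : ℂ)) c.isC1Per_ωsq (c.momentum' k j u)
  have h : c.hamiltonian k u = (c.momentum k 0 (W 0) + c.momentum k 1 (W 1))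
      + mulL2 b (fun x => (c.V x : ℂ)) c.memLp_V (H1.val b (u : H1 b)) := by
    rw [hamiltonian, LinearMap.add_apply, LinearMap.sum_apply, Fin.sum_univ_two]
    rfl
  rw [h]
  filter_upwards [Lp.coeFn_add (c.momentum k 0 (W 0) + c.momentum k 1 (W 1))
      (mulL2 b (fun x => (c.V x : ℂ)) c.memLp_V (H1.val b (u : H1 b))),
    Lp.coeFn_add (c.momentum k 0 (W 0)) (c.momentum k 1 (W 1)),
    coeFn_mulL2 c.memLp_V (H1.val b (u : H1 b)), coeFn_momentum (c := c) k 0 (W 0),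
    coeFn_momentum (c := c) k 1 (W 1), coeFn_val_mulH1 c.isC1Per_ωsq (c.momentum' k 0 u),
    coeFn_val_mulH1 c.isC1Per_ωsq (c.momentum' k 1 u),
    coeFn_deriv_mulH1 c.isC1Per_ωsq 0 (c.momentum' k 0 u),
    coeFn_deriv_mulH1 c.isC1Per_ωsq 1 (c.momentum' k 1 u),
    coeFn_val_momentum' (c := c) k 0 u, coeFn_val_momentum' (c := c) k 1 u,
    coeFn_deriv_momentum' (c := c) k 0 0 u, coeFn_deriv_momentum' (c := c) k 1 1 u]
    with x h1 h2 h3 h4 h5 h6 h7 h8 h9 h10 h11 h12 h13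
  rw [h1, Pi.add_apply, h2, Pi.add_apply, h3, h4, h5, h6, h7, h8, h9, h10, h11, h12, h13,
    Fin.sum_univ_two]
  -- The only derivatives of A that arise form its divergence, so none survive in the expanded
  -- operator.
  have hdiv : ((pd 0 c.A x 0 : ℝ) : ℂ) + ((pd 1 c.A x 1 : ℝ) : ℂ) = 0 := by
    have := c.A_div x
    rw [Fin.sum_univ_two] at this
    exact_mod_cast this
  simp only [pd_ωsq]
  push_cast
  linear_combination (c.ω x : ℂ) ^ 2 * (Complex.I * H1.val b (u : H1 b) x * hdiv
    + (H1.deriv b 0 (H2.deriv b 0 u) x + H1.deriv b 1 (H2.deriv b 1 u) x) * Complex.I_mul_I)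

theorem coeFn_crOp (σ μ : ℂ) (w : H1 b) : crOp b σ μ w =ᵐ[cellMeasure b] fun x =>
    -Complex.I * H1.deriv b 0 w x + σ * H1.deriv b 1 w x + μ * H1.val b w x := by
  have h : crOp b σ μ w = ((-Complex.I) • H1.deriv b 0 w + σ • H1.deriv b 1 w) + μ • H1.val b w :=
    rfl
  rw [h]
  filter_upwards [Lp.coeFn_add ((-Complex.I) • H1.deriv b 0 w + σ • H1.deriv b 1 w)
      (μ • H1.val b w), Lp.coeFn_add ((-Complex.I) • H1.deriv b 0 w) (σ • H1.deriv b 1 w),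
    Lp.coeFn_smul (-Complex.I) (H1.deriv b 0 w), Lp.coeFn_smul σ (H1.deriv b 1 w),
    Lp.coeFn_smul μ (H1.val b w)] with x h1 h2 h3 h4 h5
  simp only [h1, h2, h3, h4, h5, Pi.add_apply, Pi.smul_apply, smul_eq_mul]

end Coefficients

/-! ### The pointwise algebra of the factorization -/

/-- Here w stands for ω, X for e^{-sφ}, W for e^{2sφ}, U with indices for u and its derivatives, and
K0, K1 for the derivatives of `kappa`. The gradient of φ is already replaced by (-A1, A0). The terms
with K0 and K1 cancel between the product of operators and the remainder. -/
theorem factorization_identity {s w w0 w1 A0 A1 U U0 U1 U00 U01 U11 z k V I X W K0 K1 : ℂ}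
    (hs : s ^ 2 = 1) (hI : I * I = -1) (hX : X ^ 2 * W = 1) :
    w ^ 2 * (-U00 - 2 * I * (z - A0) * U0 + (z - A0) ^ 2 * U)
        - 2 * I * w * w0 * (-I * U0 + (z - A0) * U)
      + (w ^ 2 * (-U11 - 2 * I * (k - A1) * U1 + (k - A1) ^ 2 * U)
        - 2 * I * w * w1 * (-I * U1 + (k - A1) * U)) + V * U
    = w * X * (-I * (W * (w * X * (-I * U00 + s * U01 + (z + s * I * k) * U0)
            + (w0 - s * w * -A1) * X * (-I * U0 + s * U1 + (z + s * I * k) * U)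
          + ((-I * ((w0 - s * w * -A1) * X) + s * ((w1 - s * w * A0) * X)) * U0 + K0 * U))
          + 2 * s * -A1 * W * (w * X * (-I * U0 + s * U1 + (z + s * I * k) * U)
            + (-I * ((w0 - s * w * -A1) * X) + s * ((w1 - s * w * A0) * X)) * U))
        + -s * (W * (w * X * (-I * U01 + s * U11 + (z + s * I * k) * U1)
            + (w1 - s * w * A0) * X * (-I * U0 + s * U1 + (z + s * I * k) * U)
          + ((-I * ((w0 - s * w * -A1) * X) + s * ((w1 - s * w * A0) * X)) * U1 + K1 * U))
          + 2 * s * A0 * W * (w * X * (-I * U0 + s * U1 + (z + s * I * k) * U)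
            + (-I * ((w0 - s * w * -A1) * X) + s * ((w1 - s * w * A0) * X)) * U))
        + (z - s * I * k) * (W * (w * X * (-I * U0 + s * U1 + (z + s * I * k) * U)
            + (-I * ((w0 - s * w * -A1) * X) + s * ((w1 - s * w * A0) * X)) * U)))
      + (V + ((2 * I * w * w0 * A0 + w ^ 2 * A0 ^ 2 + (2 * I * w * w1 * A1 + w ^ 2 * A1 ^ 2))
        - w * X * (-I * (W * K0 + 2 * s * -A1 * W
              * (-I * ((w0 - s * w * -A1) * X) + s * ((w1 - s * w * A0) * X)))
            - s * (W * K1 + 2 * s * A0 * W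
              * (-I * ((w0 - s * w * -A1) * X) + s * ((w1 - s * w * A0) * X)))))) * U := by
  -- The identity with X² W already replaced by 1. The final step multiplies the common factor by X²
  -- W - 1, which is zero.
  have h1 : w ^ 2 * (-U00 - 2 * I * (z - A0) * U0 + (z - A0) ^ 2 * U)
        - 2 * I * w * w0 * (-I * U0 + (z - A0) * U)
      + (w ^ 2 * (-U11 - 2 * I * (k - A1) * U1 + (k - A1) ^ 2 * U)
        - 2 * I * w * w1 * (-I * U1 + (k - A1) * U)) =
     w * (w * (-I * (-I * U00 + s * U01 + (z + s * I * k) * U0) - s * (-I * U01 + s * U11 + (z + s * I * k) * U1))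
      + (-I * (w0 + s * w * A1) - s * (w1 - s * w * A0)) * (-I * U0 + s * U1 + (z + s * I * k) * U)
      + (-I * (w0 + s * w * A1) + s * (w1 - s * w * A0)) * (-I * U0 - s * U1 + (z - s * I * k) * U)
      + ((z - s * I * k) + 2 * I * s * A1 - 2 * s * s * A0) * w * (-I * U0 + s * U1 + (z + s * I * k) * U))
      + ((2 * I * w * w0 * A0 + w ^ 2 * A0 ^ 2 + (2 * I * w * w1 * A1 + w ^ 2 * A1 ^ 2))) * U := by
    grind
  linear_combination h1 - w * (w * (-I * (-I * U00 + s * U01 + (z + s * I * k) * U0) - s * (-I * U01 + s * U11 + (z + s * I * k) * U1))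
      + (-I * (w0 + s * w * A1) - s * (w1 - s * w * A0)) * (-I * U0 + s * U1 + (z + s * I * k) * U)
      + (-I * (w0 + s * w * A1) + s * (w1 - s * w * A0)) * (-I * U0 - s * U1 + (z - s * I * k) * U)
      + ((z - s * I * k) + 2 * I * s * A1 - 2 * s * s * A0) * w * (-I * U0 + s * U1 + (z + s * I * k) * U)) * hX

namespace Coefficients

variable {b : Module.Basis (Fin 2) ℝ Plane} (c : Coefficients b) (φ : Plane → ℝ)

/-! ### The factorization of the operator -/

/-- The function `-i ∂₁θ + s ∂₂θ`. -/
def kappa (s : ℝ) (x : Plane) : ℂ :=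
  -Complex.I * pd 0 (c.theta φ s) x + s * pd 1 (c.theta φ s) x

/-- The potential that remains after the factorization of the operator. -/
def remainder (s : ℝ) (x : Plane) : ℂ :=
  (c.V x : ℂ) + ((∑ j : Fin 2, (2 * Complex.I * (c.ω x : ℂ) * ((pd j c.ω x : ℝ) : ℂ) * (c.A x j : ℂ)
      + (c.ω x : ℂ) ^ 2 * (c.A x j : ℂ) ^ 2))
    - c.theta φ s x * (-Complex.I * pd 0 (fun y => weight φ s y * c.kappa φ s y) x
      - s * pd 1 (fun y => weight φ s y * c.kappa φ s y) x))

variable {c φ}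

theorem isC1Per_kappa (hφ : c.IsGauge φ) (s : ℝ) : IsC1Per b (c.kappa φ s) := by
  have h := fun j => isC1Per_pd (contDiff_theta hφ s) (isPer_theta hφ s) j
  refine ⟨(contDiff_const.mul (h 0).contDiff).add (contDiff_const.mul (h 1).contDiff), fun x j => ?_⟩
  rw [kappa, (h 0).per x j, (h 1).per x j, kappa]

theorem isC1Per_weight_mul_kappa (hφ : c.IsGauge φ) (s : ℝ) :
    IsC1Per b (fun y => weight φ s y * c.kappa φ s y) :=
  ⟨(isC1Per_weight hφ s).contDiff.mul (isC1Per_kappa hφ s).contDiff, fun x j => by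
    rw [(isC1Per_weight hφ s).per x j, (isC1Per_kappa hφ s).per x j]⟩

theorem memLp_remainder (hφ : c.IsGauge φ) (s : ℝ) :
    MemLp (c.remainder φ s) ∞ (cellMeasure b) := by
  refine c.memLp_V.add (memLp_top_of_continuous ?_)
  have hA : ∀ j, Continuous fun x => (c.A x j : ℂ) := fun j => Complex.continuous_ofReal.comp
    ((EuclideanSpace.proj (𝕜 := ℝ) j).continuous.comp c.A_contDiff.continuous)
  have hω : Continuous fun x => (c.ω x : ℂ) :=
    Complex.continuous_ofReal.comp c.ω_contDiff.continuous
  have hω' : ∀ j, Continuous fun x => ((pd j c.ω x : ℝ) : ℂ) := fun j =>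
    Complex.continuous_ofReal.comp (continuous_pd (c.ω_contDiff.of_le (by norm_num)) j)
  have hk := fun j => continuous_pd (isC1Per_weight_mul_kappa hφ s).contDiff j
  have ht := (isC1Per_theta hφ s).contDiff.continuous
  refine (continuous_finsetSum _ fun j _ => ?_).sub
    (ht.mul ((continuous_const.mul (hk 0)).sub (continuous_const.mul (hk 1))))
  exact (((continuous_const.mul hω).mul (hω' j)).mul (hA j)).add ((hω.pow 2).mul ((hA j).pow 2))

theorem coeFn_comb {μ : Measure Plane} (a₁ a₂ a₃ : ℂ) (f₁ f₂ f₃ : Lp ℂ 2 μ) :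
    ⇑(a₁ • f₁ + a₂ • f₂ + a₃ • f₃) =ᵐ[μ] fun x => a₁ * f₁ x + a₂ * f₂ x + a₃ * f₃ x := by
  filter_upwards [Lp.coeFn_add (a₁ • f₁ + a₂ • f₂) (a₃ • f₃), Lp.coeFn_add (a₁ • f₁) (a₂ • f₂),
    Lp.coeFn_smul a₁ f₁, Lp.coeFn_smul a₂ f₂, Lp.coeFn_smul a₃ f₃] with x h1 h2 h3 h4 h5
  simp only [h1, h2, h3, h4, h5, Pi.add_apply, Pi.smul_apply, smul_eq_mul]

/-- The factorization `H(k) = θ P₋ₛ e^{2sφ} Pₛ θ + Q` with the Cauchy–Riemann operators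
`Pₛ = (-i∂₁ + k₁) + s i (-i∂₂ + k₂)`. -/
theorem hamiltonian_factorization (hφ : c.IsGauge φ) {s : ℝ} (hs : s = 1 ∨ s = -1) (z k₂ : ℂ)
    (u : H2 b) : ∃ y : H1 b,
      H1.val b y = crOp b s (z + s * Complex.I * k₂)
        (mulH1 b (c.theta φ s) (isC1Per_theta hφ s) (u : H1 b)) ∧
      c.hamiltonian ![z, k₂] u =
        mulL2 b (c.theta φ s) (memLp_top_of_continuous (isC1Per_theta hφ s).contDiff.continuous)
          (crOp b (-s) (z - s * Complex.I * k₂)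
            (mulH1 b (weight φ s) (isC1Per_weight hφ s) y))
        + mulL2 b (c.remainder φ s) (memLp_remainder hφ s) (H1.val b (u : H1 b)) := by
  set μ := z + s * Complex.I * k₂ with hμ
  have hθ := isC1Per_theta hφ s
  have hκ := isC1Per_kappa hφ s
  have hw := isC1Per_weight hφ s
  -- A priori Pₛ(θu) lies only in L². Writing it as θ Pₛu + κu, with κ = -i∂₁θ + s∂₂θ, exhibits it
  -- as an element y of H¹, to which P₋ₛ can be applied after the weight.
  set Y : H1 b := (-Complex.I) • H2.deriv b 0 u + (s : ℂ) • H2.deriv b 1 u + μ • (u : H1 b) with hY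
  have hYv : H1.val b Y =ᵐ[cellMeasure b] fun x => -Complex.I * H1.deriv b 0 (u : H1 b) x
      + s * H1.deriv b 1 (u : H1 b) x + μ * H1.val b (u : H1 b) x := by
    have : H1.val b Y = (-Complex.I) • H1.deriv b 0 (u : H1 b) + (s : ℂ) • H1.deriv b 1 (u : H1 b)
        + μ • H1.val b (u : H1 b) := by
      rw [← H2.val_deriv, ← H2.val_deriv]; rfl
    rw [this]
    exact coeFn_comb _ _ _ _ _ _
  have hYd : ∀ i, H1.deriv b i Y =ᵐ[cellMeasure b] fun x =>
      -Complex.I * H1.deriv b i (H2.deriv b 0 u) x + s * H1.deriv b i (H2.deriv b 1 u) x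
        + μ * H1.deriv b i (u : H1 b) x := fun i => coeFn_comb _ _ _ _ _ _
  set y : H1 b := mulH1 b _ hθ Y + mulH1 b _ hκ (u : H1 b) with hy
  have hyv : H1.val b y =ᵐ[cellMeasure b] fun x =>
      c.theta φ s x * H1.val b Y x + c.kappa φ s x * H1.val b (u : H1 b) x := by
    filter_upwards [Lp.coeFn_add (H1.val b (mulH1 b _ hθ Y)) (H1.val b (mulH1 b _ hκ (u : H1 b))),
      coeFn_val_mulH1 hθ Y, coeFn_val_mulH1 hκ (u : H1 b)] with x h1 h2 h3
    rw [← h2, ← h3]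
    exact h1
  have hyd : ∀ i, H1.deriv b i y =ᵐ[cellMeasure b] fun x =>
      (c.theta φ s x * H1.deriv b i Y x + pd i (c.theta φ s) x * H1.val b Y x)
        + (c.kappa φ s x * H1.deriv b i (u : H1 b) x
          + pd i (c.kappa φ s) x * H1.val b (u : H1 b) x) := by
    intro i
    filter_upwards [Lp.coeFn_add (H1.deriv b i (mulH1 b _ hθ Y))
        (H1.deriv b i (mulH1 b _ hκ (u : H1 b))),
      coeFn_deriv_mulH1 hθ i Y, coeFn_deriv_mulH1 hκ i (u : H1 b)] with x h1 h2 h3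
    rw [← h2, ← h3]
    exact h1
  refine ⟨y, ?_, ?_⟩
  · refine Lp.ext ?_
    filter_upwards [hyv, hYv, coeFn_crOp (b := b) s μ (mulH1 b _ hθ (u : H1 b)),
      coeFn_val_mulH1 hθ (u : H1 b), coeFn_deriv_mulH1 hθ 0 (u : H1 b),
      coeFn_deriv_mulH1 hθ 1 (u : H1 b)] with x h1 h2 h3 h4 h5 h6
    rw [h1, h2, h3, h4, h5, h6, kappa]
    ring
  · refine Lp.ext ?_
    set E := mulH1 b _ hw y
    set R := crOp b (-s) (z - s * Complex.I * k₂) E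
    have hsym := H2.deriv_comm u
    have e1 := coeFn_hamiltonian (c := c) ![z, k₂] u
    have e2 := Lp.coeFn_add
      (mulL2 b (c.theta φ s) (memLp_top_of_continuous hθ.contDiff.continuous) R)
      (mulL2 b (c.remainder φ s) (memLp_remainder hφ s) (H1.val b (u : H1 b)))
    have e3 := coeFn_mulL2 (memLp_top_of_continuous hθ.contDiff.continuous) R
    have e4 := coeFn_mulL2 (memLp_remainder hφ s) (H1.val b (u : H1 b))
    have e5 := coeFn_crOp (b := b) (-s) (z - s * Complex.I * k₂) E
    have e6 := coeFn_val_mulH1 hw y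
    have e7 := coeFn_deriv_mulH1 hw 0 y
    have e8 := coeFn_deriv_mulH1 hw 1 y
    filter_upwards [e1, e2, e3, e4, e5, e6, e7, e8, hyv, hyd 0, hyd 1, hYv, hYd 0, hYd 1]
      with x h1 h2 h3 h4 h5 h6 h7 h8 h9 h10 h11 h12 h13 h14
    rw [h1, h2, Pi.add_apply, h3, h4, h5, h6, h7, h8, h9, h10, h11, h12, h13, h14]
    rw [hsym, remainder,
      pd_mul hw.contDiff hκ.contDiff, pd_mul hw.contDiff hκ.contDiff, pd_weight hφ, pd_weight hφ,
      Fin.sum_univ_two, Fin.sum_univ_two, kappa, pd_theta hφ, pd_theta hφ, hφ.pd_zero, hφ.pd_one]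
    have hval : c.theta φ s x = (c.ω x : ℂ) * ((Real.exp (-s * φ x) : ℝ) : ℂ) := by
      rw [theta]; push_cast; ring
    have hexp : ((Real.exp (-s * φ x) : ℝ) : ℂ) ^ 2 * weight φ s x = 1 := by
      rw [weight, ← Complex.ofReal_pow, ← Complex.ofReal_mul, one_mul, ← Real.exp_nat_mul,
        ← Real.exp_add]
      simp only [Nat.cast_ofNat]
      rw [show 2 * (-s * φ x) + 2 * s * φ x = 0 by ring, Real.exp_zero, Complex.ofReal_one]
    rw [hval]
    have hs2 : ((s : ℝ) : ℂ) ^ 2 = 1 := by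
      rcases hs with rfl | rfl <;> norm_num
    -- Conjugation by e^{±sφ} produces the magnetic terms, so both sides agree in all terms of
    -- positive order in the derivatives and in k. They differ by multiplication with `remainder`,
    -- the discrepancy on the constant function 1 at k = 0.
    have key := factorization_identity (w := (c.ω x : ℂ)) (w0 := ((pd 0 c.ω x : ℝ) : ℂ))
      (w1 := ((pd 1 c.ω x : ℝ) : ℂ)) (A0 := (c.A x 0 : ℂ)) (A1 := (c.A x 1 : ℂ))
      (U := H1.val b (u : H1 b) x) (U0 := H1.deriv b 0 (u : H1 b) x)
      (U1 := H1.deriv b 1 (u : H1 b) x) (U00 := H1.deriv b 0 (H2.deriv b 0 u) x)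
      (U01 := H1.deriv b 0 (H2.deriv b 1 u) x) (U11 := H1.deriv b 1 (H2.deriv b 1 u) x)
      (z := z) (k := k₂) (V := (c.V x : ℂ)) (K0 := pd 0 (c.kappa φ s) x)
      (K1 := pd 1 (c.kappa φ s) x) hs2 Complex.I_mul_I hexp
    simp only [Matrix.cons_val_zero, Matrix.cons_val_one, Complex.ofReal_mul, Complex.ofReal_sub,
      Complex.ofReal_neg, hμ]
    exact key

end Coefficients

/-! ### Inverses of second order operators -/

section Inverse

variable {b : Module.Basis (Fin 2) ℝ Plane}

/-- The bounded operator `G : L²(Ω) → H¹_per(Ω)` is the inverse of the operator `K` with domain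
`H²_per(Ω)`. -/
structure IsInverseOf (K : H2 b →ₗ[ℂ] L2 b) (G : L2 b →L[ℂ] H1 b) : Prop where
  right_inv : ∀ f, ∃ u : H2 b, (u : H1 b) = G f ∧ K u = f
  left_inv : ∀ u : H2 b, G (K u) = u

/-- The inverse of a perturbation of rank one. -/
theorem IsInverseOf.sub_rankOne {K K' : H2 b →ₗ[ℂ] L2 b} {G : L2 b →L[ℂ] H1 b}
    (h : IsInverseOf K' G) {ℓ : H1 b →L[ℂ] ℂ} {β : L2 b} (hK : ∀ u : H2 b, K' u = K u + ℓ u • β)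
    {d : ℂ} (hd : d = 1 - ℓ (G β)) (hd0 : d ≠ 0) :
    IsInverseOf K (G + d⁻¹ • (G ∘L ℓ.smulRight β ∘L G)) := by
  -- Sherman–Morrison: K u = f means K' u = f + ℓ(u) β, and applying ℓ ∘ G determines the unknown
  -- number ℓ(u) as d⁻¹ ℓ(G f).
  have happ : ∀ f, (G + d⁻¹ • (G ∘L ℓ.smulRight β ∘L G)) f = G (f + (d⁻¹ * ℓ (G f)) • β) := by
    intro f
    simp [smul_smul]
  constructor
  · intro f
    obtain ⟨u, hu, hKu⟩ := h.right_inv (f + (d⁻¹ * ℓ (G f)) • β)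
    refine ⟨u, by rw [happ, hu], ?_⟩
    have h1 : ℓ u = d⁻¹ * ℓ (G f) := by
      rw [hu, map_add, map_smul, map_add, map_smul, smul_eq_mul]
      have : ℓ (G β) = 1 - d := by rw [hd]; ring
      rw [this]
      field_simp
      ring
    rw [hK, h1] at hKu
    exact add_right_cancel hKu
  · intro u
    have h1 : K u = K' u - ℓ u • β := by rw [hK, add_sub_cancel_right]
    have h2 : G (K u) = u - ℓ u • G β := by rw [h1, map_sub, map_smul, h.left_inv]
    have h3 : ℓ (G (K u)) = d * ℓ u := by
      rw [h2, map_sub, map_smul, smul_eq_mul, hd]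
      ring
    rw [happ, map_add, map_smul, h3, h2, inv_mul_cancel_left₀ hd0, sub_add_cancel]

end Inverse

/-! ### The resolvent of the linearized pencil -/

section Linearization

variable {b : Module.Basis (Fin 2) ℝ Plane} (c : Coefficients b)

theorem val_toH1 (w : LinearMap.range (H1.val b)) : H1.val b (toH1 b w) = w :=
  congrArg Subtype.val ((LinearEquiv.ofInjective (H1.val b) (H1.val_injective b)).apply_symm_apply w)

theorem T1Domain.val_snd (X : T1Domain b) : H1.val b (T1Domain.snd b X) = X.1.snd :=
  val_toH1 _

theorem mulH1_mulH1_of_mul_eq_one {m m' : Plane → ℂ} (hm : IsC1Per b m) (hm' : IsC1Per b m')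
    (h : ∀ x, m x * m' x = 1) (u : H1 b) : mulH1 b m hm (mulH1 b m' hm' u) = u := by
  refine H1.val_injective b (Lp.ext ?_)
  filter_upwards [coeFn_val_mulH1 hm (mulH1 b m' hm' u), coeFn_val_mulH1 hm' u] with x h1 h2
  rw [h1, h2, ← mul_assoc, h, one_mul]

theorem mulL2_mulL2_of_mul_eq_one {m m' : Plane → ℂ} (hm : MemLp m ∞ (cellMeasure b))
    (hm' : MemLp m' ∞ (cellMeasure b)) (h : ∀ x, m x * m' x = 1) (u : L2 b) :
    mulL2 b m hm (mulL2 b m' hm' u) = u := by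
  refine Lp.ext ?_
  filter_upwards [coeFn_mulL2 hm (mulL2 b m' hm' u), coeFn_mulL2 hm' u] with x h1 h2
  rw [h1, h2, ← mul_assoc, h, one_mul]

namespace Coefficients

/-- The operator `2(i∂₁ + A₁) - 2i ω⁻¹ ∂₁ω` as a bounded operator `H¹_per(Ω) → L²(Ω)`. -/
def cornerL : H1 b →L[ℂ] L2 b :=
  (2 * Complex.I) • derivL b 0
    + mulL2 b
        (fun x => 2 * (c.A x 0 : ℂ) - 2 * Complex.I * (((c.ω x)⁻¹ * pd 0 c.ω x : ℝ) : ℂ))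
        c.memLp_lowerOrder ∘L valL b

theorem coeFn_corner (w : H1 b) : c.corner w =ᵐ[cellMeasure b] fun x =>
    2 * Complex.I * H1.deriv b 0 w x
      + (2 * (c.A x 0 : ℂ) - 2 * Complex.I * (((c.ω x)⁻¹ * pd 0 c.ω x : ℝ) : ℂ))
        * H1.val b w x := by
  set M := mulL2 b
    (fun x => 2 * (c.A x 0 : ℂ) - 2 * Complex.I * (((c.ω x)⁻¹ * pd 0 c.ω x : ℝ) : ℂ))
    c.memLp_lowerOrder (H1.val b w)
  have h : c.corner w = (2 * Complex.I) • H1.deriv b 0 w + M := rfl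
  rw [h]
  filter_upwards [Lp.coeFn_add ((2 * Complex.I) • H1.deriv b 0 w) M,
    Lp.coeFn_smul (2 * Complex.I) (H1.deriv b 0 w), coeFn_mulL2 c.memLp_lowerOrder (H1.val b w)]
    with x h1 h2 h3
  rw [h1, Pi.add_apply, h2, h3, Pi.smul_apply, smul_eq_mul]

/-- The dependence of `H(z, k₂)` on `z`. -/
theorem hamiltonian_eq (z k₂ : ℂ) (u : H2 b) :
    c.hamiltonian ![z, k₂] u = c.hamiltonian ![0, k₂] u
      + ((-z) • c.corner (mulH1 b (fun x => (((c.ω x) ^ 2 : ℝ) : ℂ)) c.isC1Per_ωsq (u : H1 b))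
        + z ^ 2 • H1.val b
          (mulH1 b (fun x => (((c.ω x) ^ 2 : ℝ) : ℂ)) c.isC1Per_ωsq (u : H1 b))) := by
  set W := mulH1 b (fun x => (((c.ω x) ^ 2 : ℝ) : ℂ)) c.isC1Per_ωsq (u : H1 b)
  refine Lp.ext ?_
  filter_upwards [coeFn_hamiltonian (c := c) ![z, k₂] u, coeFn_hamiltonian (c := c) ![0, k₂] u,
    Lp.coeFn_add (c.hamiltonian ![0, k₂] u) ((-z) • c.corner W + z ^ 2 • H1.val b W),
    Lp.coeFn_add ((-z) • c.corner W) (z ^ 2 • H1.val b W),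
    Lp.coeFn_smul (-z) (c.corner W), Lp.coeFn_smul (z ^ 2) (H1.val b W), c.coeFn_corner W,
    coeFn_val_mulH1 c.isC1Per_ωsq (u : H1 b), coeFn_deriv_mulH1 c.isC1Per_ωsq 0 (u : H1 b)]
    with x h1 h2 h3 h4 h5 h6 h7 h8 h9
  rw [h1, h3, Pi.add_apply, h2, h4, Pi.add_apply, h5, h6, Pi.smul_apply, Pi.smul_apply, h7, h8, h9,
    pd_ωsq, Fin.sum_univ_two, Fin.sum_univ_two]
  have hω : (c.ω x : ℂ) ≠ 0 := by exact_mod_cast c.ω_ne_zero x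
  simp only [Matrix.cons_val_zero, Matrix.cons_val_one, smul_eq_mul]
  push_cast
  field_simp
  ring

/-- The bounded operator `(f, g) ↦ g - (C - z)(ω² f)`, where `C = 2(i∂₁ + A₁) - 2i ω⁻¹ ∂₁ω`. -/
def reduce (z : ℂ) : StateSpace b →L[ℂ] L2 b :=
  WithLp.sndL 2 ℂ (H1 b) (L2 b)
    - (c.cornerL - z • valL b) ∘L mulH1L b (fun x => (((c.ω x) ^ 2 : ℝ) : ℂ)) c.isC1Per_ωsq
      ∘L WithLp.fstL 2 ℂ (H1 b) (L2 b)

variable (b) in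
/-- The embedding of the first component of the state space. -/
def inlL : H1 b →L[ℂ] StateSpace b :=
  (WithLp.prodContinuousLinearEquiv 2 ℂ (H1 b) (L2 b)).symm.toContinuousLinearMap
    ∘L ContinuousLinearMap.inl ℂ (H1 b) (L2 b)

variable (b) in
/-- The embedding of the second component of the state space. -/
def inrL : L2 b →L[ℂ] StateSpace b :=
  (WithLp.prodContinuousLinearEquiv 2 ℂ (H1 b) (L2 b)).symm.toContinuousLinearMap
    ∘L ContinuousLinearMap.inr ℂ (H1 b) (L2 b)

/-- The bounded operator `u ↦ ω² u` from `H¹_per(Ω)` to `L²(Ω)`. -/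
def ωsqL : H1 b →L[ℂ] L2 b :=
  valL b ∘L mulH1L b (fun x => (((c.ω x) ^ 2 : ℝ) : ℂ)) c.isC1Per_ωsq

/-- The bounded operator `u ↦ (u, z ω² u)`. -/
def lift (z : ℂ) : H1 b →L[ℂ] StateSpace b := inlL b + z • (inrL b ∘L c.ωsqL)

/-- The bounded operator `(f, g) ↦ (0, ω² f)`. -/
def shift : StateSpace b →L[ℂ] StateSpace b :=
  inrL b ∘L c.ωsqL ∘L WithLp.fstL 2 ℂ (H1 b) (L2 b)

theorem T1_fst (k₂ : ℂ) (X : T1Domain b) : (c.T1 k₂ 0 X).fst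
    = mulH1 b (fun x => ((((c.ω x) ^ 2)⁻¹ : ℝ) : ℂ)) c.isC1Per_ωsq_inv (T1Domain.snd b X) := rfl

theorem T1_snd (k₂ : ℂ) (X : T1Domain b) : (c.T1 k₂ 0 X).snd
    = -c.hamiltonian ![0, k₂] (T1Domain.fst b X) + c.corner (T1Domain.snd b X) := by
  have : (c.T1 k₂ 0 X).snd = -(c.hamiltonian ![0, k₂] (T1Domain.fst b X)
    - (0 : ℂ) • H1.val b (T1Domain.fst b X : H1 b)) + c.corner (T1Domain.snd b X) := rfl
  rw [this, zero_smul, sub_zero]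

/-- The resolvent of `T₁(k₂)` in terms of the inverse of `H(z, k₂)`. -/
theorem isResolventAt_T1 {z k₂ : ℂ} {G : L2 b →L[ℂ] H1 b}
    (hG : IsInverseOf (c.hamiltonian ![z, k₂]) G) :
    IsResolventAt (c.T1 k₂ 0) z (c.shift - c.lift z ∘L G ∘L c.reduce z) := by
  set m2 := fun x => (((c.ω x) ^ 2 : ℝ) : ℂ) with hm2
  have hinv : ∀ x, ((((c.ω x) ^ 2)⁻¹ : ℝ) : ℂ) * m2 x = 1 := fun x => by
    rw [hm2, ← Complex.ofReal_mul, inv_mul_cancel₀ (pow_ne_zero 2 (c.ω_ne_zero x)),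
      Complex.ofReal_one]
  have hred : ∀ F : StateSpace b, c.reduce z F = F.snd
      - (c.corner (mulH1 b m2 c.isC1Per_ωsq F.fst)
        - z • H1.val b (mulH1 b m2 c.isC1Per_ωsq F.fst)) := fun F => rfl
  have hR1 : ∀ F : StateSpace b, ((c.shift - c.lift z ∘L G ∘L c.reduce z) F).fst
      = -G (c.reduce z F) := fun F => by
    have : ((c.shift - c.lift z ∘L G ∘L c.reduce z) F).fst
      = 0 - (G (c.reduce z F) + z • (0 : H1 b)) := rfl
    rw [this, smul_zero, add_zero, zero_sub]
  have hR2 : ∀ F : StateSpace b, ((c.shift - c.lift z ∘L G ∘L c.reduce z) F).snd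
      = H1.val b (mulH1 b m2 c.isC1Per_ωsq (F.fst - z • G (c.reduce z F))) := fun F => by
    have : ((c.shift - c.lift z ∘L G ∘L c.reduce z) F).snd
      = H1.val b (mulH1 b m2 c.isC1Per_ωsq F.fst)
        - ((0 : L2 b) + z • H1.val b (mulH1 b m2 c.isC1Per_ωsq (G (c.reduce z F)))) := rfl
    rw [this, zero_add]
    simp only [map_sub, map_smul]
  constructor
  · intro F
    -- The first row forces v = ω²(f + z u). Substituted in the second row, this leaves H(z, k₂) u =
    -- -`reduce z F`, since the z-dependence of H is exactly that of the pencil (`hamiltonian_eq`).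
    obtain ⟨u, hu, hKu⟩ := hG.right_inv (-c.reduce z F)
    rw [map_neg] at hu
    set W : H1 b := mulH1 b m2 c.isC1Per_ωsq (F.fst + z • (u : H1 b)) with hW
    let X : T1Domain b := ⟨WithLp.toLp 2 ((u : H1 b), H1.val b W), u.2, ⟨W, rfl⟩⟩
    have hX1 : T1Domain.fst b X = u := rfl
    have hX2 : T1Domain.snd b X = W := H1.val_injective b (T1Domain.val_snd X)
    refine ⟨X, ?_, ?_⟩
    · refine WithLp.ofLp_injective 2 (Prod.ext ?_ ?_)
      · exact hu.trans (hR1 F).symm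
      · refine Eq.trans ?_ (hR2 F).symm
        change H1.val b W = _
        rw [hW, hu, smul_neg, sub_eq_add_neg]
    · refine WithLp.ofLp_injective 2 (Prod.ext ?_ ?_)
      · change (c.T1 k₂ 0 X).fst - z • (u : H1 b) = F.fst
        rw [T1_fst, hX2, hW, mulH1_mulH1_of_mul_eq_one _ _ hinv, add_sub_cancel_right]
      · change (c.T1 k₂ 0 X).snd - z • H1.val b W = F.snd
        rw [T1_snd, hX1, hX2]
        rw [hamiltonian_eq, hred] at hKu
        have h0 : c.hamiltonian ![0, k₂] u = -(F.snd
            - (c.corner (mulH1 b m2 c.isC1Per_ωsq F.fst)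
              - z • H1.val b (mulH1 b m2 c.isC1Per_ωsq F.fst)))
            - ((-z) • c.corner (mulH1 b m2 c.isC1Per_ωsq (u : H1 b))
              + z ^ 2 • H1.val b (mulH1 b m2 c.isC1Per_ωsq (u : H1 b))) := eq_sub_of_add_eq hKu
        rw [h0, hW]
        simp only [map_add, map_smul]
        module
  · intro X
    set u := T1Domain.fst b X with hu
    set W := T1Domain.snd b X with hW
    set F : StateSpace b := c.T1 k₂ 0 X - z • (X : StateSpace b) with hF
    have hu' : (X : StateSpace b).fst = (u : H1 b) := rfl
    have hW' : (X : StateSpace b).snd = H1.val b W := (T1Domain.val_snd X).symm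
    have hF1 : F.fst = mulH1 b _ c.isC1Per_ωsq_inv W - z • (u : H1 b) := rfl
    have hF2 : F.snd = -c.hamiltonian ![0, k₂] u + c.corner W - z • H1.val b W := by
      have : F.snd = (c.T1 k₂ 0 X).snd - z • (X : StateSpace b).snd := rfl
      rw [this, hW']
      exact congrArg (· - z • H1.val b W) (c.T1_snd k₂ X)
    have hWF : mulH1 b m2 c.isC1Per_ωsq F.fst
        = W - z • mulH1 b m2 c.isC1Per_ωsq (u : H1 b) := by
      rw [hF1, map_sub, map_smul, mulH1_mulH1_of_mul_eq_one c.isC1Per_ωsq c.isC1Per_ωsq_inv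
        fun x => by rw [mul_comm]; exact hinv x]
    have hredF : c.reduce z F = -c.hamiltonian ![z, k₂] u := by
      rw [hred, hWF, hF2, hamiltonian_eq c z]
      simp only [map_sub, map_smul]
      module
    have hGF : G (c.reduce z F) = -(u : H1 b) := by rw [hredF, map_neg, hG.left_inv]
    refine WithLp.ofLp_injective 2 (Prod.ext ?_ ?_)
    · refine (hR1 F).trans ?_
      rw [hGF, neg_neg]
      rfl
    · refine (hR2 F).trans ?_
      rw [hGF, smul_neg, sub_neg_eq_add, map_add, hWF, map_smul, sub_add_cancel]
      exact hW'.symm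

end Coefficients

end Linearization

namespace Coefficients

variable {b : Module.Basis (Fin 2) ℝ Plane} {c : Coefficients b} {φ : Plane → ℝ}

/-! ### Inversion of the modified operator -/

/-- Multiplication by `θ` in `L²(Ω)`. -/
def thetaL (hφ : c.IsGauge φ) (s : ℝ) : L2 b →L[ℂ] L2 b :=
  mulL2 b (c.theta φ s) (memLp_top_of_continuous (isC1Per_theta hφ s).contDiff.continuous)

/-- Multiplication by `θ⁻¹` in `L²(Ω)`. -/
def thetaInvL (hφ : c.IsGauge φ) (s : ℝ) : L2 b →L[ℂ] L2 b :=
  mulL2 b (c.thetaInv φ s) (memLp_top_of_continuous (isC1Per_thetaInv hφ s).contDiff.continuous)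

/-- Multiplication by `θ⁻² Q` in `L²(Ω)`, where `Q` is the remainder of the factorization. -/
def potentialL (hφ : c.IsGauge φ) (s : ℝ) : L2 b →L[ℂ] L2 b :=
  thetaInvL hφ s ∘L mulL2 b (c.remainder φ s) (memLp_remainder hφ s) ∘L thetaInvL hφ s

/-- The inverse `p(D)⁻¹ e^{-2sφ} q(D)⁻¹` of the principal part. -/
def principalInv (hφ : c.IsGauge φ) (s : ℝ) (p q : (Fin 2 → ℤ) → ℂ) : L2 b →L[ℂ] H1 b :=
  invOp b p ∘L valL b ∘L mulH1L b (weight φ (-s)) (isC1Per_weight hφ (-s)) ∘L invOp b q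

/-- The inverse of the principal part perturbed by the bounded potential. -/
def perturbedInv (hφ : c.IsGauge φ) (s : ℝ) (p q : (Fin 2 → ℤ) → ℂ) : L2 b →L[ℂ] H1 b :=
  principalInv hφ s p q
    ∘L Ring.inverse (1 + potentialL hφ s ∘L valL b ∘L principalInv hφ s p q)

/-- The inverse of the modification of `H(k)`. -/
def modifiedInv (hφ : c.IsGauge φ) (s : ℝ) (p q : (Fin 2 → ℤ) → ℂ) : L2 b →L[ℂ] H1 b :=
  mulH1L b (c.thetaInv φ s) (isC1Per_thetaInv hφ s) ∘L perturbedInv hφ s p q ∘L thetaInvL hφ s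

/-- The normalized Fourier coefficient of `θ u` with index `m`. -/
def modeCoef (hφ : c.IsGauge φ) (s : ℝ) (m : Fin 2 → ℤ) : H1 b →L[ℂ] ℂ :=
  ((volume.real (cell b) : ℝ) : ℂ)⁻¹ •
    (coef b m ∘L valL b ∘L mulH1L b (c.theta φ s) (isC1Per_theta hφ s))

/-- The function `P (e^{2sφ} χₘ)`, where `P = -i∂₁ - s∂₂ + μ`. -/
def modeVec (hφ : c.IsGauge φ) (s : ℝ) (μ : ℂ) (m : Fin 2 → ℤ) : L2 b :=
  crOp b (-s) μ (mulH1 b (weight φ s) (isC1Per_weight hφ s) (chiH1 b m))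

/-- The symbol of `Pₛ`, modified at the index `m₀`. -/
def modSym (b : Module.Basis (Fin 2) ℝ Plane) (s : ℝ) (μ : ℂ) (m₀ : Fin 2 → ℤ) (t : ℂ)
    (m : Fin 2 → ℤ) : ℂ := crSym b s μ m + if m = m₀ then t else 0

theorem invOp_injective {p : (Fin 2 → ℤ) → ℂ} (hp : IsElliptic b p) :
    Function.Injective (invOp b p) := by
  intro f g h
  refine ext_coef fun m => mul_left_cancel₀ (inv_ne_zero (hp.ne_zero m)) ?_
  rw [← coef_invOp hp, ← coef_invOp hp, h]

theorem thetaL_thetaInvL (hφ : c.IsGauge φ) (s : ℝ) (f : L2 b) :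
    thetaL hφ s (thetaInvL hφ s f) = f :=
  mulL2_mulL2_of_mul_eq_one _ _ (theta_mul_thetaInv s) f

theorem thetaInvL_thetaL (hφ : c.IsGauge φ) (s : ℝ) (f : L2 b) :
    thetaInvL hφ s (thetaL hφ s f) = f :=
  mulL2_mulL2_of_mul_eq_one _ _ (fun x => by rw [mul_comm]; exact theta_mul_thetaInv s x) f

theorem weight_neg_mul_weight (s : ℝ) (x : Plane) : weight φ (-s) x * weight φ s x = 1 := by
  rw [mul_comm]
  exact weight_mul_weight_neg s x

theorem mulH1_weight_cancel (hφ : c.IsGauge φ) (s : ℝ) (y : H1 b) :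
    mulH1 b _ (isC1Per_weight hφ (-s)) (mulH1 b _ (isC1Per_weight hφ s) y) = y :=
  mulH1_mulH1_of_mul_eq_one _ _ (weight_neg_mul_weight s) y

theorem principalInv_apply (hφ : c.IsGauge φ) (s : ℝ) (p q : (Fin 2 → ℤ) → ℂ) (f : L2 b) :
    principalInv hφ s p q f = invOp b p (H1.val b
      (mulH1 b (weight φ (-s)) (isC1Per_weight hφ (-s)) (invOp b q f))) := rfl

theorem principalInv_injective (hφ : c.IsGauge φ) (s : ℝ) {p q : (Fin 2 → ℤ) → ℂ}
    (hp : IsElliptic b p) (hq : IsElliptic b q) : Function.Injective (principalInv hφ s p q) := by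
  intro f g h
  rw [principalInv_apply, principalInv_apply] at h
  have h1 := H1.val_injective b (invOp_injective hp h)
  have h2 := congrArg (mulH1 b _ (isC1Per_weight hφ s)) h1
  rw [mulH1_mulH1_of_mul_eq_one _ _ (weight_mul_weight_neg s),
    mulH1_mulH1_of_mul_eq_one _ _ (weight_mul_weight_neg s)] at h2
  exact invOp_injective hq h2

theorem principalInv_mem_H2 (hφ : c.IsGauge φ) (s : ℝ) {p : (Fin 2 → ℤ) → ℂ}
    (hp : IsElliptic b p) (q : (Fin 2 → ℤ) → ℂ) (f : L2 b) : principalInv hφ s p q f ∈ H2 b := by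
  rw [principalInv_apply]
  exact invOp_mem_H2 hp _

/-- The principal part maps `y` with `p(D) w = y` to `q(D) e^{2sφ} y`. -/
theorem principalInv_eq (hφ : c.IsGauge φ) {s : ℝ} {μ : ℂ} {p : (Fin 2 → ℤ) → ℂ}
    (hp : IsElliptic b p) (hq : IsElliptic b (crSym b (-s) μ)) {w y : H1 b}
    (h : ∀ m, coef b m (H1.val b y) = p m * coef b m (H1.val b w)) :
    principalInv hφ s p (crSym b (-s) μ)
      (crOp b (-s) μ (mulH1 b _ (isC1Per_weight hφ s) y)) = w := by
  have h1 : invOp b (crSym b (-s) μ) (crOp b (-s) μ (mulH1 b _ (isC1Per_weight hφ s) y))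
      = mulH1 b _ (isC1Per_weight hφ s) y :=
    H1.val_injective b ((val_invOp_eq_iff hq).2 fun m => coef_crOp _ _ _ _)
  refine H1.val_injective b ?_
  rw [principalInv_apply, h1, mulH1_weight_cancel hφ s]
  exact (val_invOp_eq_iff hp).2 h

/-- On this vector the outer factor and the weight cancel and only the multiplier p⁻¹ acts on one
exponential. It gives the determinant without potential exactly, as 1 - t/p(m). -/
theorem principalInv_modeVec (hφ : c.IsGauge φ) {s : ℝ} {μ : ℂ} {p : (Fin 2 → ℤ) → ℂ}
    (hp : IsElliptic b p) (hq : IsElliptic b (crSym b (-s) μ)) (m : Fin 2 → ℤ) :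
    principalInv hφ s p (crSym b (-s) μ) (modeVec hφ s μ m) = (p m)⁻¹ • chiH1 b m := by
  refine principalInv_eq hφ hp hq fun n => ?_
  rw [map_smul, map_smul, val_chiH1, smul_eq_mul, coef_chiL2]
  split_ifs with h
  · rw [← h, mul_inv_cancel_left₀ (hp.ne_zero m)]
  · simp

theorem coef_add_chiH1 (y : H1 b) (τ : ℂ) (m₀ m : Fin 2 → ℤ) :
    coef b m (H1.val b (y + (((volume.real (cell b) : ℝ) : ℂ)⁻¹ * τ) • chiH1 b m₀))
      = coef b m (H1.val b y) + if m = m₀ then τ else 0 := by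
  have hv : ((volume.real (cell b) : ℝ) : ℂ) ≠ 0 := by exact_mod_cast (cell_measureReal_pos b).ne'
  rw [map_add, map_smul, map_add, map_smul, val_chiH1, coef_chiL2, smul_eq_mul]
  simp only [eq_comm (a := m₀)]
  split_ifs
  · field_simp
  · rw [mul_zero]

/-- The action of the modified operator in terms of the principal part. -/
theorem exists_principalInv_eq (hφ : c.IsGauge φ) {s : ℝ} (hs : s = 1 ∨ s = -1) {z k₂ t : ℂ}
    {m₀ : Fin 2 → ℤ} (hp : IsElliptic b (modSym b s (z + s * Complex.I * k₂) m₀ t))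
    (hq : IsElliptic b (crSym b (-s) (z - s * Complex.I * k₂))) (u : H2 b) : ∃ h : L2 b,
      principalInv hφ s (modSym b s (z + s * Complex.I * k₂) m₀ t)
          (crSym b (-s) (z - s * Complex.I * k₂)) h
        = mulH1 b (c.theta φ s) (isC1Per_theta hφ s) (u : H1 b) ∧
      c.hamiltonian ![z, k₂] u + (t • modeCoef hφ s m₀) (u : H1 b)
          • thetaL hφ s (modeVec hφ s (z - s * Complex.I * k₂) m₀)
        = thetaL hφ s (h + potentialL hφ s
          (H1.val b (mulH1 b (c.theta φ s) (isC1Per_theta hφ s) (u : H1 b)))) := by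
  obtain ⟨y, hy, hH⟩ := hamiltonian_factorization hφ hs z k₂ u
  set w := mulH1 b (c.theta φ s) (isC1Per_theta hφ s) (u : H1 b) with hw
  set v := ((volume.real (cell b) : ℝ) : ℂ)⁻¹
  -- Changing the symbol by t at m₀ adds one exponential to Pₛw; carried through the outer factors,
  -- it becomes the rank-one term with vector `modeVec`.
  set y' := y + (v * (t * coef b m₀ (H1.val b w))) • chiH1 b m₀ with hy'
  refine ⟨crOp b (-s) (z - s * Complex.I * k₂) (mulH1 b _ (isC1Per_weight hφ s) y'),
    principalInv_eq hφ hp hq fun m => ?_, ?_⟩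
  · rw [hy', coef_add_chiH1, hy, coef_crOp, modSym]
    split_ifs with h
    · rw [h]; ring
    · ring
  · have h1 : (t • modeCoef hφ s m₀) (u : H1 b) = v * (t * coef b m₀ (H1.val b w)) := by
      have : (t • modeCoef hφ s m₀) (u : H1 b) = t • (v • coef b m₀ (H1.val b w)) := rfl
      rw [this, smul_eq_mul, smul_eq_mul]
      ring
    have h2 : mulL2 b (c.remainder φ s) (memLp_remainder hφ s) (H1.val b (u : H1 b))
        = thetaL hφ s (potentialL hφ s (H1.val b w)) := by
      have h3 : H1.val b w = thetaL hφ s (H1.val b (u : H1 b)) := rfl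
      rw [h3, potentialL]
      simp only [ContinuousLinearMap.comp_apply]
      rw [thetaInvL_thetaL, thetaL_thetaInvL]
    rw [hH, h1, h2, hy', map_add (thetaL hφ s), map_add (mulH1 b _ _), map_smul (mulH1 b _ _),
      map_add (crOp b _ _), map_smul (crOp b _ _), map_add (thetaL hφ s), map_smul (thetaL hφ s)]
    change thetaL hφ s _ + _ + _ = _
    rw [modeVec]
    abel

/-- The modified operator is invertible, provided that the potential is relatively small. -/
theorem isInverseOf_modified (hφ : c.IsGauge φ) {s : ℝ} (hs : s = 1 ∨ s = -1) {z k₂ t : ℂ}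
    {m₀ : Fin 2 → ℤ} {p q : (Fin 2 → ℤ) → ℂ} (hpe : p = modSym b s (z + s * Complex.I * k₂) m₀ t)
    (hqe : q = crSym b (-s) (z - s * Complex.I * k₂)) (hp : IsElliptic b p) (hq : IsElliptic b q)
    (hu : IsUnit (1 + potentialL hφ s ∘L valL b ∘L principalInv hφ s p q)) :
    IsInverseOf (c.hamiltonian ![z, k₂] +
        ((t • modeCoef hφ s m₀).toLinearMap ∘ₗ (H2 b).subtype).smulRight
          (thetaL hφ s (modeVec hφ s (z - s * Complex.I * k₂) m₀)))
      (modifiedInv hφ s p q) := by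
  have key := fun u => exists_principalInv_eq hφ hs (hpe ▸ hp) (hqe ▸ hq) u
  rw [← hpe, ← hqe] at key
  set E := principalInv hφ s p q with hE
  set N := Ring.inverse (1 + potentialL hφ s ∘L valL b ∘L E)
  have hK : ∀ u : H2 b, (c.hamiltonian ![z, k₂] +
      ((t • modeCoef hφ s m₀).toLinearMap ∘ₗ (H2 b).subtype).smulRight
          (thetaL hφ s (modeVec hφ s (z - s * Complex.I * k₂) m₀))) u
      = c.hamiltonian ![z, k₂] u + (t • modeCoef hφ s m₀) (u : H1 b)
          • thetaL hφ s (modeVec hφ s (z - s * Complex.I * k₂) m₀) := fun u => rfl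
  have hG : ∀ f, modifiedInv hφ s p q f
      = mulH1 b (c.thetaInv φ s) (isC1Per_thetaInv hφ s) (E (N (thetaInvL hφ s f))) := fun f => rfl
  have h1 : ∀ h, h + potentialL hφ s (H1.val b (E h))
      = (1 + potentialL hφ s ∘L valL b ∘L E) h := fun h => rfl
  have hN : ∀ g, (1 + potentialL hφ s ∘L valL b ∘L E) (N g) = g := fun g => by
    rw [← mul_apply_eq_comp, Ring.mul_inverse_cancel _ hu, one_apply_eq_self]
  have hN' : ∀ g, N ((1 + potentialL hφ s ∘L valL b ∘L E) g) = g := fun g => by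
    rw [← mul_apply_eq_comp, Ring.inverse_mul_cancel _ hu, one_apply_eq_self]
  have hti : ∀ x, c.thetaInv φ s x * c.theta φ s x = 1 := fun x => by
    rw [mul_comm]; exact theta_mul_thetaInv s x
  constructor
  · intro f
    have hmem : modifiedInv hφ s p q f ∈ H2 b := by
      rw [hG]
      exact mulH1_mem_H2 _ (isC1Per_pd (contDiff_thetaInv hφ s) (isPer_thetaInv hφ s))
        (principalInv_mem_H2 hφ s hp q _)
    refine ⟨⟨_, hmem⟩, rfl, ?_⟩
    obtain ⟨h, hEh, hKu⟩ := key ⟨_, hmem⟩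
    have h2 : mulH1 b (c.theta φ s) (isC1Per_theta hφ s) (modifiedInv hφ s p q f)
        = E (N (thetaInvL hφ s f)) := by
      rw [hG, mulH1_mulH1_of_mul_eq_one _ _ (theta_mul_thetaInv s)]
    rw [h2] at hEh hKu
    -- Injectivity identifies the preimage h supplied by `key` with the explicit vector obtained
    -- from the Neumann inverse.
    have h3 := principalInv_injective hφ s hp hq hEh
    rw [hK, hKu, h3, h1, hN, thetaL_thetaInvL]
  · intro u
    obtain ⟨h, hEh, hKu⟩ := key u
    rw [hK, hKu, ← hEh, h1, hG, thetaInvL_thetaL, hN', hEh, mulH1_mulH1_of_mul_eq_one _ _ hti]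

/-- The determinant that decides on the invertibility of the operator. -/
def det (hφ : c.IsGauge φ) (s : ℝ) (p q : (Fin 2 → ℤ) → ℂ) (μ t : ℂ) (m : Fin 2 → ℤ) : ℂ :=
  1 - t * (((volume.real (cell b) : ℝ) : ℂ)⁻¹ *
    coef b m (valL b (perturbedInv hφ s p q (modeVec hφ s μ m))))

/-- The factors θ and θ⁻¹ cancel, which connects the Sherman–Morrison denominator with the form of
`det` that is convenient for estimates. -/
theorem det_eq (hφ : c.IsGauge φ) (s : ℝ) (p q : (Fin 2 → ℤ) → ℂ) (μ t : ℂ) (m : Fin 2 → ℤ) :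
    det hφ s p q μ t m = 1 - (t • modeCoef hφ s m)
      (modifiedInv hφ s p q (thetaL hφ s (modeVec hφ s μ m))) := by
  have h1 : modifiedInv hφ s p q (thetaL hφ s (modeVec hφ s μ m))
      = mulH1 b (c.thetaInv φ s) (isC1Per_thetaInv hφ s)
        (perturbedInv hφ s p q (modeVec hφ s μ m)) := by
    conv_rhs => rw [← thetaInvL_thetaL hφ s (modeVec hφ s μ m)]
    rfl
  have h2 : ∀ w, (t • modeCoef hφ s m) (mulH1 b (c.thetaInv φ s) (isC1Per_thetaInv hφ s) w)
      = t * (((volume.real (cell b) : ℝ) : ℂ)⁻¹ * coef b m (valL b w)) := by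
    intro w
    have : (t • modeCoef hφ s m) (mulH1 b (c.thetaInv φ s) (isC1Per_thetaInv hφ s) w)
      = t * (((volume.real (cell b) : ℝ) : ℂ)⁻¹ * coef b m (H1.val b
        (mulH1 b (c.theta φ s) (isC1Per_theta hφ s)
          (mulH1 b (c.thetaInv φ s) (isC1Per_thetaInv hφ s) w)))) := rfl
    rw [this, mulH1_mulH1_of_mul_eq_one _ _ (theta_mul_thetaInv s), valL_apply]
  rw [h1, h2, det]

/-- The inverse of `H(z, k₂)` in terms of the inverse of the modified operator. -/
theorem isInverseOf_hamiltonian (hφ : c.IsGauge φ) {s : ℝ} (hs : s = 1 ∨ s = -1) {z k₂ t : ℂ}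
    {m₀ : Fin 2 → ℤ} {p q : (Fin 2 → ℤ) → ℂ} (hpe : p = modSym b s (z + s * Complex.I * k₂) m₀ t)
    (hqe : q = crSym b (-s) (z - s * Complex.I * k₂)) (hp : IsElliptic b p) (hq : IsElliptic b q)
    (hu : IsUnit (1 + potentialL hφ s ∘L valL b ∘L principalInv hφ s p q))
    (hd : det hφ s p q (z - s * Complex.I * k₂) t m₀ ≠ 0) :
    IsInverseOf (c.hamiltonian ![z, k₂]) (modifiedInv hφ s p q
      + (det hφ s p q (z - s * Complex.I * k₂) t m₀)⁻¹ • (modifiedInv hφ s p q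
        ∘L (t • modeCoef hφ s m₀).smulRight
          (thetaL hφ s (modeVec hφ s (z - s * Complex.I * k₂) m₀)) ∘L modifiedInv hφ s p q)) := by
  have h := isInverseOf_modified hφ hs hpe hqe hp hq hu
  have hdet := det_eq hφ s p q (z - s * Complex.I * k₂) t m₀
  generalize modifiedInv hφ s p q = G at h hdet ⊢
  generalize thetaL hφ s (modeVec hφ s (z - s * Complex.I * k₂) m₀) = β at h hdet ⊢
  generalize t • modeCoef hφ s m₀ = ℓ at h hdet ⊢
  exact h.sub_rankOne (fun u => rfl) hdet hd

theorem norm_chiL2_sq (m : Fin 2 → ℤ) : ‖chiL2 b m‖ ^ 2 = volume.real (cell b) := by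
  have h1 : inner ℂ (chiL2 b m) (chiL2 b m) = ((volume.real (cell b) : ℝ) : ℂ) := by
    have h : inner ℂ (chiL2 b m) (chiL2 b m) = coef b m (chiL2 b m) := rfl
    rw [h, coef_chiL2, if_pos rfl]
  rw [inner_self_eq_norm_sq_to_K] at h1
  refine Complex.ofReal_injective ?_
  rw [Complex.ofReal_pow]
  exact h1

/-- The determinant is close to the one without potential. -/
theorem norm_det_sub_le (hφ : c.IsGauge φ) {s : ℝ} {μ t : ℂ} {m₀ : Fin 2 → ℤ}
    {p : (Fin 2 → ℤ) → ℂ} (hp : IsElliptic b p) (hq : IsElliptic b (crSym b (-s) μ)) {ε : ℝ}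
    (hε : ‖potentialL hφ s‖ * ‖valL b ∘L principalInv hφ s p (crSym b (-s) μ)‖ ≤ ε)
    (hε2 : ε ≤ 1 / 2) :
    ‖det hφ s p (crSym b (-s) μ) μ t m₀ - (1 - t / p m₀)‖ ≤ 2 * ε * ‖t‖ / ‖p m₀‖ := by
  set E := principalInv hφ s p (crSym b (-s) μ) with hE
  set B := potentialL hφ s ∘L valL b ∘L E with hB
  have hBn : ‖B‖ ≤ ε := (ContinuousLinearMap.opNorm_comp_le _ _).trans hε
  have hu : IsUnit (1 + B) := by
    have := isUnit_one_sub_of_norm_lt_one (x := -B) (by rw [norm_neg]; linarith)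
    rwa [sub_neg_eq_add] at this
  set h := Ring.inverse (1 + B) (modeVec hφ s μ m₀) with hh
  have h1 : h + potentialL hφ s (valL b (E h)) = modeVec hφ s μ m₀ := by
    have : (1 + B) h = modeVec hφ s μ m₀ := by
      rw [hh, ← mul_apply_eq_comp, Ring.mul_inverse_cancel _ hu, one_apply_eq_self]
    exact this
  set x := valL b (E h) with hx
  -- A fixed-point equation: the leading term is explicit, and the correction has norm at most ε‖x‖.
  -- As ε ≤ 1/2, it also bounds ‖x‖ by twice the leading term.
  have hxe : x = (p m₀)⁻¹ • chiL2 b m₀ - (valL b ∘L E) (potentialL hφ s x) := by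
    have h2 : E h = (p m₀)⁻¹ • chiH1 b m₀ - E (potentialL hφ s x) := by
      rw [← principalInv_modeVec hφ hp hq m₀, ← hE, ← map_sub, ← h1, add_sub_cancel_right]
    conv_lhs => rw [hx, h2]
    rw [map_sub, map_smul, valL_apply, val_chiH1]
    rfl
  have hpp : 0 < ‖p m₀‖ := norm_pos_iff.2 (hp.ne_zero m₀)
  have hEQ : ‖(valL b ∘L E) (potentialL hφ s x)‖ ≤ ε * ‖x‖ := by
    calc _ ≤ ‖valL b ∘L E‖ * (‖potentialL hφ s‖ * ‖x‖) :=
          (ContinuousLinearMap.le_opNorm _ _).trans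
            (mul_le_mul_of_nonneg_left (ContinuousLinearMap.le_opNorm _ _) (norm_nonneg _))
      _ = ‖potentialL hφ s‖ * ‖valL b ∘L E‖ * ‖x‖ := by ring
      _ ≤ _ := mul_le_mul_of_nonneg_right hε (norm_nonneg _)
  have hxn : ‖x‖ ≤ 2 * (‖p m₀‖⁻¹ * ‖chiL2 b m₀‖) := by
    have h2 : ‖x‖ ≤ ‖p m₀‖⁻¹ * ‖chiL2 b m₀‖ + ε * ‖x‖ := by
      calc ‖x‖ = ‖(p m₀)⁻¹ • chiL2 b m₀ - (valL b ∘L E) (potentialL hφ s x)‖ := by rw [← hxe]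
        _ ≤ ‖(p m₀)⁻¹ • chiL2 b m₀‖ + ‖(valL b ∘L E) (potentialL hφ s x)‖ := norm_sub_le _ _
        _ ≤ _ := by
          rw [norm_smul, norm_inv]
          exact add_le_add le_rfl hEQ
    have h3 : ε * ‖x‖ ≤ 1 / 2 * ‖x‖ := mul_le_mul_of_nonneg_right hε2 (norm_nonneg _)
    linarith
  have hv := cell_measureReal_pos b
  have hvc : ((volume.real (cell b) : ℝ) : ℂ) ≠ 0 := by exact_mod_cast hv.ne'
  have hcoef : ‖coef b m₀ ((valL b ∘L E) (potentialL hφ s x))‖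
      ≤ ‖chiL2 b m₀‖ * (ε * (2 * (‖p m₀‖⁻¹ * ‖chiL2 b m₀‖))) := by
    have hε0 : 0 ≤ ε := (mul_nonneg (norm_nonneg _) (norm_nonneg _)).trans hε
    refine (norm_inner_le_norm (𝕜 := ℂ) (chiL2 b m₀) _).trans ?_
    exact mul_le_mul_of_nonneg_left (hEQ.trans (mul_le_mul_of_nonneg_left hxn hε0)) (norm_nonneg _)
  have hdet : det hφ s p (crSym b (-s) μ) μ t m₀ - (1 - t / p m₀)
      = t * ((((volume.real (cell b) : ℝ) : ℂ)⁻¹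
        * coef b m₀ ((valL b ∘L E) (potentialL hφ s x)))) := by
    have h2 : det hφ s p (crSym b (-s) μ) μ t m₀
        = 1 - t * (((volume.real (cell b) : ℝ) : ℂ)⁻¹ * coef b m₀ x) := rfl
    have h3 : coef b m₀ x = (p m₀)⁻¹ * ((volume.real (cell b) : ℝ) : ℂ)
        - coef b m₀ ((valL b ∘L E) (potentialL hφ s x)) := by
      conv_lhs => rw [hxe]
      rw [map_sub, map_smul, coef_chiL2, if_pos rfl, smul_eq_mul]
    rw [h2, h3]
    field_simp
    ring
  rw [hdet, norm_mul, norm_mul, norm_inv, Complex.norm_real, Real.norm_of_nonneg hv.le]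
  calc ‖t‖ * ((volume.real (cell b))⁻¹ * ‖coef b m₀ ((valL b ∘L E) (potentialL hφ s x))‖)
      ≤ ‖t‖ * ((volume.real (cell b))⁻¹
        * (‖chiL2 b m₀‖ * (ε * (2 * (‖p m₀‖⁻¹ * ‖chiL2 b m₀‖))))) := by gcongr
    _ = ‖t‖ * ((volume.real (cell b))⁻¹
        * (‖chiL2 b m₀‖ ^ 2 * (ε * (2 * ‖p m₀‖⁻¹)))) := by ring
    _ = 2 * ε * ‖t‖ / ‖p m₀‖ := by
      rw [norm_chiL2_sq]
      field_simp

end Coefficients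

/-! ### Smallness of the inverse of the principal part -/

section Smallness

variable {b : Module.Basis (Fin 2) ℝ Plane}

theorem mulL2_sub_trigPoly {f : Plane → ℂ} (hf : Continuous f) (a : (Fin 2 → ℤ) →₀ ℂ)
    (hg : Continuous fun x => f x - a.sum fun m k => k * chi b m x) :
    mulL2 b f (memLp_top_of_continuous hf)
      = mulL2 b _ (memLp_top_of_continuous hg)
        + ∑ m ∈ a.support, a m • mulL2 b (chi b m) (memLp_top_of_continuous (continuous_chi m)) := by
  ext1 u
  refine ext_coef fun n => ?_
  rw [add_apply, map_add, sum_apply, map_sum]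
  have h1 : ∀ m ∈ a.support,
      coef b n ((a m • mulL2 b (chi b m) (memLp_top_of_continuous (continuous_chi m))) u)
        = ∫ x in cell b, u x * (a m * chi b m x * chi b (-n) x) := by
    intro m _
    rw [smul_apply, map_smul, coef_apply, integral_mulL2, smul_eq_mul, ← integral_const_mul]
    exact integral_congr_ae (Filter.Eventually.of_forall fun x => by ring)
  rw [Finset.sum_congr rfl h1, coef_apply, coef_apply, integral_mulL2, integral_mulL2,
    ← integral_finsetSum, ← integral_add]
  · refine integral_congr_ae (Filter.Eventually.of_forall fun x => ?_)
    simp only [Finsupp.sum, ← Finset.mul_sum, ← Finset.sum_mul]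
    ring
  · exact integrable_mul u (hg.mul (continuous_chi _))
  · exact integrable_finsetSum _ fun m _ =>
      integrable_mul u ((continuous_const.mul (continuous_chi _)).mul (continuous_chi _))
  · exact fun m _ => integrable_mul u ((continuous_const.mul (continuous_chi _)).mul (continuous_chi _))

/-- A product of inverse multipliers with an exponential in between. -/
theorem norm_invOp_chi_invOp_le {p q : (Fin 2 → ℤ) → ℂ} (hp : IsElliptic b p)
    (hq : IsElliptic b q) (γ : Fin 2 → ℤ) {C : ℝ} (hC : ∀ m, ‖(p (m + γ))⁻¹ * (q m)⁻¹‖ ≤ C) :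
    ‖(valL b ∘L invOp b p) ∘L mulL2 b (chi b γ) (memLp_top_of_continuous (continuous_chi γ))
      ∘L (valL b ∘L invOp b q)‖ ≤ C := by
  obtain ⟨M, hM, hMC⟩ := exists_multiplier (b := b) hC
  have h : (valL b ∘L invOp b p) ∘L mulL2 b (chi b γ) (memLp_top_of_continuous (continuous_chi γ))
      ∘L (valL b ∘L invOp b q)
      = mulL2 b (chi b γ) (memLp_top_of_continuous (continuous_chi γ)) ∘L M := by
    ext1 u
    refine ext_coef fun n => ?_
    simp only [ContinuousLinearMap.comp_apply, valL_apply]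
    rw [coef_invOp hp, coef_mulL2_chi, coef_mulL2_chi, coef_invOp hq, hM, sub_add_cancel, mul_assoc]
  rw [h]
  calc _ ≤ ‖mulL2 b (chi b γ) (memLp_top_of_continuous (continuous_chi γ))‖ * ‖M‖ :=
        ContinuousLinearMap.opNorm_comp_le _ _
    _ ≤ 1 * C := mul_le_mul (norm_mulL2_le _ zero_le_one fun x => (norm_chi γ x).le) hMC
        (norm_nonneg _) zero_le_one
    _ = C := one_mul C

/-- The index m drops out, so one lower bound on |(μ - ν).re| keeps the two symbols from being small
together at any m, for each fixed shift γ. -/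
theorem crSym_sub_re {s : ℝ} {μ ν : ℂ} (m γ : Fin 2 → ℤ) :
    (crSym b s μ (m + γ) - crSym b (-s) ν m).re = freq b γ 0 + (μ - ν).re := by
  simp only [crSym, freq_add]
  simp
  ring

/-- The inverse of the principal part is small if the zero sets of the two symbols are far
apart. -/
theorem Coefficients.exists_norm_principalInv_le {c : Coefficients b} {φ : Plane → ℝ}
    (hφ : c.IsGauge φ) (s : ℝ) {ε δ T : ℝ} (hε : 0 < ε) (hδ : 0 < δ) : ∃ K : ℝ,
    ∀ (p : (Fin 2 → ℤ) → ℂ) (μ ν : ℂ), IsElliptic b p → IsElliptic b (crSym b (-s) ν) →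
      (∀ m, δ ≤ ‖p m‖) → (∀ m, δ ≤ ‖crSym b (-s) ν m‖) → (∀ m, ‖p m - crSym b s μ m‖ ≤ T) →
      K ≤ |(μ - ν).re| → ‖valL b ∘L principalInv hφ s p (crSym b (-s) ν)‖ ≤ ε := by
  have hw := isC1Per_weight hφ (-s)
  have hwc := hw.contDiff.continuous
  -- Each inverse multiplier has norm at most δ⁻¹, so this tolerance contributes ε/2.
  obtain ⟨a, ha⟩ := exists_trigPoly_near hwc hw.per (ε := ε * δ ^ 2 / 2) (by positivity)
  have hg : Continuous fun x => weight φ (-s) x - a.sum fun m k => k * chi b m x :=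
    hwc.sub (continuous_finsetSum _ fun m _ => continuous_const.mul (continuous_chi m))
  set S := ∑ m ∈ a.support, ‖a m‖ with hS
  have hS0 : 0 ≤ S := Finset.sum_nonneg fun _ _ => norm_nonneg _
  -- Chosen so that S/(δΛ) ≤ ε/2; the summand 1 keeps Λ positive when S = 0.
  set Λ := 2 * (S + 1) / (δ * ε) with hΛ
  have hΛ0 : 0 < Λ := by positivity
  refine ⟨2 * Λ + ∑ m ∈ a.support, |freq b m 0| + T, fun p μ ν hp hq hpδ hqδ hpT hK => ?_⟩
  set P := valL b ∘L invOp b p with hP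
  set Q := valL b ∘L invOp b (crSym b (-s) ν) with hQ
  have hPn : ‖P‖ ≤ δ⁻¹ := norm_valL_comp_invOp_le hp hδ hpδ
  have hQn : ‖Q‖ ≤ δ⁻¹ := norm_valL_comp_invOp_le hq hδ hqδ
  set W := mulL2 b (fun x => weight φ (-s) x - a.sum fun m k => k * chi b m x)
    (memLp_top_of_continuous hg) with hW
  have hE : valL b ∘L principalInv hφ s p (crSym b (-s) ν)
      = P ∘L W ∘L Q + ∑ m ∈ a.support,
        a m • (P ∘L mulL2 b (chi b m) (memLp_top_of_continuous (continuous_chi m)) ∘L Q) := by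
    have h1 : valL b ∘L principalInv hφ s p (crSym b (-s) ν)
        = P ∘L mulL2 b (weight φ (-s)) (memLp_top_of_continuous hwc) ∘L Q := rfl
    rw [h1, mulL2_sub_trigPoly hwc a hg]
    ext1 u
    simp [W]
  have hterm : ∀ m ∈ a.support, ‖a m •
      (P ∘L mulL2 b (chi b m) (memLp_top_of_continuous (continuous_chi m)) ∘L Q)‖
      ≤ ‖a m‖ * (δ⁻¹ * Λ⁻¹) := by
    intro γ hγ
    rw [norm_smul]
    refine mul_le_mul_of_nonneg_left (norm_invOp_chi_invOp_le hp hq γ fun m => ?_) (norm_nonneg _)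
    have h1 : |freq b γ 0| ≤ ∑ m ∈ a.support, |freq b m 0| :=
      Finset.single_le_sum (f := fun m => |freq b m 0|) (fun _ _ => abs_nonneg _) hγ
    have h2 : |(μ - ν).re| - |freq b γ 0|
        ≤ ‖crSym b s μ (m + γ) - crSym b (-s) ν m‖ := by
      refine le_trans ?_ (Complex.abs_re_le_norm _)
      rw [crSym_sub_re, add_comm]
      have := abs_sub_abs_le_abs_sub ((μ - ν).re) (-freq b γ 0)
      rwa [abs_neg, sub_neg_eq_add] at this
    have h3 : ‖crSym b s μ (m + γ) - crSym b (-s) ν m‖ ≤ T + ‖p (m + γ)‖ + ‖crSym b (-s) ν m‖ := by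
      have e : crSym b s μ (m + γ) - crSym b (-s) ν m
          = -(p (m + γ) - crSym b s μ (m + γ)) + p (m + γ) - crSym b (-s) ν m := by ring
      rw [e]
      refine (norm_sub_le _ _).trans (add_le_add_left ((norm_add_le _ _).trans ?_) _)
      rw [norm_neg]
      exact add_le_add_left (hpT _) _
    have hp1 := hpδ (m + γ)
    have hq1 := hqδ m
    rw [norm_mul, norm_inv, norm_inv]
    -- The choice of K makes the two symbol values sum to at least 2Λ, so one of them is at least Λ;
    -- the other is at least δ.
    rcases le_total Λ ‖p (m + γ)‖ with h | h
    · rw [mul_comm]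
      exact mul_le_mul (inv_anti₀ hδ hq1) (inv_anti₀ hΛ0 h) (by positivity) (by positivity)
    · have h4 : Λ ≤ ‖crSym b (-s) ν m‖ := by linarith
      exact mul_le_mul (inv_anti₀ hδ hp1) (inv_anti₀ hΛ0 h4) (by positivity) (by positivity)
  have hfirst : ‖P ∘L W ∘L Q‖ ≤ ε / 2 := by
    have hWn : ‖W‖ ≤ ε * δ ^ 2 / 2 := norm_mulL2_le _ (by positivity) ha
    calc ‖P ∘L W ∘L Q‖ ≤ ‖P‖ * (‖W‖ * ‖Q‖) :=
          (ContinuousLinearMap.opNorm_comp_le _ _).trans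
            (mul_le_mul_of_nonneg_left (ContinuousLinearMap.opNorm_comp_le _ _) (norm_nonneg _))
      _ ≤ δ⁻¹ * (ε * δ ^ 2 / 2 * δ⁻¹) := by gcongr
      _ = ε / 2 := by field_simp
  rw [hE]
  calc _ ≤ ‖P ∘L W ∘L Q‖ + ∑ m ∈ a.support, ‖a m •
      (P ∘L mulL2 b (chi b m) (memLp_top_of_continuous (continuous_chi m)) ∘L Q)‖ :=
        (norm_add_le _ _).trans (add_le_add le_rfl (norm_sum_le _ _))
    _ ≤ ε / 2 + ∑ m ∈ a.support, ‖a m‖ * (δ⁻¹ * Λ⁻¹) :=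
        add_le_add hfirst (Finset.sum_le_sum hterm)
    _ = ε / 2 + S * (δ⁻¹ * Λ⁻¹) := by rw [← Finset.sum_mul]
    _ ≤ ε / 2 + ε / 2 := by
        refine add_le_add le_rfl ?_
        rw [hΛ]
        have : S * (δ⁻¹ * (2 * (S + 1) / (δ * ε))⁻¹) = S * ε / (2 * (S + 1)) := by
          field_simp
        rw [this, div_le_iff₀ (by positivity)]
        nlinarith
    _ = ε := add_halves ε

end Smallness

/-! ### Dependence on the spectral parameter -/

namespace Coefficients

variable {b : Module.Basis (Fin 2) ℝ Plane} {c : Coefficients b} {φ : Plane → ℝ}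

/-- The spectral parameter shifts the symbol by a constant, which is the form required by
`differentiableAt_invOp`. -/
theorem crSym_add (σ μ z : ℂ) : crSym b σ (z + μ) = fun m => crSym b σ μ m + z := by
  funext m
  simp only [crSym]
  ring

theorem modSym_add (s : ℝ) (μ z t : ℂ) (m₀ : Fin 2 → ℤ) :
    modSym b s (z + μ) m₀ t = fun m => modSym b s μ m₀ t m + z := by
  funext m
  simp only [modSym, crSym_add]
  ring

theorem differentiableAt_ringInverse {E : Type*} [NormedAddCommGroup E] [NormedSpace ℂ E]
    [CompleteSpace E] {f : ℂ → E →L[ℂ] E} {z : ℂ} (hf : DifferentiableAt ℂ f z)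
    (hu : IsUnit (f z)) : DifferentiableAt ℂ (fun ζ => Ring.inverse (f ζ)) z :=
  DifferentiableAt.comp (g := Ring.inverse) z (differentiableAt_inverse hu) hf

theorem differentiableAt_principalInv (hφ : c.IsGauge φ) (s : ℝ) {μ ν t z : ℂ}
    {m₀ : Fin 2 → ℤ} (hp : ∀ᶠ ζ in nhds z, IsElliptic b (modSym b s (ζ + μ) m₀ t))
    (hq : ∀ᶠ ζ in nhds z, IsElliptic b (crSym b (-s) (ζ - ν))) :
    DifferentiableAt ℂ
      (fun ζ => principalInv hφ s (modSym b s (ζ + μ) m₀ t) (crSym b (-s) (ζ - ν))) z := by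
  simp only [sub_eq_add_neg, crSym_add, modSym_add] at hp hq ⊢
  simp only [principalInv]
  refine (differentiableAt_invOp hp).clm_comp ((differentiableAt_const _).clm_comp
    ((differentiableAt_const _).clm_comp (differentiableAt_invOp hq)))

theorem differentiableAt_perturbedInv (hφ : c.IsGauge φ) (s : ℝ) {μ ν t z : ℂ}
    {m₀ : Fin 2 → ℤ} (hp : ∀ᶠ ζ in nhds z, IsElliptic b (modSym b s (ζ + μ) m₀ t))
    (hq : ∀ᶠ ζ in nhds z, IsElliptic b (crSym b (-s) (ζ - ν)))
    (hu : IsUnit (1 + potentialL hφ s ∘L valL b ∘L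
      principalInv hφ s (modSym b s (z + μ) m₀ t) (crSym b (-s) (z - ν)))) :
    DifferentiableAt ℂ
      (fun ζ => perturbedInv hφ s (modSym b s (ζ + μ) m₀ t) (crSym b (-s) (ζ - ν))) z := by
  have h := differentiableAt_principalInv hφ s hp hq
  simp only [perturbedInv]
  refine h.clm_comp (differentiableAt_ringInverse (f := fun ζ => 1 + potentialL hφ s ∘L valL b ∘L
      principalInv hφ s (modSym b s (ζ + μ) m₀ t) (crSym b (-s) (ζ - ν))) ?_ hu)
  exact ((differentiableAt_const _).clm_comp ((differentiableAt_const _).clm_comp h)).const_add 1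

theorem modeVec_add (hφ : c.IsGauge φ) (s : ℝ) (ζ ν : ℂ) (m : Fin 2 → ℤ) :
    modeVec hφ s (ζ - ν) m = modeVec hφ s (-ν) m
      + ζ • H1.val b (mulH1 b (weight φ s) (isC1Per_weight hφ s) (chiH1 b m)) := by
  simp only [modeVec, crOp, add_apply, smul_apply, valL_apply]
  module

theorem differentiable_modeVec (hφ : c.IsGauge φ) (s : ℝ) (ν : ℂ) (m : Fin 2 → ℤ) :
    Differentiable ℂ fun ζ => modeVec hφ s (ζ - ν) m := by
  simp only [modeVec_add hφ s _ ν]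
  fun_prop

theorem differentiableAt_det (hφ : c.IsGauge φ) (s : ℝ) {μ ν t z : ℂ}
    {m₀ : Fin 2 → ℤ} (hp : ∀ᶠ ζ in nhds z, IsElliptic b (modSym b s (ζ + μ) m₀ t))
    (hq : ∀ᶠ ζ in nhds z, IsElliptic b (crSym b (-s) (ζ - ν)))
    (hu : IsUnit (1 + potentialL hφ s ∘L valL b ∘L
      principalInv hφ s (modSym b s (z + μ) m₀ t) (crSym b (-s) (z - ν)))) :
    DifferentiableAt ℂ
      (fun ζ => det hφ s (modSym b s (ζ + μ) m₀ t) (crSym b (-s) (ζ - ν)) (ζ - ν) t m₀) z := by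
  have h1 := (differentiableAt_perturbedInv hφ s hp hq hu).clm_apply
    (differentiable_modeVec hφ s ν m₀ z)
  have h2 := ((coef b m₀ ∘L valL b).differentiableAt).comp z h1
  exact ((h2.const_mul _).const_mul t).const_sub 1

theorem differentiableAt_modifiedInv (hφ : c.IsGauge φ) (s : ℝ) {μ ν t z : ℂ}
    {m₀ : Fin 2 → ℤ} (hp : ∀ᶠ ζ in nhds z, IsElliptic b (modSym b s (ζ + μ) m₀ t))
    (hq : ∀ᶠ ζ in nhds z, IsElliptic b (crSym b (-s) (ζ - ν)))
    (hu : IsUnit (1 + potentialL hφ s ∘L valL b ∘L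
      principalInv hφ s (modSym b s (z + μ) m₀ t) (crSym b (-s) (z - ν)))) :
    DifferentiableAt ℂ
      (fun ζ => modifiedInv hφ s (modSym b s (ζ + μ) m₀ t) (crSym b (-s) (ζ - ν))) z :=
  (differentiableAt_const _).clm_comp
    ((differentiableAt_perturbedInv hφ s hp hq hu).clm_comp (differentiableAt_const _))

end Coefficients

/-! ### Separation of the zeros of the symbols -/

section Separation

variable {α β : ℝ} {b : Module.Basis (Fin 2) ℝ Plane}

theorem repr_eq_inner_dualVec
    (hb : ∀ i j : Fin 2, inner ℝ (b i) (dualVec α β j) = if i = j then (1 : ℝ) else 0)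
    (x : Plane) (i : Fin 2) : b.repr x i = inner ℝ (dualVec α β i) x := by
  have h : b.coord i = (innerSL ℝ (dualVec α β i)).toLinearMap := by
    refine b.ext fun j => ?_
    have := hb j i
    rw [real_inner_comm] at this
    simp [Finsupp.single_apply, this]
  exact LinearMap.congr_fun h x

theorem dual_ne_zero
    (hb : ∀ i j : Fin 2, inner ℝ (b i) (dualVec α β j) = if i = j then (1 : ℝ) else 0) :
    α ≠ 0 := by
  rintro rfl
  have := hb 0 0
  simp [dualVec, PiLp.inner_apply, Fin.sum_univ_two] at this

theorem freq_zero_eq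
    (hb : ∀ i j : Fin 2, inner ℝ (b i) (dualVec α β j) = if i = j then (1 : ℝ) else 0)
    (m : Fin 2 → ℤ) : freq b m 0 = 2 * Real.pi * (m 0 * α + m 1 * β) := by
  rw [freq, phase_apply, Fin.sum_univ_two, repr_eq_inner_dualVec hb, repr_eq_inner_dualVec hb]
  simp [dualVec, PiLp.inner_apply]

theorem freq_one_eq
    (hb : ∀ i j : Fin 2, inner ℝ (b i) (dualVec α β j) = if i = j then (1 : ℝ) else 0)
    (m : Fin 2 → ℤ) : freq b m 1 = 2 * Real.pi * m 1 := by
  rw [freq, phase_apply, Fin.sum_univ_two, repr_eq_inner_dualVec hb, repr_eq_inner_dualVec hb]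
  simp [dualVec, PiLp.inner_apply]

/-- The parameter μ cancels. If the second indices differ, the imaginary part is a nonzero multiple
of 2π; otherwise the real part is a nonzero multiple of 2πα. -/
theorem le_norm_crSym_sub
    (hb : ∀ i j : Fin 2, inner ℝ (b i) (dualVec α β j) = if i = j then (1 : ℝ) else 0)
    {s : ℝ} (hs : s = 1 ∨ s = -1) (μ : ℂ) {m m' : Fin 2 → ℤ} (hm : m ≠ m') :
    min Real.pi (2 * Real.pi * |α|) ≤ ‖crSym b s μ m - crSym b s μ m'‖ := by
  have hπ := Real.pi_pos
  have hre : (crSym b s μ m - crSym b s μ m').re = freq b m 0 - freq b m' 0 := by simp [crSym]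
  have him : (crSym b s μ m - crSym b s μ m').im = s * (freq b m 1 - freq b m' 1) := by
    simp [crSym]; ring
  rw [freq_zero_eq hb, freq_zero_eq hb] at hre
  rw [freq_one_eq hb, freq_one_eq hb] at him
  have hint : ∀ k : ℤ, k ≠ 0 → (1 : ℝ) ≤ |(k : ℝ)| := fun k hk => by
    exact_mod_cast Int.one_le_abs hk
  have hs1 : |s| = 1 := by rcases hs with rfl | rfl <;> simp
  by_cases h1 : m 1 = m' 1
  · have h0 : m 0 ≠ m' 0 := fun h0 => hm (funext fun i => by fin_cases i <;> assumption)
    refine (min_le_right _ _).trans (le_trans ?_ (Complex.abs_re_le_norm _))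
    have : 2 * Real.pi * (m 0 * α + m' 1 * β) - 2 * Real.pi * (m' 0 * α + m' 1 * β)
      = 2 * Real.pi * α * ((m 0 - m' 0 : ℤ) : ℝ) := by push_cast; ring
    rw [hre, h1, this, abs_mul, abs_mul, abs_of_pos Real.two_pi_pos]
    exact le_mul_of_one_le_right (by positivity) (hint _ (sub_ne_zero.2 h0))
  · refine (min_le_left _ _).trans (le_trans ?_ (Complex.abs_im_le_norm _))
    have : s * (2 * Real.pi * m 1 - 2 * Real.pi * m' 1)
      = s * (2 * Real.pi * ((m 1 - m' 1 : ℤ) : ℝ)) := by push_cast; ring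
    rw [him, this, abs_mul, hs1, one_mul, abs_mul, abs_of_pos Real.two_pi_pos]
    have := hint _ (sub_ne_zero.2 h1)
    nlinarith

/-- The imaginary part of the difference is, up to sign, π(2(m₁ + m₁' + 2n) + 1), where m₁ and m₁'
are the entries at index 1. An odd multiple of π cannot vanish; this is the role of the π/2 in Re
k₂. -/
theorem le_norm_crSym_sub_neg
    (hb : ∀ i j : Fin 2, inner ℝ (b i) (dualVec α β j) = if i = j then (1 : ℝ) else 0)
    {s : ℝ} (hs : s = 1 ∨ s = -1) {k₂ : ℂ} {n : ℤ} (hk : k₂.re = Real.pi / 2 + 2 * Real.pi * n)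
    (z : ℂ) (m m' : Fin 2 → ℤ) :
    Real.pi ≤ ‖crSym b s (z + s * Complex.I * k₂) m
      - crSym b (-s) (z - s * Complex.I * k₂) m'‖ := by
  have him : (crSym b s (z + s * Complex.I * k₂) m
      - crSym b (-s) (z - s * Complex.I * k₂) m').im
      = s * (freq b m 1 + freq b m' 1 + 2 * k₂.re) := by
    simp [crSym]; ring
  rw [freq_one_eq hb, freq_one_eq hb, hk] at him
  have hs1 : |s| = 1 := by rcases hs with rfl | rfl <;> simp
  refine le_trans ?_ (Complex.abs_im_le_norm _)
  have : s * (2 * Real.pi * m 1 + 2 * Real.pi * m' 1 + 2 * (Real.pi / 2 + 2 * Real.pi * n))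
    = s * (Real.pi * ((2 * (m 1 + m' 1 + 2 * n) + 1 : ℤ) : ℝ)) := by push_cast; ring
  rw [him, this, abs_mul, hs1, one_mul, abs_mul, abs_of_pos Real.pi_pos]
  have h1 : (1 : ℝ) ≤ |((2 * (m 1 + m' 1 + 2 * n) + 1 : ℤ) : ℝ)| := by
    exact_mod_cast Int.one_le_abs (by omega)
  exact le_mul_of_one_le_right Real.pi_pos.le h1

end Separation

/-! ### Auxiliary facts on families of bounded operators -/

section Families

variable {E F G : Type*} [NormedAddCommGroup E] [NormedSpace ℂ E] [NormedAddCommGroup F]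
  [NormedSpace ℂ F] [NormedAddCommGroup G] [NormedSpace ℂ G]

theorem differentiable_add_smul (S B : E →L[ℂ] F) : Differentiable ℂ fun z : ℂ => S + z • B :=
  (differentiable_id.smul_const B).const_add S

theorem differentiable_sub_comp (S : E →L[ℂ] G) (C V : F →L[ℂ] G) (M : E →L[ℂ] F) :
    Differentiable ℂ fun z : ℂ => S - (C - z • V) ∘L M := fun _ =>
  (((differentiableAt_id.smul_const V).const_sub C).clm_comp (differentiableAt_const M)).const_sub S

theorem differentiableAt_neg_comp_smulRight {L : ℂ → F →L[ℂ] E} {N : ℂ → G →L[ℂ] F}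
    {R : ℂ → E →L[ℂ] G} {β : ℂ → G} {z : ℂ} (hL : DifferentiableAt ℂ L z)
    (hN : DifferentiableAt ℂ N z) (hR : DifferentiableAt ℂ R z) (hβ : DifferentiableAt ℂ β z)
    (ℓ : F →L[ℂ] ℂ) :
    DifferentiableAt ℂ (fun ζ => -(L ζ ∘L N ζ ∘L ℓ.smulRight (β ζ) ∘L N ζ ∘L R ζ)) z := by
  have h : DifferentiableAt ℂ (fun ζ => ℓ.smulRight (β ζ)) z :=
    (ContinuousLinearMap.smulRightL ℂ F G ℓ).differentiableAt.comp z hβ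
  exact (hL.clm_comp (hN.clm_comp (h.clm_comp (hN.clm_comp hR)))).neg

theorem continuousAt_sub_comp {L : ℂ → F →L[ℂ] E} {N : ℂ → G →L[ℂ] F}
    {R : ℂ → E →L[ℂ] G} {z : ℂ} (hL : DifferentiableAt ℂ L z)
    (hN : DifferentiableAt ℂ N z) (hR : DifferentiableAt ℂ R z) (S : E →L[ℂ] E) :
    ContinuousAt (fun ζ => S - L ζ ∘L N ζ ∘L R ζ) z :=
  ((hL.clm_comp (hN.clm_comp hR)).const_sub S).continuousAt

theorem IsResolventAt.sub_comp_rankOne {T : E →ₗ.[ℂ] E} {z : ℂ} {S : E →L[ℂ] E} {L : F →L[ℂ] E}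
    {N : G →L[ℂ] F} {R : E →L[ℂ] G} {ℓ : F →L[ℂ] ℂ} {β : G} {d : ℂ}
    (h : IsResolventAt T z (S - L ∘L (N + d • (N ∘L ℓ.smulRight β ∘L N)) ∘L R)) :
    IsResolventAt T z (S - L ∘L N ∘L R + d • -(L ∘L N ∘L ℓ.smulRight β ∘L N ∘L R)) := by
  have e : S - L ∘L (N + d • (N ∘L ℓ.smulRight β ∘L N)) ∘L R
      = S - L ∘L N ∘L R + d • -(L ∘L N ∘L ℓ.smulRight β ∘L N ∘L R) := by
    ext1 x
    simp only [sub_apply, ContinuousLinearMap.comp_apply, add_apply, smul_apply, neg_apply,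
      ContinuousLinearMap.smulRight_apply, map_add, map_smul]
    module
  rwa [← e]

end Families

namespace Coefficients

variable {b : Module.Basis (Fin 2) ℝ Plane} {c : Coefficients b} {φ : Plane → ℝ}

/-! ### The spectrum near and far from the zeros of the symbols -/

theorem modSym_zero (b : Module.Basis (Fin 2) ℝ Plane) (s : ℝ) (μ : ℂ) (m₀ : Fin 2 → ℤ) :
    modSym b s μ m₀ 0 = crSym b s μ := by
  funext m
  simp [modSym]

theorem norm_modSym_sub_le (b : Module.Basis (Fin 2) ℝ Plane) (s : ℝ) (μ : ℂ) (m₀ : Fin 2 → ℤ)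
    (t : ℂ) (m : Fin 2 → ℤ) : ‖modSym b s μ m₀ t m - crSym b s μ m‖ ≤ ‖t‖ := by
  rw [modSym, add_sub_cancel_left]
  split_ifs <;> simp

theorem isElliptic_crSym {σ μ : ℂ} (hσ : σ = 1 ∨ σ = -1) {δ : ℝ} (hδ : 0 < δ)
    (h : ∀ m, δ ≤ ‖crSym b σ μ m‖) : IsElliptic b (crSym b σ μ) :=
  isElliptic_of_le hσ hδ h (t := 0) fun m => by rw [sub_self, norm_zero]

theorem isUnit_one_add_potentialL (hφ : c.IsGauge φ) (s : ℝ) {E : L2 b →L[ℂ] H1 b}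
    (h : ‖potentialL hφ s‖ * ‖valL b ∘L E‖ < 1) : IsUnit (1 + potentialL hφ s ∘L valL b ∘L E) := by
  have := isUnit_one_sub_of_norm_lt_one (x := -(potentialL hφ s ∘L valL b ∘L E))
    (by rw [norm_neg]; exact (ContinuousLinearMap.opNorm_comp_le _ _).trans_lt h)
  rwa [sub_neg_eq_add] at this

/-- Points away from the zeros of both symbols are in the resolvent set. -/
theorem notMem_spec_of_le (hφ : c.IsGauge φ) {s : ℝ} (hs : s = 1 ∨ s = -1) {z k₂ : ℂ}
    {δ : ℝ} (hδ : 0 < δ) (hp : ∀ m, δ ≤ ‖crSym b s (z + s * Complex.I * k₂) m‖)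
    (hq : ∀ m, δ ≤ ‖crSym b (-s) (z - s * Complex.I * k₂) m‖)
    (hsmall : ‖potentialL hφ s‖ * ‖valL b ∘L principalInv hφ s
      (crSym b s (z + s * Complex.I * k₂)) (crSym b (-s) (z - s * Complex.I * k₂))‖ < 1) :
    z ∉ spec (c.T1 k₂ 0) := by
  have hsc : (s : ℂ) = 1 ∨ (s : ℂ) = -1 := by rcases hs with rfl | rfl <;> simp
  have hsc' : -(s : ℂ) = 1 ∨ -(s : ℂ) = -1 := by rcases hs with rfl | rfl <;> simp
  -- No modification is needed here: with t = 0 the determinant is 1, and the index 0 is a dummy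
  -- value.
  have hd : det hφ s (crSym b s (z + s * Complex.I * k₂)) (crSym b (-s) (z - s * Complex.I * k₂))
      (z - s * Complex.I * k₂) 0 0 ≠ 0 := by simp [det]
  have h := isInverseOf_hamiltonian hφ hs (modSym_zero b s _ 0).symm rfl
    (isElliptic_crSym hsc hδ hp) (isElliptic_crSym hsc' hδ hq)
    (isUnit_one_add_potentialL hφ s hsmall) hd
  exact (c.isResolventAt_T1 h).notMem_spec

/-- A function of the form `p / (p + t)` with a small holomorphic perturbation has nonzero
derivative. -/
theorem deriv_ne_zero_of_near {d : ℂ → ℂ} {z a : ℂ} {δ : ℝ} (hδ : 0 < δ)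
    (hd : DifferentiableOn ℂ d (Metric.ball z δ)) (ha : ‖z + a‖ < 4 * δ)
    (ha' : ∀ ζ ∈ Metric.ball z δ, δ ≤ ‖ζ + a‖)
    (hb : ∀ ζ ∈ Metric.ball z δ, ‖d ζ - (1 - ((3 * δ : ℝ) : ℂ) / (ζ + a))‖ ≤ 3 / 100) :
    deriv d z ≠ 0 := by
  intro h0
  have hz : z ∈ Metric.ball z δ := Metric.mem_ball_self hδ
  have hne : ∀ ζ ∈ Metric.ball z δ, ζ + a ≠ 0 := fun ζ hζ =>
    norm_pos_iff.1 (hδ.trans_le (ha' ζ hζ))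
  have hm : DifferentiableOn ℂ (fun ζ => 1 - ((3 * δ : ℝ) : ℂ) / (ζ + a)) (Metric.ball z δ) := by
    intro ζ hζ
    refine DifferentiableAt.differentiableWithinAt ?_
    have := hne ζ hζ
    fun_prop (disch := assumption)
  have hg : DifferentiableOn ℂ (fun ζ => d ζ - (1 - ((3 * δ : ℝ) : ℂ) / (ζ + a)))
      (Metric.ball z δ) := hd.sub hm
  have hsub : Metric.closedBall z (δ / 2) ⊆ Metric.ball z δ :=
    Metric.closedBall_subset_ball (by linarith)
  -- Cauchy's estimate bounds the derivative of the error by (3/100)/(δ/2) = 0.06/δ, whereas the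
  -- model derivative 3δ/(z + a)² exceeds 3/(16δ) in modulus.
  have hC := Complex.norm_deriv_le_of_forall_mem_sphere_norm_le (c := z) (R := δ / 2)
    (C := 3 / 100) (half_pos hδ)
    (hg.diffContOnCl_ball hsub)
    fun ζ hζ => hb ζ (hsub (Metric.sphere_subset_closedBall hζ))
  have h1 : HasDerivAt (fun ζ => 1 - ((3 * δ : ℝ) : ℂ) / (ζ + a))
      (((3 * δ : ℝ) : ℂ) / (z + a) ^ 2) z := by
    have h2 := (((hasDerivAt_id z).add_const a).fun_inv (hne z hz)).const_mul ((3 * δ : ℝ) : ℂ)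
    have h3 := h2.const_sub 1
    simp only [id, div_eq_mul_inv] at h3 ⊢
    exact h3.congr_deriv (by ring)
  have hdz := (hd.differentiableAt (Metric.isOpen_ball.mem_nhds hz)).hasDerivAt
  rw [(hdz.fun_sub h1).deriv, h0, zero_sub, norm_neg, norm_div, norm_pow, Complex.norm_real,
    Real.norm_of_nonneg (by positivity)] at hC
  have hp := ha' z hz
  have h4 : 0 < ‖z + a‖ := hδ.trans_le hp
  rw [div_le_div_iff₀ (by positivity) (by positivity)] at hC
  have h5 : ‖z + a‖ ^ 2 < 16 * δ ^ 2 := by nlinarith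
  nlinarith

/-- The correction of rank one in the resolvent of `T₁(k₂)` near a zero of a symbol. -/
def rankOneL (hφ : c.IsGauge φ) (s : ℝ) (G : L2 b →L[ℂ] H1 b) (z ν t : ℂ) (m₀ : Fin 2 → ℤ) :
    StateSpace b →L[ℂ] StateSpace b :=
  -(c.lift z ∘L G ∘L (t • modeCoef hφ s m₀).smulRight
      (thetaL hφ s (modeVec hφ s (z - ν) m₀)) ∘L G ∘L c.reduce z)

/-- Displays the functional and the vector required by the hypothesis `hrank` of
`isSimpleEigenvalue_of_local`. -/
theorem rankOneL_apply (hφ : c.IsGauge φ) (s : ℝ) (G : L2 b →L[ℂ] H1 b) (z ν t : ℂ)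
    (m₀ : Fin 2 → ℤ) (x : StateSpace b) : rankOneL hφ s G z ν t m₀ x
      = (-(t • modeCoef hφ s m₀) (G (c.reduce z x)))
        • c.lift z (G (thetaL hφ s (modeVec hφ s (z - ν) m₀))) := by
  have : rankOneL hφ s G z ν t m₀ x = -c.lift z (G ((t • modeCoef hφ s m₀) (G (c.reduce z x))
    • thetaL hφ s (modeVec hφ s (z - ν) m₀))) := rfl
  rw [this, map_smul, map_smul, neg_smul]

theorem differentiable_lift (c : Coefficients b) : Differentiable ℂ c.lift :=
  differentiable_add_smul _ _

theorem differentiable_reduce (c : Coefficients b) : Differentiable ℂ c.reduce :=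
  differentiable_sub_comp _ _ _ _

theorem differentiableAt_rankOneL (hφ : c.IsGauge φ) (s : ℝ) {G : ℂ → L2 b →L[ℂ] H1 b} {z : ℂ}
    (hG : DifferentiableAt ℂ G z) (ν t : ℂ) (m₀ : Fin 2 → ℤ) :
    DifferentiableAt ℂ (fun ζ => rankOneL hφ s (G ζ) ζ ν t m₀) z :=
  differentiableAt_neg_comp_smulRight (c.differentiable_lift z) hG (c.differentiable_reduce z)
    ((thetaL hφ s).differentiableAt.comp z (differentiable_modeVec hφ s ν m₀ z)) _

/-- The resolvent of `T₁(k₂)` in terms of the determinant. -/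
theorem isResolventAt_T1_of_det_ne_zero (hφ : c.IsGauge φ) {s : ℝ} (hs : s = 1 ∨ s = -1)
    {z k₂ t : ℂ} {m₀ : Fin 2 → ℤ} {p q : (Fin 2 → ℤ) → ℂ}
    (hpe : p = modSym b s (z + s * Complex.I * k₂) m₀ t)
    (hqe : q = crSym b (-s) (z - s * Complex.I * k₂)) (hp : IsElliptic b p) (hq : IsElliptic b q)
    (hu : IsUnit (1 + potentialL hφ s ∘L valL b ∘L principalInv hφ s p q))
    (hd : det hφ s p q (z - s * Complex.I * k₂) t m₀ ≠ 0) :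
    IsResolventAt (c.T1 k₂ 0) z (c.shift - c.lift z ∘L modifiedInv hφ s p q ∘L c.reduce z
      + (det hφ s p q (z - s * Complex.I * k₂) t m₀)⁻¹
        • rankOneL hφ s (modifiedInv hφ s p q) z (s * Complex.I * k₂) t m₀) :=
  (c.isResolventAt_T1 (isInverseOf_hamiltonian hφ hs hpe hqe hp hq hu hd)).sub_comp_rankOne

/-- Points of the spectrum near a zero of a symbol are simple eigenvalues. -/
theorem isSimpleEigenvalue_of_near (hφ : c.IsGauge φ) {s : ℝ} (hs : s = 1 ∨ s = -1) {z k₂ : ℂ}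
    {m₀ : Fin 2 → ℤ} {δ : ℝ} (hδ : 0 < δ)
    (h₀ : ‖crSym b s (z + s * Complex.I * k₂) m₀‖ < δ)
    (hp : ∀ m, m ≠ m₀ → 2 * δ ≤ ‖crSym b s (z + s * Complex.I * k₂) m‖)
    (hq : ∀ m, 2 * δ ≤ ‖crSym b (-s) (z - s * Complex.I * k₂) m‖)
    (hsmall : ∀ p μ, IsElliptic b p → IsElliptic b (crSym b (-s) (μ - s * Complex.I * k₂)) →
      (∀ m, δ ≤ ‖p m‖) → (∀ m, δ ≤ ‖crSym b (-s) (μ - s * Complex.I * k₂) m‖) →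
      (∀ m, ‖p m - crSym b s (μ + s * Complex.I * k₂) m‖ ≤ 3 * δ) →
      ‖potentialL hφ s‖ * ‖valL b ∘L
        principalInv hφ s p (crSym b (-s) (μ - s * Complex.I * k₂))‖ ≤ 1 / 200)
    (hz : z ∈ spec (c.T1 k₂ 0)) : IsSimpleEigenvalue (c.T1 k₂ 0) z := by
  have hsc : (s : ℂ) = 1 ∨ (s : ℂ) = -1 := by rcases hs with rfl | rfl <;> simp
  have hsc' : -(s : ℂ) = 1 ∨ -(s : ℂ) = -1 := by rcases hs with rfl | rfl <;> simp
  set ν : ℂ := s * Complex.I * k₂ with hν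
  -- On the disc of radius δ about z the symbol value at m₀ stays below 2δ, so adding 3δ keeps it
  -- above δ. At z itself the modified value stays below 4δ.
  set t : ℂ := ((3 * δ : ℝ) : ℂ) with ht
  have htn : ‖t‖ = 3 * δ := by rw [ht, Complex.norm_real, Real.norm_of_nonneg (by positivity)]
  set U := Metric.ball z δ with hU
  have hzU : z ∈ U := Metric.mem_ball_self hδ
  have hUn : ∀ ζ ∈ U, ∀ᶠ ξ in nhds ζ, ξ ∈ U := fun ζ hζ => Metric.isOpen_ball.mem_nhds hζ
  have hadd : ∀ (σ η ζ : ℂ) m, crSym b σ (ζ + η) m = crSym b σ (z + η) m + (ζ - z) := by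
    intro σ η ζ m
    simp only [crSym]
    ring
  have hnear : ∀ ζ ∈ U, ‖ζ - z‖ < δ := fun ζ hζ => by rwa [← dist_eq_norm]
  have hpδ : ∀ ζ ∈ U, ∀ m, δ ≤ ‖modSym b s (ζ + ν) m₀ t m‖ := by
    intro ζ hζ m
    have h1 := hnear ζ hζ
    rw [modSym, hadd]
    split_ifs with h
    · have h2 := norm_sub_le (crSym b s (z + ν) m + (ζ - z) + t) (crSym b s (z + ν) m + (ζ - z))
      rw [add_sub_cancel_left, htn] at h2
      have h3 := norm_add_le (crSym b s (z + ν) m) (ζ - z)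
      rw [h] at h2 h3 ⊢
      linarith
    · rw [add_zero]
      have h2 := norm_sub_le (crSym b s (z + ν) m + (ζ - z)) (ζ - z)
      rw [add_sub_cancel_right] at h2
      have := hp m h
      linarith
  have hqδ : ∀ ζ ∈ U, ∀ m, δ ≤ ‖crSym b (-s) (ζ - ν) m‖ := by
    intro ζ hζ m
    have h1 := hnear ζ hζ
    have h2 := norm_sub_le (crSym b (-s) (z - ν) m + (ζ - z)) (ζ - z)
    rw [add_sub_cancel_right] at h2
    have := hq m
    rw [sub_eq_add_neg ζ ν, hadd, ← sub_eq_add_neg]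
    linarith
  have hpe : ∀ ζ ∈ U, IsElliptic b (modSym b s (ζ + ν) m₀ t) := fun ζ hζ =>
    isElliptic_of_le hsc hδ (hpδ ζ hζ) fun m => norm_modSym_sub_le b s _ m₀ t m
  have hqe : ∀ ζ ∈ U, IsElliptic b (crSym b (-s) (ζ - ν)) := fun ζ hζ =>
    isElliptic_crSym hsc' hδ (hqδ ζ hζ)
  have hsm : ∀ ζ ∈ U, ‖potentialL hφ s‖ * ‖valL b ∘L principalInv hφ s
      (modSym b s (ζ + ν) m₀ t) (crSym b (-s) (ζ - ν))‖ ≤ 1 / 200 := fun ζ hζ =>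
    hsmall _ ζ (hpe ζ hζ) (hqe ζ hζ) (hpδ ζ hζ) (hqδ ζ hζ) fun m =>
      (norm_modSym_sub_le b s _ m₀ t m).trans htn.le
  have hu : ∀ ζ ∈ U, IsUnit (1 + potentialL hφ s ∘L valL b ∘L principalInv hφ s
      (modSym b s (ζ + ν) m₀ t) (crSym b (-s) (ζ - ν))) := fun ζ hζ =>
    isUnit_one_add_potentialL hφ s ((hsm ζ hζ).trans_lt (by norm_num))
  have hpz := (hUn z hzU).mono hpe
  have hqz := (hUn z hzU).mono hqe
  have hdet : ∀ ζ ∈ U, DifferentiableAt ℂ (fun ζ => det hφ s (modSym b s (ζ + ν) m₀ t)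
      (crSym b (-s) (ζ - ν)) (ζ - ν) t m₀) ζ := fun ζ hζ =>
    differentiableAt_det hφ s ((hUn ζ hζ).mono hpe) ((hUn ζ hζ).mono hqe) (hu ζ hζ)
  set a : ℂ := crSym b s ν m₀ + t with ha
  have hpa : ∀ ζ, modSym b s (ζ + ν) m₀ t m₀ = ζ + a := fun ζ => by
    rw [modSym, if_pos rfl, ha]
    simp only [crSym]
    ring
  have hder : deriv (fun ζ => det hφ s (modSym b s (ζ + ν) m₀ t)
      (crSym b (-s) (ζ - ν)) (ζ - ν) t m₀) z ≠ 0 := by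
    refine deriv_ne_zero_of_near (a := a) hδ
      (fun ζ hζ => (hdet ζ hζ).differentiableWithinAt) ?_ ?_ ?_
    · rw [← hpa, modSym, if_pos rfl]
      refine (norm_add_le _ _).trans_lt ?_
      rw [htn]
      linarith
    · intro ζ hζ
      rw [← hpa]
      exact hpδ ζ hζ m₀
    · intro ζ hζ
      have h1 := norm_det_sub_le hφ (t := t) (m₀ := m₀) (hpe ζ hζ) (hqe ζ hζ) (hsm ζ hζ)
        (by norm_num)
      rw [hpa] at h1
      refine h1.trans ?_
      have h2 := hpδ ζ hζ m₀
      rw [hpa] at h2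
      -- The error is at most 2 · (1/200) · 3δ/δ = 3/100.
      rw [htn, div_le_iff₀ (hδ.trans_le h2)]
      linarith
  have hG := differentiableAt_modifiedInv hφ s hpz hqz (hu z hzU)
  refine isSimpleEigenvalue_of_local hz
    (N := fun ζ => c.shift - c.lift ζ ∘L
      modifiedInv hφ s (modSym b s (ζ + ν) m₀ t) (crSym b (-s) (ζ - ν)) ∘L c.reduce ζ)
    (F := fun ζ => rankOneL hφ s
      (modifiedInv hφ s (modSym b s (ζ + ν) m₀ t) (crSym b (-s) (ζ - ν))) ζ ν t m₀)
    ?_ (differentiableAt_rankOneL hφ s hG ν t m₀) (hdet z hzU).hasDerivAt hder ?_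
    (rankOneL_apply hφ s _ z ν t m₀)
  · exact continuousAt_sub_comp (c.differentiable_lift z) hG (c.differentiable_reduce z) c.shift
  · filter_upwards [hUn z hzU] with ζ hζ hd
    exact isResolventAt_T1_of_det_ne_zero hφ hs rfl rfl (hpe ζ hζ) (hqe ζ hζ) (hu ζ hζ) hd

/-- The spectrum of `T₁(k₂)` is simple if the imaginary part of `k₂` is large and its real part
separates the zeros of the symbols. -/
theorem exists_hasSimpleSpectrum {α β : ℝ}
    (hb : ∀ i j : Fin 2, inner ℝ (b i) (dualVec α β j) = if i = j then (1 : ℝ) else 0)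
    (c : Coefficients b) : ∃ K : ℝ, ∀ (k₂ : ℂ) (n : ℤ), k₂.re = Real.pi / 2 + 2 * Real.pi * n →
      K ≤ |k₂.im| → HasSimpleSpectrum (c.T1 k₂ 0) := by
  obtain ⟨φ, hφ⟩ := c.exists_isGauge
  have hα := abs_pos.2 (dual_ne_zero hb)
  have hπ := Real.pi_pos
  set Δ := min Real.pi (2 * Real.pi * |α|) with hΔ
  have hΔ0 : 0 < Δ := lt_min hπ (by positivity)
  have hΔπ : Δ ≤ Real.pi := min_le_left _ _
  -- If one symbol value is below δ, the separation Δ = 8δ leaves every other value of both symbols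
  -- above 7δ, more than the 2δ required.
  set δ := Δ / 8 with hδd
  have hδ : 0 < δ := by positivity
  have hK : ∀ s : ℝ, ∃ K : ℝ, s = 1 ∨ s = -1 → ∀ k₂ : ℂ, K ≤ |k₂.im| → ∀ p μ, IsElliptic b p →
      IsElliptic b (crSym b (-s) (μ - s * Complex.I * k₂)) →
      (∀ m, δ ≤ ‖p m‖) → (∀ m, δ ≤ ‖crSym b (-s) (μ - s * Complex.I * k₂) m‖) →
      (∀ m, ‖p m - crSym b s (μ + s * Complex.I * k₂) m‖ ≤ 3 * δ) →
      ‖potentialL hφ s‖ * ‖valL b ∘L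
        principalInv hφ s p (crSym b (-s) (μ - s * Complex.I * k₂))‖ ≤ 1 / 200 := by
    intro s
    -- The potential depends only on the coefficients and s, so K is uniform in k₂ and in the
    -- spectral parameter. The value T = 3δ admits the modified symbols.
    obtain ⟨K, hK⟩ := exists_norm_principalInv_le hφ s (ε := 1 / 200 / (‖potentialL hφ s‖ + 1))
      (T := 3 * δ) (by positivity) hδ
    refine ⟨K, fun hs k₂ hk p μ hp hq hpδ hqδ hpT => ?_⟩
    have h1 : (μ + s * Complex.I * k₂ - (μ - s * Complex.I * k₂)).re = -(2 * s * k₂.im) := by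
      simp
      ring
    have hs1 : |s| = 1 := by rcases hs with rfl | rfl <;> simp
    have h2 := hK p _ _ hp hq hpδ hqδ hpT (by
      rw [h1, abs_neg, abs_mul, abs_mul, hs1, abs_two]
      linarith [abs_nonneg k₂.im])
    refine (mul_le_mul_of_nonneg_left h2 (norm_nonneg _)).trans ?_
    rw [mul_div_assoc', div_le_iff₀ (by positivity)]
    linarith
  choose K hK using hK
  refine ⟨max (K 1) (K (-1)), fun k₂ n hk hkK z hz => ?_⟩
  have hKs : ∀ s : ℝ, s = 1 ∨ s = -1 → K s ≤ |k₂.im| := by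
    rintro s (rfl | rfl)
    · exact (le_max_left _ _).trans hkK
    · exact (le_max_right _ _).trans hkK
  -- Only the inner factor Pₛ is modified, so the sign s is dictated by which symbol is nearly zero
  -- at z.
  by_cases hnear : ∃ s : ℝ, (s = 1 ∨ s = -1) ∧ ∃ m₀,
      ‖crSym b s (z + s * Complex.I * k₂) m₀‖ < δ
  · obtain ⟨s, hs, m₀, hm₀⟩ := hnear
    refine isSimpleEigenvalue_of_near hφ hs hδ hm₀ (fun m hm => ?_) (fun m => ?_)
      (hK s hs k₂ (hKs s hs)) hz
    · have h1 := le_norm_crSym_sub hb hs (z + s * Complex.I * k₂) hm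
      have h2 := norm_sub_le (crSym b s (z + s * Complex.I * k₂) m)
        (crSym b s (z + s * Complex.I * k₂) m₀)
      linarith
    · have h1 := le_norm_crSym_sub_neg hb hs hk z m₀ m
      have h2 := norm_sub_le (crSym b s (z + s * Complex.I * k₂) m₀)
        (crSym b (-s) (z - s * Complex.I * k₂) m)
      linarith
  · push Not at hnear
    have hp := hnear 1 (Or.inl rfl)
    have hq : ∀ m, δ ≤ ‖crSym b (-(1 : ℝ)) (z - (1 : ℝ) * Complex.I * k₂) m‖ := fun m => by
      have := hnear (-1) (Or.inr rfl) m
      push_cast at this ⊢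
      rwa [neg_one_mul, neg_mul, ← sub_eq_add_neg, ← one_mul Complex.I] at this
    -- Far from both zero sets either factorization works; s = 1 is used.
    refine absurd hz (notMem_spec_of_le hφ (Or.inl rfl) hδ hp hq ?_)
    refine (hK 1 (Or.inl rfl) k₂ (hKs 1 (Or.inl rfl)) _ z (isElliptic_crSym (by simp) hδ hp)
      (isElliptic_crSym (by simp) hδ hq) hp hq fun m => ?_).trans_lt (by norm_num)
    rw [sub_self, norm_zero]
    positivity

end Coefficients

end PeriodicSchrodinger

end

/-! ### The choice of l -/

theorem theorem4p3 (α β : ℝ) (b : Module.Basis (Fin 2) ℝ PeriodicSchrodinger.Plane)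
    (hb : ∀ i j : Fin 2,
      inner ℝ (b i) (PeriodicSchrodinger.dualVec α β j) = if i = j then (1 : ℝ) else 0)
    (c : PeriodicSchrodinger.Coefficients b) :
    ∃ l : ℤ, ∀ n : ℤ,
      PeriodicSchrodinger.HasSimpleSpectrum
        (c.T1 ((Real.pi : ℂ) / 2 + 2 * Real.pi * n
          + Complex.I * ((Real.pi : ℂ) / 2 + 2 * Real.pi * l) * α) 0) := by
  obtain ⟨K, hK⟩ := PeriodicSchrodinger.Coefficients.exists_hasSimpleSpectrum hb c
  have hα : 0 < |α| := abs_pos.2 (PeriodicSchrodinger.dual_ne_zero hb)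
  -- For l ≥ 0 one has |Im k₂| = (π/2 + 2πl)|α| ≥ l|α| ≥ K, independently of n.
  obtain ⟨l, hl⟩ := exists_nat_ge (K / |α|)
  rw [div_le_iff₀ hα] at hl
  refine ⟨l, fun n => hK _ n ?_ ?_⟩
  · simp
  · have him : ((Real.pi : ℂ) / 2 + 2 * Real.pi * n
        + Complex.I * ((Real.pi : ℂ) / 2 + 2 * Real.pi * (l : ℤ)) * α).im
        = (Real.pi / 2 + 2 * Real.pi * l) * α := by
      simp
    rw [him, abs_mul, abs_of_nonneg (by positivity)]
    refine hl.trans (mul_le_mul_of_nonneg_right ?_ hα.le)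
    have h0 : (0 : ℝ) ≤ l := Nat.cast_nonneg l
    nlinarith [Real.pi_gt_three]
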